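/- **Setting.** Everything is over $\mathbb C$. Let $(\mathfrak g,B)$ be a finite-dimensional Lie algebra with a nondegenerate symmetric $\mathrm{ad}$-invariant bilinear form, $H_1,\dots,H_p\in\mathfrak g$ pairwise commuting, and $\{e_a\}$ a basis of $\mathfrak g$ with $[H_k,e_a]=r_k(a)e_a$ (for $\mathfrak g$ semisimple: a Cartan–Weyl basis). Put $B_{ab}=B(e_a,e_b)$, let $B^{ab}$ be the inverse matrix, and sum over repeated indices. Let $\theta$ be a generic antisymmetric $p\times p$ matrix; $V[[\theta]]$ denotes formal power series in the entries $\theta^{kl}$, $k<l$, with coefficients in $V$, and all operations below are extended $\mathbb C[[\theta]]$-(bi)linearly and $\theta$-adically continuously. Put $$\chi=\exp\{-\tfrac i2\theta^{kl}H_k\otimes H_l\},\qquad \lambda_a=\exp\{\tfrac i2\theta^{kl}r_k(a)H_l\},\qquad \mathcal R=\chi_{21}\chi^{-1}.$$ Let $A=\bigoplus_{n\in\mathbb Z}A^n$ be a graded-commutative $\tilde{\mathfrak g}$-differential algebra, with Lie derivatives $L_x$, interior derivatives $i_x$ ($x\in\mathfrak g$) and differential $d$; write $i_a=i_{e_a}$,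 $L_a=L_{e_a}$. Its twist $A_\chi$ is $A[[\theta]]$ with the product $a\cdot_\chi b=\cdot(\chi^{-1}\triangleright(a\otimes b))$. Let $\mathcal W$ be the noncommutative Weil algebra: the superalgebra generated by even $e_x$ and odd $\xi_x$, linear in $x\in\mathfrak g$, with super-brackets $[e_x,e_y]=e_{[x,y]}$, $[e_x,\xi_y]=\xi_{[x,y]}$, $[\xi_x,\xi_y]=B(x,y)$; write $\xi_a=\xi_{e_a}$ and $\xi^a=B^{ab}\xi_b$. The twisted Weil algebra $\mathcal W^{\chi}$ is the algebra $\mathcal W[[\theta]]$ with the twisted adjoint action $L_a(X)=e_aX\lambda_a-\lambda_aXe_a$, $i_a(X)=\xi_aX\lambda_a-(-1)^{|X|}\lambda_aX\xi_a$. On $\mathcal W^{\chi}\widehat\otimes A_\chi=(\mathcal W\otimes A)[[\theta]]$ consider, with Koszul signs, the braided product $$(w_1\otimes\nu_1)\cdot(w_2\otimes\nu_2)=(-1)^{|\nu_1||w_2|}\,w_1(\mathcal R^{(2)}\triangleright w_2)\otimes(\mathcal R^{(1)}\triangleright\nu_1)\cdot_\chi\nu_2 ,$$ and the total Lie derivatives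 $L_a^{tot}=\chi(L_a\otimes1+1\otimes L_a)\chi^{-1}$. The twisted Cartan complex is $$\mathcal C=\{x\in \mathcal W^{\chi}\widehat\otimes A_\chi:\ L_a^{tot}x=0,\ (i_a\otimes1)x=0\ \text{ for all }a\}.$$ Let $Q$ be the linear automorphism of $\mathcal W[[\theta]]$ given by $Q(w)=\exp\{\tfrac i2\theta^{kl}s_kH_l\}\,w$ for $w$ of weight $s$ under $(\mathrm{ad}_{H_k})_k$; it identifies the adjoint with the twisted adjoint module and maps $e_a,\xi_a$ to the quantum generators $\lambda_ae_a,\lambda_a\xi_a$. Let $\Phi$ be the Kalkman map $\exp\{\xi^a\otimes i_a\}$ of $\mathcal W\otimes A$, where $(\xi^a\otimes i_a)(w\otimes\nu)=(-1)^{|w|}\xi^aw\otimes i_a\nu$, carried to $\mathcal W^\chi\widehat\otimes A_\chi$ by $Q\otimes1$. The twisted Kalkman map is $\Phi^\chi=\chi\Phi\chi^{-1}$, and it induces the product $$x\odot_\chi y:=\Phi^\chi\big((\Phi^\chi)^{-1}(x)\cdot(\Phi^\chi)^{-1}(y)\big).$$ **Statement.** $\mathcal C$ is closed under $\odot_\chi$,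 and on $\mathcal C$ the product $\odot_\chi$ is the restriction of the bilinear operation determined, for $u_i\in\mathcal W$ and homogeneous $\nu_i\in A$, by $$(u_1\otimes\nu_1)\odot_\chi(u_2\otimes\nu_2)=u_1u_2\otimes(-1)^{|\nu_1||\nu_2|}\;\cdot_\chi\Big(\exp\{\tfrac12B^{ab}\,i_a\otimes i_b\}(\nu_2\otimes\nu_1)\Big).$$ Here the $i_a$ are the twisted interior derivatives: in accordance with the twisted coproduct $\xi_a\mapsto\xi_a\otimes\lambda_a^{-1}+\lambda_a\otimes\xi_a$, the symbol $i_a\otimes i_b$ stands for the composite $(i_a\otimes\lambda_a^{-1})(\lambda_b\otimes i_b)$ on $A_\chi\otimes A_\chi$, with Koszul signs. -/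

import Mathlib

open scoped TensorProduct

noncomputable section

namespace TwistedCartan

/-! ### Formal power series in the entries of an antisymmetric matrix `θ` -/

section Formal

/-- The independent entries `θ^{kl}`, `k < l`, of an antisymmetric `p × p` matrix. -/
abbrev Param (p : ℕ) : Type := {s : Fin p × Fin p // s.1 < s.2}

/-- `V[[θ]]`: formal power series in the `θ^{kl}` with coefficients in `V`
(for `V` a vector space: the topologically free `ℂ[[θ]]`-module on `V`). -/
abbrev Formal (p : ℕ) (V : Type*) : Type _ := MvPowerSeries (Param p) V

variable {p : ℕ} {U V Z : Type*} [AddCommGroup U] [Module ℂ U] [AddCommGroup V] [Module ℂ V]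
  [AddCommGroup Z] [Module ℂ Z]

/-- The constant power series. -/
def const (p : ℕ) : V →ₗ[ℂ] Formal p V where
  toFun v := fun m => if m = 0 then v else 0
  map_add' u v := by
    funext m
    change (if m = 0 then u + v else 0) = (if m = 0 then u else 0) + (if m = 0 then v else 0)
    split_ifs <;> simp
  map_smul' c v := by
    funext m
    change (if m = 0 then c • v else 0) = c • (if m = 0 then v else 0)
    split_ifs <;> simp

/-- Coefficientwise application of a linear map. -/
def fmap (f : V →ₗ[ℂ] Z) : Formal p V →ₗ[ℂ] Formal p Z where
  toFun x := fun m => f (x m)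
  map_add' x y := by
    funext m
    exact map_add f (x m) (y m)
  map_smul' c x := by
    funext m
    exact map_smul f c (x m)

/-- The `ℂ[[θ]]`-bilinear (Cauchy product) extension of a bilinear map. -/
def fmap₂ (β : U →ₗ[ℂ] V →ₗ[ℂ] Z) : Formal p U →ₗ[ℂ] Formal p V →ₗ[ℂ] Formal p Z :=
  LinearMap.mk₂ ℂ
    (fun x y => (fun m => ∑ ij ∈ Finset.HasAntidiagonal.antidiagonal m, β (x ij.1) (y ij.2) : Formal p Z))
    (fun x x' y => by
      funext m
      change ∑ ij ∈ Finset.HasAntidiagonal.antidiagonal m, β (x ij.1 + x' ij.1) (y ij.2) =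
        ∑ ij ∈ Finset.HasAntidiagonal.antidiagonal m, β (x ij.1) (y ij.2) +
          ∑ ij ∈ Finset.HasAntidiagonal.antidiagonal m, β (x' ij.1) (y ij.2)
      simp [Finset.sum_add_distrib])
    (fun c x y => by
      funext m
      change ∑ ij ∈ Finset.HasAntidiagonal.antidiagonal m, β (c • x ij.1) (y ij.2) =
        c • ∑ ij ∈ Finset.HasAntidiagonal.antidiagonal m, β (x ij.1) (y ij.2)
      simp [Finset.smul_sum])
    (fun x y y' => by
      funext m
      change ∑ ij ∈ Finset.HasAntidiagonal.antidiagonal m, β (x ij.1) (y ij.2 + y' ij.2) =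
        ∑ ij ∈ Finset.HasAntidiagonal.antidiagonal m, β (x ij.1) (y ij.2) +
          ∑ ij ∈ Finset.HasAntidiagonal.antidiagonal m, β (x ij.1) (y' ij.2)
      simp [Finset.sum_add_distrib])
    (fun c x y => by
      funext m
      change ∑ ij ∈ Finset.HasAntidiagonal.antidiagonal m, β (x ij.1) (c • y ij.2) =
        c • ∑ ij ∈ Finset.HasAntidiagonal.antidiagonal m, β (x ij.1) (y ij.2)
      simp [Finset.smul_sum])

/-- The `ℂ[[θ]]`-linear, `θ`-adically continuous extension of `F : V → Z[[θ]]` to `V[[θ]]`. -/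
def fextend (F : V →ₗ[ℂ] Formal p Z) : Formal p V →ₗ[ℂ] Formal p Z where
  toFun x := fun m => ∑ ij ∈ Finset.HasAntidiagonal.antidiagonal m, F (x ij.1) ij.2
  map_add' x y := by
    funext m
    change ∑ ij ∈ Finset.HasAntidiagonal.antidiagonal m, F (x ij.1 + y ij.1) ij.2 =
      ∑ ij ∈ Finset.HasAntidiagonal.antidiagonal m, F (x ij.1) ij.2 + ∑ ij ∈ Finset.HasAntidiagonal.antidiagonal m, F (y ij.1) ij.2
    rw [← Finset.sum_add_distrib]
    refine Finset.sum_congr rfl fun ij _ => ?_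
    rw [map_add]
    rfl
  map_smul' c x := by
    funext m
    change ∑ ij ∈ Finset.HasAntidiagonal.antidiagonal m, F (c • x ij.1) ij.2 =
      c • ∑ ij ∈ Finset.HasAntidiagonal.antidiagonal m, F (x ij.1) ij.2
    rw [Finset.smul_sum]
    refine Finset.sum_congr rfl fun ij _ => ?_
    rw [map_smul]
    rfl

/-- The entry `θ^{kl}` of the generic antisymmetric matrix, as a power series. -/
def theta (k l : Fin p) : Formal p ℂ :=
  if h : k < l then MvPowerSeries.X ⟨(k, l), h⟩
  else if h : l < k then -MvPowerSeries.X ⟨(l, k), h⟩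
  else 0

/-- The operator `θ^{kl} Q_{kl}` (summed over `k`, `l`) on `V[[θ]]`. -/
def thetaSum (Q : Fin p → Fin p → Module.End ℂ V) : Module.End ℂ (Formal p V) :=
  ∑ k, ∑ l, fmap₂ (LinearMap.lsmul ℂ V) (theta k l) * fmap (Q k l)

/-- `exp {c θ^{kl} Q_{kl}}` on `V[[θ]]`. The `n`-th power of the exponent raises the degree in `θ`
by `n`, so it contributes to the coefficient of `θ^m` only if `n ≤ |m|`. -/
def thetaExp (c : ℂ) (Q : Fin p → Fin p → Module.End ℂ V) : Module.End ℂ (Formal p V) where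
  toFun x := fun m =>
    ∑ n ∈ Finset.range (m.degree + 1), (c ^ n / (n.factorial : ℂ)) • ((thetaSum Q ^ n) x) m
  map_add' x y := by
    funext m
    simp only [map_add]
    change ∑ n ∈ Finset.range (m.degree + 1), (c ^ n / (n.factorial : ℂ)) •
        (((thetaSum Q ^ n) x) m + ((thetaSum Q ^ n) y) m) =
      ∑ n ∈ Finset.range (m.degree + 1), (c ^ n / (n.factorial : ℂ)) • ((thetaSum Q ^ n) x) m +
      ∑ n ∈ Finset.range (m.degree + 1), (c ^ n / (n.factorial : ℂ)) • ((thetaSum Q ^ n) y) m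
    simp [Finset.sum_add_distrib]
  map_smul' a x := by
    funext m
    simp only [map_smul]
    change ∑ n ∈ Finset.range (m.degree + 1), (c ^ n / (n.factorial : ℂ)) •
        (a • ((thetaSum Q ^ n) x) m) =
      a • ∑ n ∈ Finset.range (m.degree + 1), (c ^ n / (n.factorial : ℂ)) • ((thetaSum Q ^ n) x) m
    rw [Finset.smul_sum]
    exact Finset.sum_congr rfl fun n _ => smul_comm _ _ _

/-- The exponential of a nilpotent element. -/
def nilExp {R : Type*} [Ring R] [Algebra ℂ R] (T : R) : R :=
  ∑ n ∈ Finset.range (nilpotencyClass T), ((n.factorial : ℂ)⁻¹) • T ^ n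

/-- The action of `χ = exp {-(i/2) θ^{kl} H_k ⊗ H_l}` when the `H_k` of the first (second) tensor
factor act by `X k` (`Y k`). -/
def twist (X Y : Fin p → Module.End ℂ V) : Module.End ℂ (Formal p V) :=
  thetaExp (-(Complex.I / 2)) fun k l => X k * Y l

/-- The action of `χ⁻¹ = exp {(i/2) θ^{kl} H_k ⊗ H_l}`. -/
def twistInv (X Y : Fin p → Module.End ℂ V) : Module.End ℂ (Formal p V) :=
  thetaExp (Complex.I / 2) fun k l => X k * Y l

/-- The action of the twisted `R`-matrix `χ₂₁ χ⁻¹`. -/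
def rMatrix (X Y : Fin p → Module.End ℂ V) : Module.End ℂ (Formal p V) :=
  twist Y X * twistInv X Y

/-- If `P`, `Q` are the (commuting) parity involutions of two tensor factors, this is the Koszul
sign `(-1)^{|v||w|}` of these factors. -/
def koszul (P Q : Module.End ℂ V) : Module.End ℂ V :=
  (1 / 2 : ℂ) • (1 + P + Q - P * Q)

end Formal

/-! ### The Lie algebra, the noncommutative Weil algebra and `g̃`-differential algebras -/

/-- A quadratic Lie algebra `(g, B)`, pairwise commuting elements `H_1, …, H_p` of `g`, and a basis
`e_a` of `g` that diagonalizes them: `[H_k, e_a] = r_k(a) e_a`. For `g` semisimple: a Cartan-Weyl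
basis, with `r(a)` the root vector of `e_a`, and `r(a) = 0` if `e_a` is of Cartan type. -/
structure TwistData (g : Type*) [LieRing g] [LieAlgebra ℂ g] (ι : Type*) (p : ℕ) where
  B : LinearMap.BilinForm ℂ g
  symm : B.IsSymm
  nondegenerate : B.Nondegenerate
  invariant : B.lieInvariant g
  e : Module.Basis ι ℂ g
  H : Fin p → g
  comm : ∀ k l, ⁅H k, H l⁆ = 0
  r : ι → Fin p → ℂ
  weight : ∀ a k, ⁅H k, e a⁆ = r a k • e a

section Weil

variable {g : Type*} [LieRing g] [LieAlgebra ℂ g] (B : LinearMap.BilinForm ℂ g)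

/-- The relations of the noncommutative Weil algebra on even generators `(x, 0)` and odd generators
`(0, x)`: the super brackets `[e_x, e_y] = e_{[x,y]}`, `[e_x, ξ_y] = ξ_{[x,y]}`,
`[ξ_x, ξ_y] = B(x, y) c`, with `c = 1`. -/
inductive WeilRel : TensorAlgebra ℂ (g × g) → TensorAlgebra ℂ (g × g) → Prop
  | even_even (x y : g) : WeilRel
      (TensorAlgebra.ι ℂ (x, 0) * TensorAlgebra.ι ℂ (y, 0))
      (TensorAlgebra.ι ℂ (y, 0) * TensorAlgebra.ι ℂ (x, 0) + TensorAlgebra.ι ℂ (⁅x, y⁆, 0))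
  | even_odd (x y : g) : WeilRel
      (TensorAlgebra.ι ℂ (x, 0) * TensorAlgebra.ι ℂ (0, y))
      (TensorAlgebra.ι ℂ (0, y) * TensorAlgebra.ι ℂ (x, 0) + TensorAlgebra.ι ℂ (0, ⁅x, y⁆))
  | odd_odd (x y : g) : WeilRel
      (TensorAlgebra.ι ℂ (0, x) * TensorAlgebra.ι ℂ (0, y) +
        TensorAlgebra.ι ℂ (0, y) * TensorAlgebra.ι ℂ (0, x))
      (algebraMap ℂ _ (B x y))

/-- The noncommutative Weil algebra `W = U(g^B) / (c - 1)`. -/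
def Weil : Type _ := RingQuot (WeilRel B)

instance : Ring (Weil B) := inferInstanceAs (Ring (RingQuot (WeilRel B)))

instance : Algebra ℂ (Weil B) := inferInstanceAs (Algebra ℂ (RingQuot (WeilRel B)))

/-- The quotient map onto the Weil algebra. -/
def Weil.mk : TensorAlgebra ℂ (g × g) →ₐ[ℂ] Weil B := RingQuot.mkAlgHom ℂ (WeilRel B)

/-- The even generator `e_x`. -/
def Weil.even (x : g) : Weil B := Weil.mk B (TensorAlgebra.ι ℂ (x, 0))

/-- The odd generator `ξ_x`. -/
def Weil.odd (x : g) : Weil B := Weil.mk B (TensorAlgebra.ι ℂ (0, x))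

/-- The linear map `(x, y) ↦ e_x - ξ_y`. -/
def Weil.parityGen : g × g →ₗ[ℂ] Weil B :=
  (Weil.mk B).toLinearMap ∘ₗ TensorAlgebra.ι ℂ ∘ₗ
    LinearMap.prodMap LinearMap.id (-LinearMap.id)

lemma Weil.mk_rel {a b : TensorAlgebra ℂ (g × g)} (h : WeilRel B a b) :
    Weil.mk B a = Weil.mk B b :=
  RingQuot.mkAlgHom_rel ℂ h

lemma Weil.parityGen_even (x : g) : Weil.parityGen B (x, 0) = Weil.even B x := by
  simp [Weil.parityGen, Weil.even]

lemma Weil.parityGen_odd (x : g) : Weil.parityGen B (0, x) = -Weil.odd B x := by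
  have h : (LinearMap.prodMap LinearMap.id (-LinearMap.id) : g × g →ₗ[ℂ] g × g) (0, x) =
      -(0, x) := by simp
  rw [Weil.parityGen, LinearMap.comp_apply, LinearMap.comp_apply, h, map_neg, map_neg]
  rfl

/-- The parity involution `w ↦ (-1)^{|w|} w` of the Weil algebra: the algebra automorphism that
fixes the `e_x` and changes the sign of the `ξ_x`. -/
def Weil.parity : Weil B →ₐ[ℂ] Weil B :=
  RingQuot.liftAlgHom ℂ ⟨TensorAlgebra.lift ℂ (Weil.parityGen B), by
    intro a b h
    cases h with
    | even_even x y =>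
      have := Weil.mk_rel B (WeilRel.even_even x y)
      simp only [map_mul, map_add, TensorAlgebra.lift_ι_apply, Weil.parityGen_even]
      simpa [Weil.even] using this
    | even_odd x y =>
      have := Weil.mk_rel B (WeilRel.even_odd x y)
      simp only [map_mul, map_add, TensorAlgebra.lift_ι_apply, Weil.parityGen_even,
        Weil.parityGen_odd, mul_neg, neg_mul]
      rw [← neg_add, neg_inj]
      simpa only [Weil.even, Weil.odd, map_mul, map_add] using this
    | odd_odd x y =>
      have := Weil.mk_rel B (WeilRel.odd_odd x y)
      simp only [map_mul, map_add, TensorAlgebra.lift_ι_apply, Weil.parityGen_odd, neg_mul_neg,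
        AlgHom.commutes]
      simpa [Weil.odd] using this⟩

end Weil

/-- A `g̃`-differential algebra: Lie derivatives `L`, interior derivatives `i` and a differential
`d` that are graded derivations of degrees `0`, `-1`, `1` of the graded algebra `A` and satisfy the
brackets of the super Lie algebra `g̃`. -/
structure GDA (g : Type*) [LieRing g] [LieAlgebra ℂ g] {A : Type*} [Ring A] [Algebra ℂ A]
    (𝒜 : ℤ → Submodule ℂ A) where
  L : g →ₗ[ℂ] Module.End ℂ A
  i : g →ₗ[ℂ] Module.End ℂ A
  d : Module.End ℂ A
  L_mem : ∀ x n, ∀ a ∈ 𝒜 n, L x a ∈ 𝒜 n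
  i_mem : ∀ x n, ∀ a ∈ 𝒜 n, i x a ∈ 𝒜 (n - 1)
  d_mem : ∀ n, ∀ a ∈ 𝒜 n, d a ∈ 𝒜 (n + 1)
  L_mul : ∀ x a b, L x (a * b) = L x a * b + a * L x b
  i_mul : ∀ x n, ∀ a ∈ 𝒜 n, ∀ b, i x (a * b) = i x a * b + n.negOnePow • (a * i x b)
  d_mul : ∀ n, ∀ a ∈ 𝒜 n, ∀ b, d (a * b) = d a * b + n.negOnePow • (a * d b)
  L_L : ∀ x y, L x * L y - L y * L x = L ⁅x, y⁆
  L_i : ∀ x y, L x * i y - i y * L x = i ⁅x, y⁆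
  i_i : ∀ x y, i x * i y + i y * i x = 0
  L_d : ∀ x, L x * d - d * L x = 0
  i_d : ∀ x, i x * d + d * i x = L x
  d_d : d * d = 0

/-- Graded commutativity: `a b = (-1)^{mn} b a` for `a` of degree `m` and `b` of degree `n`. -/
def GradedCommutative {A : Type*} [Ring A] [Algebra ℂ A] (𝒜 : ℤ → Submodule ℂ A) : Prop :=
  ∀ m n : ℤ, ∀ a ∈ 𝒜 m, ∀ b ∈ 𝒜 n, a * b = (m * n).negOnePow • (b * a)

/-- The parity involution `a ↦ (-1)^{|a|} a` of a graded algebra. -/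
def parity {A : Type*} [Ring A] [Algebra ℂ A] (𝒜 : ℤ → Submodule ℂ A) [GradedAlgebra 𝒜] :
    Module.End ℂ A :=
  DirectSum.toModule ℂ ℤ A (fun n => ((n.negOnePow : ℤ) : ℂ) • (𝒜 n).subtype) ∘ₗ
    (DirectSum.decomposeLinearEquiv 𝒜).toLinearMap

/-! ### The twisted Weil complex, the Kalkman map and the Cartan complex -/

section Models

variable {g : Type*} [LieRing g] [LieAlgebra ℂ g] {ι : Type*} [Fintype ι] [DecidableEq ι] {p : ℕ}
  (D : TwistData g ι p) {A : Type*} [Ring A] [Algebra ℂ A] {𝒜 : ℤ → Submodule ℂ A}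
  [GradedAlgebra 𝒜] (S : GDA g 𝒜)

/-- `B^{ab}`, the inverse of the matrix `B_{ab} = B(e_a, e_b)`. -/
def Bup (a b : ι) : ℂ := (Matrix.of fun a b => D.B (D.e a) (D.e b))⁻¹ a b

/-- `ξ^a = B^{ab} ξ_b` in the Weil algebra. -/
def xiUp (a : ι) : Weil D.B := ∑ b, Bup D a b • Weil.odd D.B (D.e b)

/-- The underlying space `W ⊗ A` of the Weil complex before adjoining `θ`. -/
abbrev WA (_ : GDA g 𝒜) : Type _ := Weil D.B ⊗[ℂ] A

/-- Left multiplication by `b ∈ W[[θ]]` on the first factor of `(W ⊗ A)[[θ]]`. -/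
def lmul (b : Formal p (Weil D.B)) : Module.End ℂ (Formal p (WA D S)) :=
  fmap₂ (LinearMap.rTensorHom A ∘ₗ LinearMap.mul ℂ (Weil D.B)) b

/-- Right multiplication by `b ∈ W[[θ]]` on the first factor of `(W ⊗ A)[[θ]]`. -/
def rmul (b : Formal p (Weil D.B)) : Module.End ℂ (Formal p (WA D S)) :=
  fmap₂ (LinearMap.rTensorHom A ∘ₗ (LinearMap.mul ℂ (Weil D.B)).flip) b

/-- The adjoint action of `H_k` on the Weil algebra (the same before and after the twist). -/
def adH (k : Fin p) : Module.End ℂ (Weil D.B) :=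
  LinearMap.mulLeft ℂ (Weil.even D.B (D.H k)) - LinearMap.mulRight ℂ (Weil.even D.B (D.H k))

/-- `λ_a = exp {(i/2) θ^{kl} r_k(a) H_l}` in `W[[θ]]`. -/
def lam (a : ι) : Formal p (Weil D.B) :=
  thetaExp (Complex.I / 2)
    (fun k l => D.r a k • LinearMap.mulLeft ℂ (Weil.even D.B (D.H l))) (const p 1)

/-- `χ` on `W^χ ⊗ A_χ`. -/
def chi : Module.End ℂ (Formal p (WA D S)) :=
  twist (fun k => (adH D k).rTensor A) (fun l => (S.L (D.H l)).lTensor (Weil D.B))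

/-- `χ⁻¹` on `W^χ ⊗ A_χ`. -/
def chiInv : Module.End ℂ (Formal p (WA D S)) :=
  twistInv (fun k => (adH D k).rTensor A) (fun l => (S.L (D.H l)).lTensor (Weil D.B))

/-- `L_a ⊗ 1` for the Lie derivative `L_a(X) = e_a X λ_a - λ_a X e_a` of the twisted Weil algebra
(twisted adjoint action of `e_a`). -/
def lieW (a : ι) : Module.End ℂ (Formal p (WA D S)) :=
  lmul D S (const p (Weil.even D.B (D.e a))) * rmul D S (lam D a) -
    lmul D S (lam D a) * rmul D S (const p (Weil.even D.B (D.e a)))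

/-- `i_a ⊗ 1` for the interior derivative `i_a(X) = ξ_a X λ_a - (-1)^{|X|} λ_a X ξ_a` of the twisted
Weil algebra (twisted adjoint action of `ξ_a`). -/
def intW (a : ι) : Module.End ℂ (Formal p (WA D S)) :=
  lmul D S (const p (Weil.odd D.B (D.e a))) * rmul D S (lam D a) -
    lmul D S (lam D a) * rmul D S (const p (Weil.odd D.B (D.e a))) *
      fmap ((Weil.parity D.B).toLinearMap.rTensor A)

/-- The total Lie derivative: `e_a` acts through the twisted coproduct
`χ (e_a ⊗ 1 + 1 ⊗ e_a) χ⁻¹`. -/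
def lieTot (a : ι) : Module.End ℂ (Formal p (WA D S)) :=
  chi D S * (lieW D S a + fmap ((S.L (D.e a)).lTensor (Weil D.B))) * chiInv D S

/-- The twisted Cartan complex: the elements of `W^χ ⊗ A_χ` that are invariant under the total Lie
derivatives and annihilated by all `i_a ⊗ 1`. -/
def cartan : Submodule ℂ (Formal p (WA D S)) :=
  (⨅ a, LinearMap.ker (lieTot D S a)) ⊓ ⨅ a, LinearMap.ker (intW D S a)

/-- `ξ^a ⊗ i_a`, with the Koszul sign: `w ⊗ ν ↦ (-1)^{|w|} ξ^a w ⊗ i_a ν`. -/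
def kalkmanGen : Module.End ℂ (Formal p (WA D S)) :=
  fmap (∑ a, TensorProduct.map
    (LinearMap.mulLeft ℂ (xiUp D a) ∘ₗ (Weil.parity D.B).toLinearMap) (S.i (D.e a)))

/-- The identification of the untwisted module `W[[θ]]` (adjoint action) with the twisted Weil
algebra (twisted adjoint action), on the first factor of `W ⊗ A`: it is `w ↦ λ_s w` on vectors of
weight `s`, so it maps the generators `e_a`, `ξ_a` to the quantum generators `λ_a e_a`,
`λ_a ξ_a`. -/
def quantum : Module.End ℂ (Formal p (WA D S)) :=
  thetaExp (Complex.I / 2) fun k l =>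
    (LinearMap.mulLeft ℂ (Weil.even D.B (D.H l)) * adH D k).rTensor A

/-- The inverse of `quantum`. -/
def quantumInv : Module.End ℂ (Formal p (WA D S)) :=
  thetaExp (-(Complex.I / 2)) fun k l =>
    (LinearMap.mulLeft ℂ (Weil.even D.B (D.H l)) * adH D k).rTensor A

/-- The twisted Kalkman map `Φ^χ = χ Φ χ⁻¹`, where `Φ = exp {ξ^a ⊗ i_a}` is carried to
`W^χ ⊗ A_χ` by the identification `quantum`. -/
def kalkman : Module.End ℂ (Formal p (WA D S)) :=
  chi D S * (quantum D S * nilExp (kalkmanGen D S) * quantumInv D S) * chiInv D S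

/-- The inverse `χ Φ⁻¹ χ⁻¹` of the twisted Kalkman map. -/
def kalkmanInv : Module.End ℂ (Formal p (WA D S)) :=
  chi D S * (quantum D S * nilExp (-kalkmanGen D S) * quantumInv D S) * chiInv D S

/-- `x ⊗ y` in `((W ⊗ A) ⊗ (W ⊗ A))[[θ]]`. -/
def pair : Formal p (WA D S) →ₗ[ℂ] Formal p (WA D S) →ₗ[ℂ] Formal p (WA D S ⊗[ℂ] WA D S) :=
  fmap₂ (TensorProduct.mk ℂ (WA D S) (WA D S))

/-- `(w₁ ⊗ ν₁) ⊗ (w₂ ⊗ ν₂) ↦ (-1)^{|ν₁||w₂|} w₁ w₂ ⊗ ν₁ ν₂`. -/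
def superMul : WA D S ⊗[ℂ] WA D S →ₗ[ℂ] WA D S :=
  TensorProduct.map (LinearMap.mul' ℂ (Weil D.B)) (LinearMap.mul' ℂ A) ∘ₗ
    (TensorProduct.tensorTensorTensorComm ℂ (Weil D.B) A (Weil D.B) A).toLinearMap ∘ₗ
    koszul (((parity 𝒜).lTensor (Weil D.B)).rTensor (WA D S))
      (((Weil.parity D.B).toLinearMap.rTensor A).lTensor (WA D S))

/-- The product of the braided tensor product of `W^χ` and `A_χ`:
`(w₁ ⊗ ν₁)(w₂ ⊗ ν₂) = (-1)^{|ν₁||w₂|} w₁ (R⁽²⁾ ▷ w₂) ⊗ (R⁽¹⁾ ▷ ν₁) ·_χ ν₂`.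
The product of `W^χ` is that of `W`; the product of `A_χ` is `· ∘ χ⁻¹`. -/
def braidedMul (x y : Formal p (WA D S)) : Formal p (WA D S) :=
  let H₁ : Fin p → Module.End ℂ (WA D S ⊗[ℂ] WA D S) := fun k =>
    ((S.L (D.H k)).lTensor (Weil D.B)).rTensor (WA D S)
  let H₂ : Fin p → Module.End ℂ (WA D S ⊗[ℂ] WA D S) := fun k =>
    ((adH D k).rTensor A).lTensor (WA D S)
  let H₃ : Fin p → Module.End ℂ (WA D S ⊗[ℂ] WA D S) := fun k =>
    ((S.L (D.H k)).lTensor (Weil D.B)).lTensor (WA D S)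
  fmap (superMul D S) (twistInv H₁ H₃ (rMatrix H₁ H₂ (pair D S x y)))

/-- The product `x ⊙_χ y` induced by the twisted Kalkman map. -/
def cartanMul (x y : Formal p (WA D S)) : Formal p (WA D S) :=
  kalkman D S (braidedMul D S (kalkmanInv D S x) (kalkmanInv D S y))

/-! ### The explicit product -/

/-- The deformed product `·_χ = · ∘ χ⁻¹` of `A_χ`, on `(A ⊗ A)[[θ]]`. -/
def mulChi : Formal p (A ⊗[ℂ] A) →ₗ[ℂ] Formal p A :=
  fmap (LinearMap.mul' ℂ A) ∘ₗ
    twistInv (fun k => (S.L (D.H k)).rTensor A) (fun l => (S.L (D.H l)).lTensor A)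

/-- The first term `i_a ⊗ λ_a⁻¹` of the twisted coproduct of `ξ_a`, acting on `A_χ ⊗ A_χ`. -/
def intLeft (a : ι) : Module.End ℂ (Formal p (A ⊗[ℂ] A)) :=
  fmap ((S.i (D.e a)).rTensor A) *
    thetaExp (-(Complex.I / 2)) fun k l => D.r a k • (S.L (D.H l)).lTensor A

/-- The second term `λ_a ⊗ i_a` of the twisted coproduct of `ξ_a`, acting on `A_χ ⊗ A_χ` with the
Koszul sign. -/
def intRight (a : ι) : Module.End ℂ (Formal p (A ⊗[ℂ] A)) :=
  fmap (TensorProduct.map (parity 𝒜) (S.i (D.e a))) *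
    thetaExp (Complex.I / 2) fun k l => D.r a k • (S.L (D.H l)).rTensor A

/-- `exp {½ B^{ab} i_a ⊗ i_b}` on `A_χ ⊗ A_χ` with the twisted interior derivatives
`i_a ⊗ λ_a⁻¹` and `λ_b ⊗ i_b`. -/
def expInt : Module.End ℂ (Formal p (A ⊗[ℂ] A)) :=
  nilExp ((1 / 2 : ℂ) • ∑ a, ∑ b, Bup D a b • (intLeft D S a * intRight D S b))

/-- `w ⊗ t ↦ w ⊗ ·_χ(exp {½ B^{ab} i_a ⊗ i_b} t)`. -/
def applyExp : Weil D.B ⊗[ℂ] (A ⊗[ℂ] A) →ₗ[ℂ] Formal p (WA D S) :=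
  TensorProduct.lift <| LinearMap.mk₂ ℂ
    (fun w t => fmap (TensorProduct.mk ℂ (Weil D.B) A w)
      (mulChi D S (expInt D S (const p t))))
    (fun w w' t => by
      funext m
      exact TensorProduct.add_tmul _ _ _)
    (fun c w t => by
      funext m
      exact TensorProduct.smul_tmul' _ _ _)
    (fun w t t' => by simp only [map_add])
    (fun c w t => by simp only [map_smul])

/-- `(w₁ ⊗ ν₁) ⊗ (w₂ ⊗ ν₂) ↦ (-1)^{|ν₁||ν₂|} w₁ w₂ ⊗ (ν₂ ⊗ ν₁)`. -/
def swapMul : WA D S ⊗[ℂ] WA D S →ₗ[ℂ] Weil D.B ⊗[ℂ] (A ⊗[ℂ] A) :=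
  TensorProduct.map (LinearMap.mul' ℂ (Weil D.B))
      ((TensorProduct.comm ℂ A A).toLinearMap ∘ₗ
        koszul ((parity 𝒜).rTensor A) ((parity 𝒜).lTensor A)) ∘ₗ
    (TensorProduct.tensorTensorTensorComm ℂ (Weil D.B) A (Weil D.B) A).toLinearMap

/-- The `ℂ[[θ]]`-bilinear, `θ`-adically continuous extension to `(W ⊗ A)[[θ]]` of
`(u₁ ⊗ ν₁, u₂ ⊗ ν₂) ↦ u₁ u₂ ⊗ (-1)^{|ν₁||ν₂|} ·_χ(exp {½ B^{ab} i_a ⊗ i_b} (ν₂ ⊗ ν₁))`. -/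
def explicitMul (x y : Formal p (WA D S)) : Formal p (WA D S) :=
  fextend (applyExp D S ∘ₗ swapMul D S) (pair D S x y)

end Models

end TwistedCartan

end

open scoped TensorProduct

noncomputable section

namespace TwistedCartan

universe u v

/-! ### Calculus of formal exponentials -/

section FormalCalculus

variable {p : ℕ} {U V Z : Type*} [AddCommGroup U] [Module ℂ U] [AddCommGroup V] [Module ℂ V]
  [AddCommGroup Z] [Module ℂ Z]

/-! The deformation is undone by a single linear automorphism of (W ⊗ A)[[θ]], `transport` = χQ. It
identifies the twisted Cartan complex with the series all of whose coefficients are basic in the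
undeformed sense (`transport_mem_cartan_iff`), and it conjugates the twisted Kalkman map to the
coefficientwise exp{ξ^a ⊗ i_a}. On transported elements, the second of which is invariant, the
braided product becomes the super product of W ⊗ A (`braidedMul_transport`), and the explicit
product becomes its undeformed version `explicitOp` (`explicitMul_transport`). What remains is an
identity without θ (`kalkman_superMul_of_isBasic`).

The undeformed identity. Let K = ξ^a ⊗ i_a, let m be the super product and X = K ⊗ 1 + 1 ⊗ K. Since
ξ^a does not supercommute with W, K is not a derivation of m: K m = m (X + D), where D contracts the
first Weil factor with ξ^a and applies i_a to the last factor. The Clifford relation gives [D, X] =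
N with N = B^{ab} i_a ⊗ i_b up to signs, and N commutes with X and D, so these form a Heisenberg
triple. D kills x ⊗ y when x is horizontal, and the Baker-Campbell-Hausdorff formula
(`nilExp_heisenberg`) then turns the induced product into m exp(-N/2). Next, the parity of W is a
product of reflections w ↦ w - c ξ [ξ, w], each of which fixes horizontal elements; hence horizontal
elements are even in W (`parity_rTensor_eq_self_of_horizontal`), and the Koszul signs with the
second Weil factor disappear. Finally the graded flip, which is invisible after multiplication in
the graded-commutative algebra A, anticommutes with B^{ab} i_a ⊗ i_b and turns exp(-½ …) into exp(½
…) on ν₂ ⊗ ν₁.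

The twist. All θ-exponents are built from commuting operators: the actions w_k of H_k on W by
commutators, a_k on A, and left multiplications h_k on W. Collecting them in a commutative ring
reduces every identity between twists to a polynomial identity between exponents, needed only modulo
terms symmetric in k, l because θ is antisymmetric (`homExp_congr`). With indices 1 and 2 for the
two factors, the total exponent left over is (w₁ + a₁)_k (w₂ + a₂)_l for the braided product and (w₁
- a₁)_k (w₂ + a₂)_l for the explicit one. Both vanish when the second factor is invariant. -/

lemma sum_antidiagonal_swap {M M' : Type*} [AddCommMonoid M] [AddCommMonoid M']
    [Finset.HasAntidiagonal M] (m : M) (f : M × M → M') :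
    ∑ ij ∈ Finset.HasAntidiagonal.antidiagonal m, f ij.swap =
      ∑ ij ∈ Finset.HasAntidiagonal.antidiagonal m, f ij := by
  refine Finset.sum_nbij' Prod.swap Prod.swap ?_ ?_ ?_ ?_ ?_ <;>
    simp [Finset.HasAntidiagonal.mem_antidiagonal, add_comm]

lemma sum_range_sum_antidiagonal {M : Type*} [AddCommMonoid M] (N : ℕ) (f : ℕ × ℕ → M) :
    ∑ n ∈ Finset.range N, ∑ ij ∈ Finset.HasAntidiagonal.antidiagonal n, f ij =
      ∑ ij ∈ Finset.range N ×ˢ Finset.range N with ij.1 + ij.2 < N, f ij := by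
  rw [Finset.sum_sigma']
  refine Finset.sum_nbij' (fun t => t.2) (fun ij => ⟨ij.1 + ij.2, ij⟩) ?_ ?_ ?_ ?_ ?_
  · rintro ⟨n, i, j⟩ ht
    simp only [Finset.mem_sigma, Finset.mem_range, Finset.HasAntidiagonal.mem_antidiagonal,
      Finset.mem_filter, Finset.mem_product] at ht ⊢
    omega
  · rintro ⟨i, j⟩ ht
    simp only [Finset.mem_sigma, Finset.mem_range, Finset.HasAntidiagonal.mem_antidiagonal,
      Finset.mem_filter, Finset.mem_product] at ht ⊢
    exact ⟨ht.2, trivial⟩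
  · rintro ⟨n, i, j⟩ ht
    simp only [Finset.mem_sigma, Finset.mem_range,
      Finset.HasAntidiagonal.mem_antidiagonal] at ht
    obtain ⟨-, rfl⟩ := ht
    rfl
  · rintro ⟨i, j⟩ _
    rfl
  · rintro ⟨n, i, j⟩ _
    rfl

lemma fmap_apply (f : V →ₗ[ℂ] Z) (x : Formal p V) (m : Param p →₀ ℕ) :
    (fmap f x) m = f (x m) := rfl

lemma fmap_fmap (f : V →ₗ[ℂ] Z) (h : U →ₗ[ℂ] V) (x : Formal p U) :
    fmap f (fmap h x) = fmap (f ∘ₗ h) x := rfl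

/-- Coefficientwise application of endomorphisms, as an algebra homomorphism. -/
def fmapHom (p : ℕ) (V : Type*) [AddCommGroup V] [Module ℂ V] :
    Module.End ℂ V →ₐ[ℂ] Module.End ℂ (Formal p V) where
  toFun f := fmap f
  map_one' := rfl
  map_mul' _ _ := rfl
  map_zero' := rfl
  map_add' _ _ := rfl
  commutes' _ := rfl

lemma fmap_eq_fmapHom (f : Module.End ℂ V) :
    (fmap f : Module.End ℂ (Formal p V)) = fmapHom p V f := rfl

lemma fmap_add (f h : V →ₗ[ℂ] Z) :
    (fmap (f + h) : Formal p V →ₗ[ℂ] Formal p Z) = fmap f + fmap h := rfl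

lemma fmap_sub (f h : V →ₗ[ℂ] Z) :
    (fmap (f - h) : Formal p V →ₗ[ℂ] Formal p Z) = fmap f - fmap h := rfl

lemma fmap_mul (f h : Module.End ℂ V) :
    (fmap (f * h) : Module.End ℂ (Formal p V)) = fmap f * fmap h := rfl

lemma formal_add_apply (x y : Formal p V) (m : Param p →₀ ℕ) : (x + y) m = x m + y m := rfl

lemma formal_sub_apply (x y : Formal p V) (m : Param p →₀ ℕ) : (x - y) m = x m - y m := rfl

lemma formal_smul_apply (c : ℂ) (x : Formal p V) (m : Param p →₀ ℕ) :
    (c • x) m = c • x m := rfl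

lemma formal_zero_apply (m : Param p →₀ ℕ) : (0 : Formal p V) m = 0 := rfl

lemma formal_sum_apply {κ : Type*} (s : Finset κ) (f : κ → Formal p V) (m : Param p →₀ ℕ) :
    (∑ i ∈ s, f i) m = ∑ i ∈ s, f i m := by
  classical
  induction s using Finset.induction_on with
  | empty => simp [formal_zero_apply]
  | insert a s ha ih => rw [Finset.sum_insert ha, Finset.sum_insert ha, formal_add_apply, ih]

lemma fmap₂_apply (β : U →ₗ[ℂ] V →ₗ[ℂ] Z) (x : Formal p U) (y : Formal p V)
    (m : Param p →₀ ℕ) :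
    fmap₂ β x y m = ∑ ij ∈ Finset.HasAntidiagonal.antidiagonal m, β (x ij.1) (y ij.2) := rfl

lemma const_apply (v : V) (m : Param p →₀ ℕ) : const p v m = if m = 0 then v else 0 := rfl

lemma fextend_apply (F : V →ₗ[ℂ] Formal p Z) (x : Formal p V) (m : Param p →₀ ℕ) :
    fextend F x m = ∑ ij ∈ Finset.HasAntidiagonal.antidiagonal m, F (x ij.1) ij.2 := rfl

lemma fmap_const (f : V →ₗ[ℂ] Z) (v : V) : fmap f (const p v) = const p (f v) := by
  funext m
  rw [fmap_apply, const_apply, const_apply]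
  split_ifs <;> simp

lemma fmap₂_const_left (β : U →ₗ[ℂ] V →ₗ[ℂ] Z) (u : U) :
    (fmap₂ β (const p u) : Formal p V →ₗ[ℂ] Formal p Z) = fmap (β u) := by
  refine LinearMap.ext fun y => funext fun m => ?_
  rw [fmap₂_apply, fmap_apply, Finset.sum_eq_single (0, m)]
  · simp [const_apply]
  · rintro ⟨i, j⟩ hij hne
    rw [Finset.HasAntidiagonal.mem_antidiagonal] at hij
    have : i ≠ 0 := by
      rintro rfl
      exact hne (by simpa using hij)
    simp [const_apply, this]
  · intro h
    exact absurd (Finset.HasAntidiagonal.mem_antidiagonal.2 (zero_add m)) h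

lemma fextend_const (F : V →ₗ[ℂ] Formal p Z) (v : V) : fextend F (const p v) = F v := by
  funext m
  rw [fextend_apply, Finset.sum_eq_single (0, m)]
  · simp [const_apply]
  · rintro ⟨i, j⟩ hij hne
    rw [Finset.HasAntidiagonal.mem_antidiagonal] at hij
    have : i ≠ 0 := by
      rintro rfl
      exact hne (by simpa using hij)
    simp [const_apply, this, formal_zero_apply]
  · intro h
    exact absurd (Finset.HasAntidiagonal.mem_antidiagonal.2 (zero_add m)) h

lemma fmap₂_const_const (β : U →ₗ[ℂ] V →ₗ[ℂ] Z) (u : U) (v : V) :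
    fmap₂ β (const p u) (const p v) = const p (β u v) := by
  rw [fmap₂_const_left, fmap_const]

/-- The power series without terms of degree less than `d`. -/
def HasOrderGE (d : ℕ) (x : Formal p V) : Prop :=
  ∀ m : Param p →₀ ℕ, m.degree < d → x m = 0

lemma HasOrderGE.mono {d e : ℕ} {x : Formal p V} (h : HasOrderGE e x) (hd : d ≤ e) :
    HasOrderGE d x := fun m hm => h m (hm.trans_le hd)

lemma hasOrderGE_zero (x : Formal p V) : HasOrderGE 0 x := fun _ hm => absurd hm (by simp)

lemma HasOrderGE.add {d : ℕ} {x y : Formal p V} (hx : HasOrderGE d x) (hy : HasOrderGE d y) :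
    HasOrderGE d (x + y) := fun m hm => by
  rw [formal_add_apply, hx m hm, hy m hm, add_zero]

lemma HasOrderGE.smul {d : ℕ} {x : Formal p V} (c : ℂ) (hx : HasOrderGE d x) :
    HasOrderGE d (c • x) := fun m hm => by
  rw [formal_smul_apply, hx m hm, smul_zero]

lemma HasOrderGE.sum {κ : Type*} {s : Finset κ} {f : κ → Formal p V} {d : ℕ}
    (h : ∀ i ∈ s, HasOrderGE d (f i)) : HasOrderGE d (∑ i ∈ s, f i) := fun m hm => by
  rw [formal_sum_apply]
  exact Finset.sum_eq_zero fun i hi => h i hi m hm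

/-- The θ-adic filtration is separated. Identities between formal exponentials are proved by
truncating at an arbitrary order N and comparing. -/
lemma eq_of_hasOrderGE_sub {x y : Formal p V} (h : ∀ N, HasOrderGE N (x - y)) : x = y :=
  funext fun m => sub_eq_zero.1 (h (m.degree + 1) m (Nat.lt_succ_self _))

lemma HasOrderGE.fmap {d : ℕ} {x : Formal p V} (f : V →ₗ[ℂ] Z) (hx : HasOrderGE d x) :
    HasOrderGE d (fmap f x) := fun m hm => by
  rw [fmap_apply, hx m hm, map_zero]

lemma HasOrderGE.fmap₂ {d e : ℕ} {x : Formal p U} {y : Formal p V} (β : U →ₗ[ℂ] V →ₗ[ℂ] Z)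
    (hx : HasOrderGE d x) (hy : HasOrderGE e y) : HasOrderGE (d + e) (fmap₂ β x y) :=
  fun m hm => by
  rw [fmap₂_apply]
  refine Finset.sum_eq_zero fun ij hij => ?_
  rw [Finset.HasAntidiagonal.mem_antidiagonal] at hij
  have hdeg : ij.1.degree + ij.2.degree = m.degree := by rw [← hij, map_add]
  by_cases h1 : ij.1.degree < d
  · rw [hx _ h1, map_zero, LinearMap.zero_apply]
  · rw [hy _ (by omega), map_zero]

lemma theta_antisymm (k l : Fin p) : theta k l = -theta l k := by
  unfold theta
  rcases lt_trichotomy k l with h | h | h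
  · simp [h, h.not_gt]
  · simp [h]
  · simp [h, h.not_gt]

lemma hasOrderGE_theta (k l : Fin p) : HasOrderGE 1 (theta k l) := by
  classical
  have hX : ∀ s : Param p, HasOrderGE 1 (MvPowerSeries.X s : Formal p ℂ) := fun s m hm => by
    have hm0 : m = 0 := by
      rw [Nat.lt_one_iff] at hm
      exact (Finsupp.degree_eq_zero_iff m).1 hm
    subst hm0
    exact MvPowerSeries.coeff_zero_X s
  unfold theta
  split_ifs with h1 h2
  · exact hX _
  · intro m hm
    have := hX ⟨(l, k), h2⟩ m hm
    change -((MvPowerSeries.X ⟨(l, k), h2⟩ : Formal p ℂ) m) = 0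
    rw [this, neg_zero]
  · exact fun m _ => rfl

lemma thetaSum_apply (Q : Fin p → Fin p → Module.End ℂ V) (x : Formal p V) :
    thetaSum Q x = ∑ k, ∑ l, fmap₂ (LinearMap.lsmul ℂ V) (theta k l) (fmap (Q k l) x) := by
  simp [thetaSum, LinearMap.sum_apply]

/-- Each entry of θ has no constant term. This gain of one order is what makes the exponential
series converge θ-adically. -/
lemma HasOrderGE.thetaSum {d : ℕ} {x : Formal p V} (Q : Fin p → Fin p → Module.End ℂ V)
    (hx : HasOrderGE d x) : HasOrderGE (d + 1) (thetaSum Q x) := by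
  rw [thetaSum_apply, add_comm]
  exact HasOrderGE.sum fun k _ => HasOrderGE.sum fun l _ =>
    (hasOrderGE_theta k l).fmap₂ _ (hx.fmap _)

lemma HasOrderGE.thetaSum_pow {d : ℕ} {x : Formal p V} (Q : Fin p → Fin p → Module.End ℂ V)
    (hx : HasOrderGE d x) (n : ℕ) : HasOrderGE (d + n) ((TwistedCartan.thetaSum Q ^ n) x) := by
  induction n with
  | zero => exact hx
  | succ n ih =>
    rw [pow_succ', Module.End.mul_apply]
    exact ih.thetaSum Q

lemma thetaSum_add (Q Q' : Fin p → Fin p → Module.End ℂ V) :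
    thetaSum (Q + Q') = thetaSum Q + thetaSum Q' := by
  simp only [thetaSum, Pi.add_apply, fmap_add, mul_add, Finset.sum_add_distrib]

lemma thetaSum_neg (Q : Fin p → Fin p → Module.End ℂ V) : thetaSum (-Q) = -thetaSum Q := by
  have h : ∀ f : Module.End ℂ V, (fmap (-f) : Module.End ℂ (Formal p V)) = -fmap f :=
    fun _ => rfl
  refine LinearMap.ext fun x => ?_
  rw [LinearMap.neg_apply, thetaSum_apply, thetaSum_apply, ← Finset.sum_neg_distrib]
  refine Finset.sum_congr rfl fun k _ => ?_
  rw [← Finset.sum_neg_distrib]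
  refine Finset.sum_congr rfl fun l _ => ?_
  rw [Pi.neg_apply, Pi.neg_apply, h, LinearMap.neg_apply, map_neg]

/-- `θ^{kl} Q_{kl}` depends only on the antisymmetric part of `Q`. -/
lemma thetaSum_congr {Q Q' : Fin p → Fin p → Module.End ℂ V}
    (h : ∀ k l, Q k l - Q l k = Q' k l - Q' l k) : thetaSum Q = thetaSum Q' := by
  -- Renaming the indices and using θ^{lk} = -θ^{kl} shows that twice the sum only sees the
  -- antisymmetrized family; the factor 2 is cancelled at the end.
  have key : ∀ R : Fin p → Fin p → Module.End ℂ V,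
      (2 : ℂ) • thetaSum R = ∑ k, ∑ l, fmap₂ (LinearMap.lsmul ℂ V) (theta k l) *
        fmap (R k l - R l k) := by
    intro R
    have h2 : thetaSum R =
        ∑ k, ∑ l, fmap₂ (LinearMap.lsmul ℂ V) (-theta k l) * fmap (R l k) := by
      rw [thetaSum, Finset.sum_comm]
      refine Finset.sum_congr rfl fun k _ => Finset.sum_congr rfl fun l _ => ?_
      rw [← theta_antisymm]
    refine LinearMap.ext fun x => ?_
    rw [LinearMap.smul_apply, two_smul]
    nth_rewrite 2 [h2]
    simp only [thetaSum, LinearMap.sum_apply, ← Finset.sum_add_distrib, Module.End.mul_apply]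
    refine Finset.sum_congr rfl fun k _ => Finset.sum_congr rfl fun l _ => ?_
    rw [fmap_sub, LinearMap.sub_apply, map_sub, map_neg, LinearMap.neg_apply, sub_eq_add_neg]
  have := key Q
  simp only [h] at this
  rw [← key Q'] at this
  exact smul_right_injective _ (two_ne_zero : (2 : ℂ) ≠ 0) this

/-- Maps commuting with all coefficient operators commute with `θ^{kl} Q_{kl}`. -/
lemma fmap_thetaSum {Q : Fin p → Fin p → Module.End ℂ V} {Q' : Fin p → Fin p → Module.End ℂ Z}
    (f : V →ₗ[ℂ] Z) (h : ∀ k l, f ∘ₗ Q k l = Q' k l ∘ₗ f) (x : Formal p V) :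
    fmap f (thetaSum Q x) = thetaSum Q' (fmap f x) := by
  simp only [thetaSum_apply, map_sum]
  refine Finset.sum_congr rfl fun k _ => Finset.sum_congr rfl fun l _ => ?_
  rw [fmap_fmap, ← h]
  funext m
  simp [fmap_apply, fmap₂_apply]

lemma thetaSum_eq_zero {Q : Fin p → Fin p → Module.End ℂ V} {x : Formal p V}
    (h : ∀ k l, fmap (Q k l) x = 0) : thetaSum Q x = 0 := by
  rw [thetaSum_apply]
  exact Finset.sum_eq_zero fun k _ => Finset.sum_eq_zero fun l _ => by rw [h, map_zero]

lemma commute_thetaSum {Q Q' : Fin p → Fin p → Module.End ℂ V}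
    (h : ∀ k l k' l', Commute (Q k l) (Q' k' l')) : Commute (thetaSum Q) (thetaSum Q') := by
  refine Commute.sum_left _ _ _ fun k _ => Commute.sum_left _ _ _ fun l _ =>
    Commute.sum_right _ _ _ fun k' _ => Commute.sum_right _ _ _ fun l' _ => ?_
  have hsm : ∀ (a : Formal p ℂ) (f : Module.End ℂ V),
      Commute (fmap₂ (LinearMap.lsmul ℂ V) a : Module.End ℂ (Formal p V)) (fmap f) := by
    intro a f
    refine LinearMap.ext fun x => funext fun m => ?_
    simp only [Module.End.mul_apply]
    rw [fmap_apply, fmap₂_apply, fmap₂_apply, map_sum]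
    refine Finset.sum_congr rfl fun ij _ => ?_
    rw [fmap_apply]
    simp
  have hmm : ∀ (a b : Formal p ℂ),
      Commute (fmap₂ (LinearMap.lsmul ℂ V) a : Module.End ℂ (Formal p V))
        (fmap₂ (LinearMap.lsmul ℂ V) b) := by
    -- Successive multiplication by two scalar series is multiplication by their Cauchy product,
    -- which is commutative.
    have hone : ∀ (a b : Formal p ℂ) (x : Formal p V) (m : Param p →₀ ℕ),
        fmap₂ (LinearMap.lsmul ℂ V) a (fmap₂ (LinearMap.lsmul ℂ V) b x) m =
          fmap₂ (LinearMap.lsmul ℂ V) (fmap₂ (LinearMap.mul ℂ ℂ) a b) x m := by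
      intro a b x m
      simp only [fmap₂_apply, map_sum, LinearMap.lsmul_apply, LinearMap.mul_apply', smul_smul,
        LinearMap.sum_apply, Finset.smul_sum]
      rw [Finset.sum_sigma', Finset.sum_sigma']
      refine Finset.sum_nbij' (fun t => ⟨(t.1.1 + t.2.1, t.2.2), (t.1.1, t.2.1)⟩)
        (fun t => ⟨(t.2.1, t.2.2 + t.1.2), (t.2.2, t.1.2)⟩) ?_ ?_ ?_ ?_ ?_
      all_goals
        rintro ⟨⟨i, j⟩, ⟨i', j'⟩⟩ h
        simp only [Finset.mem_sigma, Finset.HasAntidiagonal.mem_antidiagonal] at h ⊢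
      · exact ⟨by rw [← h.1, ← h.2, add_assoc], trivial⟩
      · exact ⟨by rw [← h.1, ← h.2, add_assoc], trivial⟩
      · obtain ⟨-, rfl⟩ := h
        rfl
      · obtain ⟨-, rfl⟩ := h
        rfl
    have hcomm : ∀ a b : Formal p ℂ,
        fmap₂ (LinearMap.mul ℂ ℂ) a b = fmap₂ (LinearMap.mul ℂ ℂ) b a := by
      intro a b
      funext m
      rw [fmap₂_apply, fmap₂_apply, ← sum_antidiagonal_swap]
      exact Finset.sum_congr rfl fun ij _ => by simp [mul_comm]
    intro a b
    refine LinearMap.ext fun x => funext fun m => ?_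
    simp only [Module.End.mul_apply, hone]
    rw [hcomm]
  have hf : Commute (fmap (Q k l) : Module.End ℂ (Formal p V)) (fmap (Q' k' l')) :=
    (h k l k' l').map (fmapHom p V)
  exact ((hmm _ _).mul_right (hsm _ _)).mul_left (((hsm _ _).symm).mul_right hf)

/-- The formal exponential modulo terms of degree at least `N`. -/
lemma hasOrderGE_thetaExp_sub (c : ℂ) (Q : Fin p → Fin p → Module.End ℂ V) (x : Formal p V)
    (N : ℕ) : HasOrderGE N (thetaExp c Q x -
      ∑ n ∈ Finset.range N, (c ^ n / (n.factorial : ℂ)) • (thetaSum Q ^ n) x) := by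
  intro m hm
  rw [formal_sub_apply, formal_sum_apply, sub_eq_zero]
  change ∑ n ∈ Finset.range (m.degree + 1),
    (c ^ n / (n.factorial : ℂ)) • ((thetaSum Q ^ n) x) m = _
  refine Finset.sum_subset (Finset.range_subset_range.2 hm) fun n _ hn => ?_
  rw [Finset.mem_range, not_lt] at hn
  rw [((hasOrderGE_zero x).thetaSum_pow Q n) m (by omega), smul_zero]

lemma HasOrderGE.of_sub {d : ℕ} {x y : Formal p V} (h : HasOrderGE d (x - y))
    (hy : HasOrderGE d y) : HasOrderGE d x := by
  simpa using h.add hy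

/-- Order-preserving intertwiners of the exponents intertwine the formal exponentials. -/
lemma thetaExp_intertwine (c : ℂ) {Q : Fin p → Fin p → Module.End ℂ V}
    {Q' : Fin p → Fin p → Module.End ℂ Z} (F : Formal p V →ₗ[ℂ] Formal p Z)
    (hF : ∀ d x, HasOrderGE d x → HasOrderGE d (F x))
    (h : ∀ x, F (thetaSum Q x) = thetaSum Q' (F x)) (x : Formal p V) :
    F (thetaExp c Q x) = thetaExp c Q' (F x) := by
  refine eq_of_hasOrderGE_sub fun N => ?_
  have hp : ∀ n, F ((thetaSum Q ^ n) x) = (thetaSum Q' ^ n) (F x) := by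
    intro n
    induction n with
    | zero => rfl
    | succ n ih => rw [pow_succ', pow_succ', Module.End.mul_apply, Module.End.mul_apply, h, ih]
  have h1 := hF N _ (hasOrderGE_thetaExp_sub c Q x N)
  have h2 := (hasOrderGE_thetaExp_sub c Q' (F x) N).smul (-1)
  have := h1.add h2
  simp only [map_sub, map_sum, map_smul, hp] at this
  convert this using 1
  module

lemma fmap_thetaExp (c : ℂ) {Q : Fin p → Fin p → Module.End ℂ V}
    {Q' : Fin p → Fin p → Module.End ℂ Z} (f : V →ₗ[ℂ] Z)
    (h : ∀ k l, f ∘ₗ Q k l = Q' k l ∘ₗ f) (x : Formal p V) :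
    fmap f (thetaExp c Q x) = thetaExp c Q' (fmap f x) :=
  thetaExp_intertwine c (fmap f) (fun _ _ hx => hx.fmap f) (fmap_thetaSum f h) x

/-- The exponent may be changed by anything symmetric in k, l. All later comparisons of twists rest
on this freedom. -/
lemma thetaExp_congr (c : ℂ) {Q Q' : Fin p → Fin p → Module.End ℂ V}
    (h : ∀ k l, Q k l - Q l k = Q' k l - Q' l k) : thetaExp c Q = thetaExp c Q' := by
  refine LinearMap.ext fun x => ?_
  exact thetaExp_intertwine c LinearMap.id (fun _ _ hx => hx)
    (fun x => by rw [thetaSum_congr h]; rfl) x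

lemma thetaExp_apply_eq_self (c : ℂ) {Q : Fin p → Fin p → Module.End ℂ V} {x : Formal p V}
    (h : thetaSum Q x = 0) : thetaExp c Q x = x := by
  refine eq_of_hasOrderGE_sub fun N => ?_
  -- For N = 0 the truncated sum is empty and there is no zeroth term to split off.
  rcases N with _ | N
  · exact hasOrderGE_zero _
  have := hasOrderGE_thetaExp_sub c Q x (N + 1)
  rw [Finset.sum_range_succ', Finset.sum_eq_zero] at this
  · simpa using this
  · intro n _
    rw [pow_succ (thetaSum Q), Module.End.mul_apply, h, map_zero, smul_zero]

lemma thetaExp_zero (c : ℂ) : thetaExp c (0 : Fin p → Fin p → Module.End ℂ V) = 1 :=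
  LinearMap.ext fun _ => thetaExp_apply_eq_self c (thetaSum_eq_zero fun _ _ => rfl)

lemma HasOrderGE.thetaExp {d : ℕ} {x : Formal p V} (c : ℂ)
    (Q : Fin p → Fin p → Module.End ℂ V) (hx : HasOrderGE d x) : HasOrderGE d (thetaExp c Q x) :=
  (hasOrderGE_thetaExp_sub c Q x d).of_sub <| HasOrderGE.sum fun n _ =>
    ((hx.thetaSum_pow Q n).mono (Nat.le_add_right d n)).smul _

lemma thetaExp_neg (c : ℂ) (Q : Fin p → Fin p → Module.End ℂ V) :
    thetaExp (-c) Q = thetaExp c (-Q) := by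
  refine LinearMap.ext fun x => funext fun m => ?_
  change ∑ n ∈ Finset.range (m.degree + 1), ((-c) ^ n / (n.factorial : ℂ)) •
      ((thetaSum Q ^ n) x) m = ∑ n ∈ Finset.range (m.degree + 1),
        (c ^ n / (n.factorial : ℂ)) • ((thetaSum (-Q) ^ n) x) m
  refine Finset.sum_congr rfl fun n _ => ?_
  have h : thetaSum (-Q) = (-1 : ℂ) • thetaSum Q := by
    rw [thetaSum_neg]
    exact (neg_one_smul ℂ (thetaSum Q)).symm
  rw [h, smul_pow, LinearMap.smul_apply, formal_smul_apply, smul_smul, neg_pow]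
  congr 1
  ring

/-- Formal exponentials of commuting exponents multiply. -/
lemma thetaExp_mul (c : ℂ) {Q Q' : Fin p → Fin p → Module.End ℂ V}
    (h : ∀ k l k' l', Commute (Q k l) (Q' k' l')) :
    thetaExp c Q * thetaExp c Q' = thetaExp c (Q + Q') := by
  have hcomm := commute_thetaSum h
  refine LinearMap.ext fun x => eq_of_hasOrderGE_sub fun N => ?_
  rw [Module.End.mul_apply]
  set S := thetaSum Q
  set T := thetaSum Q'
  -- Four errors telescope: truncating the inner exponential, truncating the outer one, truncating
  -- the exponential of the sum, and the difference between the product of the truncations and the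
  -- truncation of the product.
  have e1 := (hasOrderGE_thetaExp_sub c Q' x N).thetaExp c Q
  have e2 := hasOrderGE_thetaExp_sub c Q
    (∑ n ∈ Finset.range N, (c ^ n / (n.factorial : ℂ)) • (T ^ n) x) N
  have e3 := (hasOrderGE_thetaExp_sub c (Q + Q') x N).smul (-1)
  have e4 : HasOrderGE N (∑ n ∈ Finset.range N, (c ^ n / (n.factorial : ℂ)) • (S ^ n)
      (∑ n ∈ Finset.range N, (c ^ n / (n.factorial : ℂ)) • (T ^ n) x) -
      ∑ n ∈ Finset.range N, (c ^ n / (n.factorial : ℂ)) • ((S + T) ^ n) x) := by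
    have a1 : ∑ n ∈ Finset.range N, (c ^ n / (n.factorial : ℂ)) • (S ^ n)
        (∑ n ∈ Finset.range N, (c ^ n / (n.factorial : ℂ)) • (T ^ n) x) =
        ∑ ij ∈ Finset.range N ×ˢ Finset.range N,
          ((c ^ ij.1 / (ij.1.factorial : ℂ)) * (c ^ ij.2 / (ij.2.factorial : ℂ))) •
            (S ^ ij.1) ((T ^ ij.2) x) := by
      rw [Finset.sum_product]
      refine Finset.sum_congr rfl fun i _ => ?_
      rw [map_sum, Finset.smul_sum]
      refine Finset.sum_congr rfl fun j _ => ?_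
      rw [map_smul, smul_smul]
    have a2 : ∑ n ∈ Finset.range N, (c ^ n / (n.factorial : ℂ)) • ((S + T) ^ n) x =
        ∑ ij ∈ Finset.range N ×ˢ Finset.range N with ij.1 + ij.2 < N,
          ((c ^ ij.1 / (ij.1.factorial : ℂ)) * (c ^ ij.2 / (ij.2.factorial : ℂ))) •
            (S ^ ij.1) ((T ^ ij.2) x) := by
      have a3 : ∀ n, (c ^ n / (n.factorial : ℂ)) • ((S + T) ^ n) x =
          ∑ ij ∈ Finset.HasAntidiagonal.antidiagonal n,
            ((c ^ ij.1 / (ij.1.factorial : ℂ)) * (c ^ ij.2 / (ij.2.factorial : ℂ))) •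
            (S ^ ij.1) ((T ^ ij.2) x) := by
        intro n
        rw [hcomm.add_pow', LinearMap.sum_apply, Finset.smul_sum]
        refine Finset.sum_congr rfl fun ij hij => ?_
        rw [Finset.HasAntidiagonal.mem_antidiagonal] at hij
        rw [LinearMap.smul_apply, Module.End.mul_apply, ← Nat.cast_smul_eq_nsmul ℂ, smul_smul]
        congr 1
        rw [← hij, Nat.cast_add_choose]
        have h1 : ((ij.1.factorial : ℕ) : ℂ) ≠ 0 := by exact_mod_cast Nat.factorial_ne_zero _
        have h2 : ((ij.2.factorial : ℕ) : ℂ) ≠ 0 := by exact_mod_cast Nat.factorial_ne_zero _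
        have h3 : (((ij.1 + ij.2).factorial : ℕ) : ℂ) ≠ 0 := by
          exact_mod_cast Nat.factorial_ne_zero _
        field_simp
        ring
      simp only [a3]
      exact sum_range_sum_antidiagonal N _
    -- The terms with i + j < N cancel by the binomial formula; each remaining term contains at
    -- least N factors of θ.
    rw [a1, a2, ← Finset.sum_filter_add_sum_filter_not (Finset.range N ×ˢ Finset.range N)
      (fun ij => ij.1 + ij.2 < N), add_sub_cancel_left]
    refine HasOrderGE.sum fun ij hij => HasOrderGE.smul _ ?_
    have h5 := ((hasOrderGE_zero x).thetaSum_pow Q' ij.2).thetaSum_pow Q ij.1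
    refine h5.mono ?_
    simp only [Finset.mem_filter] at hij
    omega
  have := ((e1.add e2).add e3).add e4
  rw [thetaSum_add] at this
  rw [map_sub] at this
  convert this using 1
  module

/-- A map is determined by its values on constants if it is `ℂ[[θ]]`-linear and continuous. -/
def IsFormal (G : Formal p V →ₗ[ℂ] Formal p Z) : Prop := fextend (G ∘ₗ const p) = G

lemma fextend_comp_fextend (F : V →ₗ[ℂ] Formal p Z) (F' : U →ₗ[ℂ] Formal p V) (x : Formal p U) :
    fextend F (fextend F' x) = fextend (fextend F ∘ₗ F') x := by
  funext m
  simp only [fextend_apply, LinearMap.comp_apply]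
  simp only [map_sum, formal_sum_apply]
  rw [Finset.sum_sigma', Finset.sum_sigma']
  refine Finset.sum_nbij' (fun t => ⟨(t.2.1, t.2.2 + t.1.2), (t.2.2, t.1.2)⟩)
    (fun t => ⟨(t.1.1 + t.2.1, t.2.2), (t.1.1, t.2.1)⟩) ?_ ?_ ?_ ?_ ?_
  all_goals
    rintro ⟨⟨i, j⟩, ⟨i', j'⟩⟩ h
    simp only [Finset.mem_sigma, Finset.HasAntidiagonal.mem_antidiagonal] at h ⊢
  · exact ⟨by rw [← h.1, ← h.2, add_assoc], trivial⟩
  · exact ⟨by rw [← h.1, ← h.2, add_assoc], trivial⟩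
  · obtain ⟨-, rfl⟩ := h
    rfl
  · obtain ⟨-, rfl⟩ := h
    rfl

lemma IsFormal.comp {G : Formal p V →ₗ[ℂ] Formal p Z} {G' : Formal p U →ₗ[ℂ] Formal p V}
    (hG : IsFormal G) (hG' : IsFormal G') : IsFormal (G ∘ₗ G') := by
  refine LinearMap.ext fun x => ?_
  have h1 : G (G' x) = fextend (G ∘ₗ const p) (fextend (G' ∘ₗ const p) x) := by rw [hG, hG']
  rw [LinearMap.comp_apply, h1, fextend_comp_fextend, hG]
  rfl

lemma isFormal_fmap (f : V →ₗ[ℂ] Z) : IsFormal (fmap f : Formal p V →ₗ[ℂ] Formal p Z) := by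
  refine LinearMap.ext fun x => funext fun m => ?_
  rw [fextend_apply, Finset.sum_eq_single (m, 0)]
  · simp [fmap_const, const_apply, fmap_apply]
  · rintro ⟨i, j⟩ hij hne
    rw [Finset.HasAntidiagonal.mem_antidiagonal] at hij
    have : j ≠ 0 := by
      rintro rfl
      exact hne (by simpa using hij)
    simp [fmap_const, const_apply, this]
  · intro h
    exact absurd (Finset.HasAntidiagonal.mem_antidiagonal.2 (add_zero m)) h

lemma IsFormal.sum {κ : Type*} {s : Finset κ} {G : κ → Formal p V →ₗ[ℂ] Formal p Z}
    (h : ∀ i ∈ s, IsFormal (G i)) : IsFormal (∑ i ∈ s, G i) := by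
  refine LinearMap.ext fun x => funext fun m => ?_
  rw [LinearMap.sum_apply, formal_sum_apply, fextend_apply]
  simp only [LinearMap.comp_apply, LinearMap.sum_apply, formal_sum_apply]
  rw [Finset.sum_comm]
  refine Finset.sum_congr rfl fun i hi => ?_
  conv_rhs => rw [← h i hi]
  rfl

lemma isFormal_smul (a : Formal p ℂ) :
    IsFormal (fmap₂ (LinearMap.lsmul ℂ V) a : Formal p V →ₗ[ℂ] Formal p V) := by
  refine LinearMap.ext fun x => funext fun m => ?_
  rw [fextend_apply, fmap₂_apply, ← sum_antidiagonal_swap]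
  refine Finset.sum_congr rfl fun ij _ => ?_
  rw [LinearMap.comp_apply, fmap₂_apply, Finset.sum_eq_single (ij.1, 0)]
  · simp [const_apply]
  · rintro ⟨i, j⟩ hij hne
    rw [Finset.HasAntidiagonal.mem_antidiagonal] at hij
    have : j ≠ 0 := by
      rintro rfl
      exact hne (by simpa using hij)
    simp [const_apply, this]
  · intro h
    exact absurd (Finset.HasAntidiagonal.mem_antidiagonal.2 (add_zero ij.1)) h

/-- Needed because the explicit product is prescribed on constants and extended by `fextend`: this
shows that a twist is recovered from its values on constants. -/
lemma isFormal_thetaExp (c : ℂ) (Q : Fin p → Fin p → Module.End ℂ V) :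
    IsFormal (thetaExp c Q) := by
  have hT : IsFormal (thetaSum Q) :=
    IsFormal.sum fun k _ => IsFormal.sum fun l _ => (isFormal_smul _).comp (isFormal_fmap _)
  have hp : ∀ n, IsFormal (thetaSum Q ^ n) := by
    intro n
    induction n with
    | zero => exact isFormal_fmap LinearMap.id
    | succ n ih =>
      rw [pow_succ]
      exact ih.comp hT
  refine LinearMap.ext fun x => funext fun m => ?_
  -- All coefficients of degree at most |m| can be computed with the same number of terms of the
  -- series, so the sums over n and over the antidiagonal can be interchanged.
  have hm : ∀ y (m' : Param p →₀ ℕ), m'.degree ≤ m.degree → thetaExp c Q y m' =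
      ∑ n ∈ Finset.range (m.degree + 1), (c ^ n / (n.factorial : ℂ)) •
        ((thetaSum Q ^ n) y) m' := by
    intro y m' hm'
    have := hasOrderGE_thetaExp_sub c Q y (m.degree + 1) m' (by omega)
    rw [formal_sub_apply, formal_sum_apply, sub_eq_zero] at this
    exact this
  rw [fextend_apply, hm x m le_rfl]
  have : ∀ n, ((thetaSum Q ^ n) x) m = ∑ ij ∈ Finset.HasAntidiagonal.antidiagonal m,
      ((thetaSum Q ^ n) (const p (x ij.1))) ij.2 := by
    intro n
    conv_lhs => rw [← hp n]
    rfl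
  simp only [this, Finset.smul_sum]
  rw [Finset.sum_comm]
  refine Finset.sum_congr rfl fun ij hij => ?_
  rw [Finset.HasAntidiagonal.mem_antidiagonal] at hij
  rw [LinearMap.comp_apply, hm]
  rw [← hij, map_add]
  omega

end FormalCalculus

/-! ### Exponentials of nilpotent elements -/

section NilExp

variable {R : Type*} [Ring R] [Algebra ℂ R]

/-- Any exponent with vanishing power may serve as cutoff. For a non-nilpotent element
`nilpotencyClass` is 0 and `nilExp` takes the junk value 0, so every use of the exponential must
come with a proof of nilpotency. -/
lemma nilExp_eq_sum {T : R} {M : ℕ} (h : T ^ M = 0) :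
    nilExp T = ∑ n ∈ Finset.range M, ((n.factorial : ℂ)⁻¹) • T ^ n := by
  have hle : nilpotencyClass T ≤ M := Nat.sInf_le h
  refine Finset.sum_subset (Finset.range_subset_range.2 hle) fun n _ hn => ?_
  rw [Finset.mem_range, not_lt] at hn
  rw [pow_eq_zero_of_le hn (pow_nilpotencyClass ⟨M, h⟩), smul_zero]

lemma nilExp_eq_exp [Module ℚ R] (T : R) : nilExp T = IsNilpotent.exp T := by
  refine Finset.sum_congr rfl fun n _ => ?_
  have h := Rat.cast_smul_eq_qsmul ℂ ((n.factorial : ℚ)⁻¹) (T ^ n)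
  rw [← h]
  norm_num

lemma nilExp_add_of_commute {S T : R} (h : Commute S T) (hS : IsNilpotent S)
    (hT : IsNilpotent T) : nilExp (S + T) = nilExp S * nilExp T := by
  let _ : Module ℚ R := Module.compHom R (algebraMap ℚ ℂ)
  simp only [nilExp_eq_exp]
  exact IsNilpotent.exp_add_of_commute h hS hT

lemma nilExp_zero : nilExp (0 : R) = 1 := by
  rw [nilExp_eq_sum (M := 1) (pow_one 0)]
  simp

lemma nilExp_mul_nilExp_neg {T : R} (hT : IsNilpotent T) : nilExp T * nilExp (-T) = 1 := by
  rw [← nilExp_add_of_commute (Commute.neg_right (Commute.refl T)) hT hT.neg, add_neg_cancel,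
    nilExp_zero]

lemma map_nilExp {R' : Type*} [Ring R'] [Algebra ℂ R'] (φ : R →ₐ[ℂ] R') {T : R}
    (hT : IsNilpotent T) : φ (nilExp T) = nilExp (φ T) := by
  obtain ⟨M, hM⟩ := hT
  rw [nilExp_eq_sum hM, nilExp_eq_sum (M := M) (by rw [← map_pow, hM, map_zero]), map_sum]
  simp only [map_smul, map_pow]

lemma commute_nilExp {S T : R} (h : Commute S T) : Commute S (nilExp T) :=
  Commute.sum_right _ _ _ fun n _ => (h.pow_right n).smul_right _

lemma nilExp_intertwine {V Z : Type*} [AddCommGroup V] [Module ℂ V] [AddCommGroup Z] [Module ℂ Z]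
    {S : Module.End ℂ V} {T : Module.End ℂ Z} (hS : IsNilpotent S) (hT : IsNilpotent T)
    (f : V →ₗ[ℂ] Z) (h : f ∘ₗ S = T ∘ₗ f) : f ∘ₗ nilExp S = nilExp T ∘ₗ f := by
  obtain ⟨M, hM⟩ := hS
  obtain ⟨N, hN⟩ := hT
  rw [nilExp_eq_sum (M := M + N) (by rw [pow_add, hM, zero_mul]),
    nilExp_eq_sum (M := M + N) (by rw [pow_add, hN, mul_zero])]
  have hp : ∀ n, ∀ x, f ((S ^ n) x) = (T ^ n) (f x) := by
    intro n x
    induction n with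
    | zero => rfl
    | succ n ih =>
      rw [pow_succ', pow_succ', Module.End.mul_apply, Module.End.mul_apply, ← ih]
      exact LinearMap.congr_fun h _
  refine LinearMap.ext fun x => ?_
  simp only [LinearMap.comp_apply, LinearMap.sum_apply, LinearMap.smul_apply, map_sum, map_smul, hp]

/-- The Baker-Campbell-Hausdorff formula for a Heisenberg triple `[K, X] = N` acting on a vector
annihilated by `K`, transported along an intertwiner. -/
lemma nilExp_heisenberg {V Z : Type*} [AddCommGroup V] [Module ℂ V] [AddCommGroup Z] [Module ℂ Z]
    {T : Module.End ℂ Z} {X K N : Module.End ℂ V} (m : V →ₗ[ℂ] Z)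
    (hm : T ∘ₗ m = m ∘ₗ (X + K)) (hKX : K * X = X * K + N) (hXN : Commute X N) (hKN : Commute K N)
    (hT : IsNilpotent T) (hX : IsNilpotent X) (hN : IsNilpotent N) {v : V} (hv : K v = 0) :
    nilExp T (m (nilExp (-((1 / 2 : ℂ) • N)) v)) = m (nilExp X v) := by
  set Y : Module.End ℂ V := (1 / 2 : ℂ) • N with hY
  have hYn : IsNilpotent Y := hN.smul _
  have hKY : Commute K Y := hKN.smul_right _
  have hXY : Commute X Y := hXN.smul_right _
  -- The vector w = exp(-N/2) v is still annihilated by K, and the claim becomes exp(T) m(w) =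
  -- m(exp(X) exp(N/2) w). Nilpotency of K is not available, so exp(K) is never formed.
  set w := nilExp (-Y) v with hw
  have hKw : K w = 0 := by
    have := LinearMap.congr_fun (commute_nilExp hKY.neg_right).eq v
    rw [Module.End.mul_apply, Module.End.mul_apply, hv, map_zero] at this
    exact this
  have hvw : v = nilExp Y w := by
    rw [hw, ← Module.End.mul_apply, nilExp_mul_nilExp_neg hYn, Module.End.one_apply]
  obtain ⟨a, ha⟩ := hX
  obtain ⟨b, hb⟩ := hYn
  obtain ⟨c, hc⟩ := hT
  -- `xs` and `ys` are the Taylor coefficients in t of exp(tX) and exp(t²N/2); the latter has only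
  -- even terms.
  set xs : ℕ → Module.End ℂ V := fun i => ((i.factorial : ℂ)⁻¹) • X ^ i with hxs
  set ys : ℕ → Module.End ℂ V := fun j => if Even j then (((j / 2).factorial : ℂ)⁻¹) • Y ^ (j / 2)
    else 0 with hys
  have hfac : ∀ i : ℕ, ((i + 1 : ℕ) : ℂ) * (((i + 1).factorial : ℕ) : ℂ)⁻¹ =
      ((i.factorial : ℕ) : ℂ)⁻¹ := by
    intro i
    rw [Nat.factorial_succ, Nat.cast_mul, mul_inv, ← mul_assoc, mul_inv_cancel₀, one_mul]
    exact_mod_cast Nat.succ_ne_zero i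
  have hx1 : ∀ i, ((i + 1 : ℕ) : ℂ) • xs (i + 1) = X * xs i := by
    intro i
    simp only [hxs]
    rw [smul_smul, hfac, pow_succ', mul_smul_comm]
  have hy1 : ys 1 = 0 := by simp [hys]
  have hy2 : ∀ j, ((j + 2 : ℕ) : ℂ) • ys (j + 2) = N * ys j := by
    intro j
    simp only [hys]
    by_cases hj : Even j
    · obtain ⟨r, rfl⟩ := hj
      have e1 : (r + r + 2) / 2 = r + 1 := by omega
      have e2 : (r + r) / 2 = r := by omega
      rw [if_pos ⟨r + 1, by ring⟩, if_pos ⟨r, rfl⟩, e1, e2, smul_smul]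
      have e3 : ((r + r + 2 : ℕ) : ℂ) = 2 * ((r + 1 : ℕ) : ℂ) := by push_cast; ring
      rw [e3, mul_assoc, hfac, pow_succ', hY, mul_smul_comm, smul_mul_assoc, smul_smul]
      congr 1
      ring
    · rw [if_neg hj, if_neg (by rwa [Nat.even_add_one, Nat.even_add_one, not_not]),
        smul_zero, mul_zero]
  have hKys : ∀ j, K (ys j w) = 0 := by
    intro j
    have hcm : Commute K (ys j) := by
      simp only [hys]
      split_ifs
      · exact (hKY.pow_right _).smul_right _
      · exact Commute.zero_right _
    have := LinearMap.congr_fun hcm.eq w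
    rwa [Module.End.mul_apply, Module.End.mul_apply, hKw, map_zero] at this
  have hKxs : ∀ i, K * xs (i + 1) = xs (i + 1) * K + N * xs i := by
    have hp : ∀ i : ℕ, K * X ^ (i + 1) = X ^ (i + 1) * K + ((i + 1 : ℕ) : ℂ) • (N * X ^ i) := by
      intro i
      induction i with
      | zero => simp [hKX]
      | succ i ih =>
        rw [pow_succ X (i + 1), ← mul_assoc, ih, add_mul, mul_assoc, hKX, mul_add,
          smul_mul_assoc, mul_assoc N, ← pow_succ, (hXN.pow_left (i + 1)).eq, mul_assoc]
        push_cast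
        module
    intro i
    simp only [hxs]
    rw [mul_smul_comm, hp, smul_add, smul_mul_assoc, smul_smul, mul_comm, hfac, mul_smul_comm]
  have hK0 : K * xs 0 = xs 0 * K := by simp [hxs]
  -- `G n` is the coefficient of tⁿ in exp(tX) exp(t²N/2) w.
  set G : ℕ → V := fun n => ∑ ij ∈ Finset.HasAntidiagonal.antidiagonal n, xs ij.1 (ys ij.2 w)
    with hG
  have hGK : ∀ n, K (G (n + 1)) =
      ∑ ij ∈ Finset.HasAntidiagonal.antidiagonal n, N (xs ij.1 (ys ij.2 w)) := by
    intro n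
    simp only [hG]
    rw [Finset.Nat.sum_antidiagonal_succ, map_add, map_sum]
    have h0 : K (xs 0 (ys (n + 1) w)) = 0 := by
      rw [← Module.End.mul_apply, hK0, Module.End.mul_apply, hKys, map_zero]
    rw [h0, zero_add]
    refine Finset.sum_congr rfl fun ij _ => ?_
    rw [← Module.End.mul_apply, hKxs, LinearMap.add_apply, Module.End.mul_apply, hKys, map_zero,
      zero_add, Module.End.mul_apply]
  have hGK0 : K (G 0) = 0 := by
    simp only [hG]
    rw [Finset.Nat.antidiagonal_zero, Finset.sum_singleton, ← Module.End.mul_apply, hK0,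
      Module.End.mul_apply, hKys, map_zero]
  -- This is the differential equation F' = (X + K) F for F(t) = exp(tX) exp(t²N/2) w. Moving K past
  -- exp(tX) produces tN, which is the logarithmic derivative of exp(t²N/2).
  have hGrec : ∀ n, ((n + 1 : ℕ) : ℂ) • G (n + 1) = (X + K) (G n) := by
    intro n
    have hsplit : ((n + 1 : ℕ) : ℂ) • G (n + 1) =
        ∑ ij ∈ Finset.HasAntidiagonal.antidiagonal (n + 1), (ij.1 : ℂ) • xs ij.1 (ys ij.2 w) +
        ∑ ij ∈ Finset.HasAntidiagonal.antidiagonal (n + 1), (ij.2 : ℂ) • xs ij.1 (ys ij.2 w) := by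
      simp only [hG]
      rw [Finset.smul_sum, ← Finset.sum_add_distrib]
      refine Finset.sum_congr rfl fun ij hij => ?_
      rw [Finset.HasAntidiagonal.mem_antidiagonal] at hij
      rw [← hij, ← add_smul]
      push_cast
      rfl
    rw [hsplit, LinearMap.add_apply]
    congr 1
    · rw [Finset.Nat.sum_antidiagonal_succ, Nat.cast_zero, zero_smul, zero_add]
      simp only [hG]
      rw [map_sum]
      refine Finset.sum_congr rfl fun ij _ => ?_
      rw [← LinearMap.smul_apply, hx1, Module.End.mul_apply]
    · rw [Finset.Nat.sum_antidiagonal_succ', Nat.cast_zero, zero_smul, zero_add]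
      rcases n with _ | n
      · rw [hGK0, Finset.Nat.antidiagonal_zero, Finset.sum_singleton]
        simp [hy1]
      · rw [hGK, Finset.Nat.sum_antidiagonal_succ']
        simp only [zero_add, hy1, LinearMap.zero_apply, map_zero, smul_zero]
        refine Finset.sum_congr rfl fun ij _ => ?_
        have hc : Commute N (xs ij.1) := (hXN.symm.pow_right _).smul_right _
        have h2 := hy2 ij.2
        rw [← map_smul, ← LinearMap.smul_apply, add_assoc, one_add_one_eq_two, h2,
          Module.End.mul_apply]
        exact (LinearMap.congr_fun hc.eq _).symm
  have hTG : ∀ n, (((n.factorial : ℂ)⁻¹) • T ^ n) (m w) = m (G n) := by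
    intro n
    induction n with
    | zero => simp [hG, hxs, hys]
    | succ n ih =>
      have hne : ((n + 1 : ℕ) : ℂ) ≠ 0 := by exact_mod_cast Nat.succ_ne_zero n
      refine smul_right_injective _ hne ?_
      change ((n + 1 : ℕ) : ℂ) • _ = ((n + 1 : ℕ) : ℂ) • _
      have hmG : T (m (G n)) = m ((X + K) (G n)) := LinearMap.congr_fun hm (G n)
      rw [← map_smul m, hGrec, ← hmG, ← ih,
        ← LinearMap.smul_apply, smul_smul, hfac, pow_succ', LinearMap.smul_apply,
        LinearMap.smul_apply, map_smul, Module.End.mul_apply]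
  have hxa : ∀ i, a ≤ i → xs i = 0 := fun i hi => by
    simp only [hxs]
    rw [pow_eq_zero_of_le hi ha, smul_zero]
  have hyb : ∀ j, 2 * b ≤ j → ys j = 0 := fun j hj => by
    simp only [hys]
    split_ifs
    · rw [pow_eq_zero_of_le (by omega) hb, smul_zero]
    · rfl
  -- Large enough for all the series at once: `xs` vanishes from a on, `ys` from 2b on, and T^c = 0.
  set L := a + 2 * b + c with hL
  have hexpY : nilExp Y w = ∑ j ∈ Finset.range (2 * b), ys j w := by
    rw [nilExp_eq_sum hb, LinearMap.sum_apply]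
    have hgen : ∀ r, ∑ k ∈ Finset.range r, (((k.factorial : ℂ)⁻¹) • Y ^ k) w =
        ∑ j ∈ Finset.range (2 * r), ys j w := by
      intro r
      induction r with
      | zero => simp
      | succ r ih =>
        have e0 : 2 * (r + 1) = 2 * r + 1 + 1 := by ring
        have e1 : 2 * r / 2 = r := by omega
        have e2 : ¬ Even (2 * r + 1) := by simp
        rw [e0, Finset.sum_range_succ, Finset.sum_range_succ, Finset.sum_range_succ, ih]
        simp only [hys]
        rw [if_pos (even_two_mul r), if_neg e2, e1, LinearMap.zero_apply, add_zero]
    exact hgen b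
  rw [hvw, hexpY, nilExp_eq_sum (M := L) (by rw [hL, pow_add, hc, mul_zero]), nilExp_eq_sum ha,
    LinearMap.sum_apply]
  simp only [hTG]
  rw [← map_sum]
  congr 1
  simp only [hG]
  rw [sum_range_sum_antidiagonal L (fun ij => xs ij.1 (ys ij.2 w))]
  have hprod : ∑ i ∈ Finset.range a, (((i.factorial : ℂ)⁻¹) • X ^ i)
      (∑ j ∈ Finset.range (2 * b), ys j w) =
      ∑ ij ∈ Finset.range a ×ˢ Finset.range (2 * b), xs ij.1 (ys ij.2 w) := by
    rw [Finset.sum_product]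
    exact Finset.sum_congr rfl fun i _ => map_sum _ _ _
  rw [LinearMap.sum_apply, hprod]
  symm
  refine Finset.sum_subset ?_ ?_
  · rintro ⟨i, j⟩ h
    simp only [Finset.mem_product, Finset.mem_range, Finset.mem_filter] at h ⊢
    omega
  · rintro ⟨i, j⟩ _ h
    simp only [Finset.mem_product, Finset.mem_range, not_and_or, not_lt] at h
    rcases h with h | h
    · rw [hxa i h, LinearMap.zero_apply]
    · rw [hyb j h, LinearMap.zero_apply, map_zero]

/-- A combination of anticommuting square-zero elements with coefficients commuting with them is
nilpotent. -/
lemma isNilpotent_sum_mul {g ι : Type*} [AddCommGroup g] [Module ℂ g] [Fintype ι]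
    (e : Module.Basis ι ℂ g) (φ : g →ₗ[ℂ] R) (hφ : ∀ x, φ x * φ x = 0) (c : ι → R)
    (hc : ∀ a x, Commute (c a) (φ x)) : IsNilpotent (∑ a, c a * φ (e a)) := by
  have hfin : Module.Finite ℂ g := Module.Finite.of_basis e
  set T := ∑ a, c a * φ (e a) with hT
  -- `J n` is spanned by the left multiples of words of length n in the values of φ. Since the
  -- coefficients commute with these values, they can be collected on the left.
  let J : ℕ → Submodule ℂ R := fun n => Submodule.span ℂ
    {r | ∃ (s : R) (v : Fin n → g), r = s * (List.ofFn fun i => φ (v i)).prod}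
  have hJ : ∀ n, T ^ n ∈ J n := by
    intro n
    induction n with
    | zero => exact Submodule.subset_span ⟨1, Fin.elim0, by simp⟩
    | succ n ih =>
      rw [pow_succ]
      have : ∀ r ∈ J n, r * T ∈ J (n + 1) := by
        intro r hr
        induction hr using Submodule.span_induction with
        | mem r h =>
          obtain ⟨s, v, rfl⟩ := h
          rw [hT, Finset.mul_sum]
          refine Submodule.sum_mem _ fun a _ => Submodule.subset_span
            ⟨s * c a, Fin.snoc v (e a), ?_⟩
          have hcm : Commute (c a) (List.ofFn fun i => φ (v i)).prod := by
            refine Commute.list_prod_right _ _ fun y hy => ?_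
            rw [List.mem_ofFn] at hy
            obtain ⟨i, rfl⟩ := hy
            exact hc a _
          have hl : (List.ofFn fun i => φ ((Fin.snoc v (e a) : Fin (n + 1) → g) i)).prod =
              (List.ofFn fun i => φ (v i)).prod * φ (e a) := by
            rw [List.ofFn_succ']
            simp
          rw [hl, mul_assoc, ← mul_assoc _ (c a), ← hcm.eq]
          simp only [mul_assoc]
        | zero => rw [zero_mul]; exact Submodule.zero_mem _
        | add x y _ _ hx hy => rw [add_mul]; exact Submodule.add_mem _ hx hy
        | smul t x _ hx => rw [smul_mul_assoc]; exact Submodule.smul_mem _ _ hx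
      exact this _ ih
  refine ⟨Module.finrank ℂ g + 1, ?_⟩
  have hz : J (Module.finrank ℂ g + 1) = ⊥ := by
    rw [Submodule.span_eq_bot]
    rintro r ⟨s, v, rfl⟩
    -- A word longer than dim g has linearly dependent letters. Because φ squares to zero it extends
    -- to the exterior algebra, where the corresponding product vanishes.
    have hld : ¬ LinearIndependent ℂ v := by
      intro hli
      have := hli.fintype_card_le_finrank
      rw [Fintype.card_fin] at this
      omega
    have h0 := (ExteriorAlgebra.ιMulti ℂ (M := g) (Module.finrank ℂ g + 1)).map_linearDependent
      v hld
    have h1 := congrArg (ExteriorAlgebra.lift ℂ ⟨φ, hφ⟩) h0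
    rw [ExteriorAlgebra.ιMulti_apply, map_list_prod, map_zero, List.map_ofFn] at h1
    have h2 : (⇑(ExteriorAlgebra.lift ℂ ⟨φ, hφ⟩) ∘ fun i => ExteriorAlgebra.ι ℂ (v i)) =
        fun i => φ (v i) := by
      funext i
      simp
    rw [h2] at h1
    rw [h1, mul_zero]
  have := hJ (Module.finrank ℂ g + 1)
  rw [hz] at this
  exact (Submodule.mem_bot ℂ).1 this

end NilExp

/-! ### The noncommutative Weil algebra -/

section WeilAlgebra

variable {g : Type*} [LieRing g] [LieAlgebra ℂ g] (B : LinearMap.BilinForm ℂ g)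

namespace Weil

/-- The even generators, linearly. -/
def evenHom : g →ₗ[ℂ] Weil B :=
  (Weil.mk B).toLinearMap ∘ₗ TensorAlgebra.ι ℂ ∘ₗ LinearMap.inl ℂ g g

/-- The odd generators, linearly. -/
def oddHom : g →ₗ[ℂ] Weil B :=
  (Weil.mk B).toLinearMap ∘ₗ TensorAlgebra.ι ℂ ∘ₗ LinearMap.inr ℂ g g

lemma oddHom_apply (x : g) : oddHom B x = odd B x := rfl

lemma even_mul_even (x y : g) :
    even B x * even B y = even B y * even B x + even B ⁅x, y⁆ := by
  have := mk_rel B (WeilRel.even_even x y)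
  simpa only [even, map_mul, map_add] using this

lemma even_mul_odd (x y : g) :
    even B x * odd B y = odd B y * even B x + odd B ⁅x, y⁆ := by
  have := mk_rel B (WeilRel.even_odd x y)
  simpa only [even, odd, map_mul, map_add] using this

lemma odd_mul_odd (x y : g) :
    odd B x * odd B y + odd B y * odd B x = algebraMap ℂ _ (B x y) := by
  have := mk_rel B (WeilRel.odd_odd x y)
  simpa only [odd, map_mul, map_add, AlgHom.commutes] using this

lemma parity_mk (t : TensorAlgebra ℂ (g × g)) :
    parity B (mk B t) = TensorAlgebra.lift ℂ (parityGen B) t :=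
  RingQuot.liftAlgHom_mkAlgHom_apply _ _ _ _

lemma parity_even (x : g) : parity B (even B x) = even B x := by
  rw [even, parity_mk, TensorAlgebra.lift_ι_apply, parityGen_even]
  rfl

lemma parity_odd (x : g) : parity B (odd B x) = -odd B x := by
  rw [odd, parity_mk, TensorAlgebra.lift_ι_apply, parityGen_odd]
  rfl

/-- Algebra homomorphisms out of the Weil algebra are determined on the generators. -/
lemma algHom_ext {R : Type*} [Ring R] [Algebra ℂ R] {φ ψ : Weil B →ₐ[ℂ] R}
    (he : ∀ x, φ (even B x) = ψ (even B x)) (ho : ∀ x, φ (odd B x) = ψ (odd B x)) : φ = ψ := by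
  have h : φ.comp (mk B) = ψ.comp (mk B) := by
    refine TensorAlgebra.hom_ext (LinearMap.ext fun xy => ?_)
    obtain ⟨x, y⟩ := xy
    have hxy : ((x, y) : g × g) = (x, 0) + (0, y) := by simp
    rw [hxy, map_add, map_add]
    exact congrArg₂ (· + ·) (he x) (ho y)
  exact RingQuot.ringQuot_ext' ℂ φ ψ h

lemma parity_parity (w : Weil B) : parity B (parity B w) = w := by
  have h : (parity B).comp (parity B) = AlgHom.id ℂ (Weil B) :=
    algHom_ext B (fun x => by simp [parity_even]) (fun x => by simp [parity_odd])
  exact DFunLike.congr_fun h w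

/-- The adjoint action of the even generator `e_x`. -/
def ad (x : g) : Module.End ℂ (Weil B) :=
  LinearMap.mulLeft ℂ (even B x) - LinearMap.mulRight ℂ (even B x)

/-- The adjoint action of the odd generator `ξ_x`. -/
def contr (x : g) : Module.End ℂ (Weil B) :=
  LinearMap.mulLeft ℂ (odd B x) - LinearMap.mulRight ℂ (odd B x) * (parity B).toLinearMap

lemma ad_apply (x : g) (w : Weil B) : ad B x w = even B x * w - w * even B x := rfl

lemma contr_apply (x : g) (w : Weil B) :
    contr B x w = odd B x * w - parity B w * odd B x := rfl

lemma ad_mul (x : g) (w w' : Weil B) : ad B x (w * w') = ad B x w * w' + w * ad B x w' := by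
  simp only [ad_apply]
  noncomm_ring

lemma contr_mul (x : g) (w w' : Weil B) :
    contr B x (w * w') = contr B x w * w' + parity B w * contr B x w' := by
  simp only [contr_apply, map_mul]
  noncomm_ring

lemma ad_odd (x y : g) : ad B x (odd B y) = odd B ⁅x, y⁆ := by
  rw [ad_apply, even_mul_odd, add_sub_cancel_left]

lemma ad_even (x y : g) : ad B x (even B y) = even B ⁅x, y⁆ := by
  rw [ad_apply, even_mul_even, add_sub_cancel_left]

lemma contr_odd (x y : g) : contr B x (odd B y) = algebraMap ℂ _ (B x y) := by
  rw [contr_apply, parity_odd, neg_mul, sub_neg_eq_add, odd_mul_odd]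

lemma parity_ad (x : g) (w : Weil B) : parity B (ad B x w) = ad B x (parity B w) := by
  simp only [ad_apply, map_sub, map_mul, parity_even]

lemma parity_contr (x : g) (w : Weil B) : parity B (contr B x w) = -contr B x (parity B w) := by
  simp only [contr_apply, map_sub, map_mul, parity_odd]
  noncomm_ring

end Weil

/-! ### Reflections in the Weil algebra and the parity of horizontal elements. -/

section Horizontal

variable {B}

lemma Weil.odd_mul_self (x : g) (hx : B x x ≠ 0) :
    (2 / B x x) • (Weil.odd B x * Weil.odd B x) = 1 := by
  have h := Weil.odd_mul_odd B x x
  rw [← two_smul ℂ, Algebra.algebraMap_eq_smul_one] at h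
  rw [div_eq_inv_mul, mul_smul, h, smul_smul, inv_mul_cancel₀ hx, one_smul]

/-- The automorphism of the Weil algebra induced by the reflection in a non-isotropic vector. -/
def Weil.reflection (x : g) (hx : B x x ≠ 0) : Weil B →ₐ[ℂ] Weil B :=
  AlgHom.ofLinearMap ((2 / B x x) • (LinearMap.mulLeft ℂ (Weil.odd B x) ∘ₗ
      LinearMap.mulRight ℂ (Weil.odd B x) ∘ₗ (Weil.parity B).toLinearMap))
    (by
      simp only [LinearMap.smul_apply, LinearMap.comp_apply, LinearMap.mulLeft_apply,
        LinearMap.mulRight_apply, AlgHom.toLinearMap_apply, map_one, one_mul]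
      exact Weil.odd_mul_self x hx)
    (by
      intro w w'
      simp only [LinearMap.smul_apply, LinearMap.comp_apply, LinearMap.mulLeft_apply,
        LinearMap.mulRight_apply, AlgHom.toLinearMap_apply, map_mul]
      rw [smul_mul_smul_comm]
      have e : Weil.odd B x * (Weil.parity B w * Weil.odd B x) *
          (Weil.odd B x * (Weil.parity B w' * Weil.odd B x)) =
          Weil.odd B x * Weil.parity B w * (Weil.odd B x * Weil.odd B x) *
            (Weil.parity B w' * Weil.odd B x) := by noncomm_ring
      rw [e, mul_smul]
      congr 1
      rw [← smul_mul_assoc, ← mul_smul_comm, Weil.odd_mul_self x hx, mul_one]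
      noncomm_ring)

lemma Weil.reflection_apply (x : g) (hx : B x x ≠ 0) (w : Weil B) :
    Weil.reflection x hx w =
      (2 / B x x) • (Weil.odd B x * (Weil.parity B w * Weil.odd B x)) := rfl

/-- In this form it is plain that a reflection fixes every element whose contraction with ξ_x
vanishes. -/
lemma Weil.reflection_eq_sub (x : g) (hx : B x x ≠ 0) (w : Weil B) :
    Weil.reflection x hx w = w - (2 / B x x) • (Weil.odd B x * Weil.contr B x w) := by
  rw [Weil.reflection_apply, Weil.contr_apply, mul_sub, smul_sub, ← mul_assoc _ _ w,
    ← smul_mul_assoc _ _ w,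
    Weil.odd_mul_self x hx, one_mul, sub_sub_cancel]

lemma Weil.reflection_odd (x y : g) (hx : B x x ≠ 0) :
    Weil.reflection x hx (Weil.odd B y) =
      Weil.odd B y - (2 * B x y / B x x) • Weil.odd B x := by
  rw [Weil.reflection_eq_sub, Weil.contr_odd, Algebra.algebraMap_eq_smul_one, mul_smul_comm,
    mul_one, smul_smul]
  congr 2
  ring

/-- The Weil algebra has an inner parity: horizontal elements are even. -/
theorem parity_rTensor_eq_self_of_horizontal {ι : Type*} [Fintype ι] (e : Module.Basis ι ℂ g)
    (hsymm : B.IsSymm) (hnd : B.Nondegenerate) (hinv : B.lieInvariant g)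
    {A : Type*} [AddCommGroup A] [Module ℂ A] (t : Weil B ⊗[ℂ] A)
    (ht : ∀ x, (Weil.contr B x).rTensor A t = 0) :
    (Weil.parity B).toLinearMap.rTensor A t = t := by
  have hfin : Module.Finite ℂ g := Module.Finite.of_basis e
  obtain ⟨f, hf⟩ := LinearMap.BilinForm.exists_orthogonal_basis (B := B)
    (LinearMap.isSymm_def.2 fun x y => hsymm.eq x y)
  have hne : ∀ j, B (f j) (f j) ≠ 0 := fun j =>
    hf.not_isOrtho_basis_self_of_separatingLeft hnd.1 j
  have hort : ∀ i j, i ≠ j → B (f i) (f j) = 0 := fun i j hij => hf hij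
  set σ := fun j => Weil.reflection (f j) (hne j) with hσ
  -- Composites of reflections in the vectors of an orthogonal basis. Taken over the whole basis,
  -- the composite is -1 on the odd generators; it will be shown to be the parity involution.
  set ρl : List (Fin (Module.finrank ℂ g)) → (Weil B →ₐ[ℂ] Weil B) :=
    fun l => (l.map σ).prod with hρ
  have hcons : ∀ j l w, ρl (j :: l) w = σ j (ρl l w) := by
    intro j l w
    simp [hρ, AlgHom.mul_apply]
  have hnil : ∀ w, ρl [] w = w := by
    intro w
    simp [hρ, AlgHom.one_apply]
  have hfixT : ∀ l, (ρl l).toLinearMap.rTensor A t = t := by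
    intro l
    induction l with
    | nil =>
      have : (ρl []).toLinearMap = LinearMap.id := LinearMap.ext hnil
      rw [this, LinearMap.rTensor_id, LinearMap.id_apply]
    | cons j l ih =>
      have : (ρl (j :: l)).toLinearMap = (σ j).toLinearMap ∘ₗ (ρl l).toLinearMap :=
        LinearMap.ext (hcons j l)
      rw [this, LinearMap.rTensor_comp, LinearMap.comp_apply, ih]
      have h2 : (σ j).toLinearMap = LinearMap.id - ((2 / B (f j) (f j)) •
          LinearMap.mulLeft ℂ (Weil.odd B (f j))) ∘ₗ Weil.contr B (f j) := by
        refine LinearMap.ext fun w => ?_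
        simp only [hσ, AlgHom.toLinearMap_apply, LinearMap.sub_apply, LinearMap.id_apply,
          LinearMap.comp_apply, LinearMap.smul_apply, LinearMap.mulLeft_apply]
        exact Weil.reflection_eq_sub _ _ _
      rw [h2, LinearMap.rTensor_sub, LinearMap.rTensor_comp, LinearMap.sub_apply,
        LinearMap.comp_apply, ht, map_zero, sub_zero, LinearMap.rTensor_id, LinearMap.id_apply]
  have hfixW : ∀ w, (∀ x, Weil.contr B x w = 0) → ∀ l, ρl l w = w := by
    intro w hw l
    induction l with
    | nil => exact hnil w
    | cons j l ih =>
      rw [hcons, ih, hσ]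
      exact (Weil.reflection_eq_sub _ _ _).trans (by rw [hw, mul_zero, smul_zero, sub_zero])
  have hodd : ∀ l : List (Fin (Module.finrank ℂ g)), l.Nodup → ∀ i,
      ρl l (Weil.odd B (f i)) = if i ∈ l then -Weil.odd B (f i) else Weil.odd B (f i) := by
    intro l hl i
    induction l with
    | nil => simp [hnil]
    | cons j l ih =>
      rw [List.nodup_cons] at hl
      rw [hcons, ih hl.2]
      by_cases hij : i = j
      · subst hij
        rw [if_neg hl.1, if_pos (by simp), hσ]
        refine (Weil.reflection_odd _ _ _).trans ?_
        rw [mul_div_cancel_right₀ _ (hne i), two_smul]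
        abel
      · have hr : σ j (Weil.odd B (f i)) = Weil.odd B (f i) := by
          refine (Weil.reflection_odd _ _ _).trans ?_
          rw [hort j i (Ne.symm hij), mul_zero, zero_div, zero_smul, sub_zero]
        by_cases hil : i ∈ l
        · rw [if_pos hil, if_pos (by simp [hil]), map_neg, hr]
        · rw [if_neg hil, if_neg (by simp [hil, hij]), hr]
  set ρt := ρl (List.finRange _) with hρt
  have hoddT : ∀ x, ρt (Weil.odd B x) = -Weil.odd B x := by
    have h : ρt.toLinearMap ∘ₗ Weil.oddHom B = -Weil.oddHom B := by
      refine f.ext fun i => ?_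
      rw [LinearMap.comp_apply, LinearMap.neg_apply, Weil.oddHom_apply]
      exact (hodd _ (List.nodup_finRange _) i).trans (if_pos (List.mem_finRange i))
    exact fun x => LinearMap.congr_fun h x
  -- the quadratic elements implementing the adjoint action on the odd generators
  set c : g → Weil B := fun x => ∑ j, (1 / 2 / B (f j) (f j)) •
    (Weil.odd B ⁅x, f j⁆ * Weil.odd B (f j)) with hc
  have hexpand : ∀ y, y = ∑ j, (B (f j) y / B (f j) (f j)) • f j := by
    intro y
    conv_lhs => rw [← f.sum_repr y]
    refine Finset.sum_congr rfl fun j _ => ?_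
    congr 1
    rw [eq_div_iff (hne j)]
    conv_rhs => rw [← f.sum_repr y, map_sum]
    rw [Finset.sum_eq_single j]
    · rw [map_smul, smul_eq_mul]
    · intro i _ hij
      rw [map_smul, hort j i (Ne.symm hij), smul_zero]
    · exact fun h => absurd (Finset.mem_univ j) h
  have hodd_expand : ∀ y, Weil.odd B y =
      ∑ j, (B (f j) y / B (f j) (f j)) • Weil.odd B (f j) := by
    intro y
    have := congrArg (Weil.oddHom B) (hexpand y)
    rw [map_sum] at this
    simpa only [map_smul, Weil.oddHom_apply] using this
  have hcpar : ∀ x, Weil.parity B (c x) = c x := by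
    intro x
    simp only [hc, map_sum, map_smul, map_mul, Weil.parity_odd, neg_mul_neg]
  have hcρ : ∀ x, ρt (c x) = c x := by
    intro x
    simp only [hc, map_sum, map_smul, map_mul, hoddT, neg_mul_neg]
  have hcc : ∀ x y, Weil.contr B y (c x) = Weil.odd B ⁅y, x⁆ := by
    intro x y
    have h1 : Weil.contr B y (c x) = ∑ j, (1 / 2 / B (f j) (f j)) •
        (B y ⁅x, f j⁆ • Weil.odd B (f j) - B y (f j) • Weil.odd B ⁅x, f j⁆) := by
      simp only [hc, map_sum, map_smul]
      refine Finset.sum_congr rfl fun j _ => ?_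
      rw [Weil.contr_mul, Weil.contr_odd, Weil.contr_odd, Weil.parity_odd,
        Algebra.algebraMap_eq_smul_one, Algebra.algebraMap_eq_smul_one, smul_one_mul,
        mul_smul_comm, mul_one, smul_neg, sub_eq_add_neg]
    have h2 : ∀ j, B y ⁅x, f j⁆ = B (f j) ⁅y, x⁆ := by
      intro j
      rw [hsymm.eq, hinv, ← lie_skew, map_neg, neg_neg]
    have h3 : Weil.odd B ⁅y, x⁆ = ∑ j, (B (f j) y / B (f j) (f j)) • Weil.odd B ⁅f j, x⁆ := by
      have h := congrArg (fun z => Weil.oddHom B ⁅z, x⁆) (hexpand y)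
      simp only [LieSubmodule.coe_toSubmodule, sum_lie, smul_lie, map_sum, map_smul] at h
      exact h
    have h4 := hodd_expand ⁅y, x⁆
    -- Contracting the two factors of each quadratic term gives two sums, each equal to one half of
    -- ξ_{[y,x]}: one by expanding [y, x] in the orthogonal basis, the other by expanding y.
    have h5 : Weil.odd B ⁅y, x⁆ =
        (1 / 2 : ℂ) • Weil.odd B ⁅y, x⁆ + (1 / 2 : ℂ) • Weil.odd B ⁅y, x⁆ := by module
    rw [h1, h5]
    nth_rewrite 1 [h4]
    rw [h3, Finset.smul_sum, Finset.smul_sum, ← Finset.sum_add_distrib]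
    refine Finset.sum_congr rfl fun j _ => ?_
    have h6 : Weil.odd B ⁅x, f j⁆ = -Weil.odd B ⁅f j, x⁆ := by
      rw [← Weil.oddHom_apply, ← Weil.oddHom_apply, ← map_neg, lie_skew]
    rw [h2, h6, hsymm.eq y (f j)]
    module
  have heven : ∀ x, ρt (Weil.even B x) = Weil.even B x := by
    intro x
    -- The element e_x - c(x) is horizontal because e_x and the quadratic element c(x) have the same
    -- contractions. So the full composite of reflections fixes it; it also fixes c(x), hence e_x.
    have hh : ∀ y, Weil.contr B y (Weil.even B x - c x) = 0 := by
      intro y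
      rw [map_sub, hcc, Weil.contr_apply, Weil.parity_even, Weil.even_mul_odd,
        ← Weil.oddHom_apply B ⁅x, y⁆, ← lie_skew, map_neg, Weil.oddHom_apply]
      abel
    have := hfixW _ hh (List.finRange _)
    rw [← hρt, map_sub, hcρ] at this
    exact sub_left_injective this
  have hρP : ρt = Weil.parity B :=
    Weil.algHom_ext B (fun x => by rw [heven, Weil.parity_even])
      (fun x => by rw [hoddT, Weil.parity_odd])
  rw [← hρP]
  exact hfixT _

end Horizontal

end WeilAlgebra

/-! ### Sign rules in endomorphism rings. -/

section EndNeg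

variable {V : Type*} [AddCommGroup V] [Module ℂ V]

lemma end_mul_neg (f h : Module.End ℂ V) : f * (-h) = -(f * h) := mul_neg f h

lemma end_neg_mul (f h : Module.End ℂ V) : (-f) * h = -(f * h) := neg_mul f h

lemma end_neg_neg (f : Module.End ℂ V) : -(-f) = f := neg_neg f

lemma end_neg_add (f h : Module.End ℂ V) : -(f + h) = -f + -h := neg_add f h

lemma end_sum_neg {κ : Type*} (s : Finset κ) (f : κ → Module.End ℂ V) :
    ∑ i ∈ s, -f i = -∑ i ∈ s, f i := Finset.sum_neg_distrib f

end EndNeg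

/-! ### Graded algebras with interior derivatives -/

section GradedParity

variable {g : Type*} [LieRing g] [LieAlgebra ℂ g] {A : Type*} [Ring A] [Algebra ℂ A]
  {𝒜 : ℤ → Submodule ℂ A} [GradedAlgebra 𝒜] (S : GDA g 𝒜)

lemma parity_of_mem {n : ℤ} {a : A} (ha : a ∈ 𝒜 n) :
    parity 𝒜 a = ((n.negOnePow : ℤ) : ℂ) • a := by
  rw [parity, LinearMap.comp_apply]
  have : (DirectSum.decomposeLinearEquiv 𝒜).toLinearMap a = DirectSum.decompose 𝒜 a := rfl
  rw [this, DirectSum.decompose_of_mem 𝒜 ha]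
  exact DirectSum.toModule_lof ℂ n _

lemma negOnePow_mul_self (n : ℤ) :
    ((n.negOnePow : ℤ) : ℂ) * ((n.negOnePow : ℤ) : ℂ) = 1 := by
  rcases Int.even_or_odd n with h | h
  · simp [Int.negOnePow_even n h]
  · simp [Int.negOnePow_odd n h]

lemma negOnePow_sub_one (n : ℤ) :
    (((n - 1).negOnePow : ℤ) : ℂ) = -((n.negOnePow : ℤ) : ℂ) := by
  rw [Int.negOnePow_sub, Int.negOnePow_one]
  simp

lemma units_smul_eq {V : Type*} [AddCommGroup V] [Module ℂ V] (u : ℤˣ) (v : V) :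
    u • v = ((u : ℤ) : ℂ) • v := by
  rw [Int.cast_smul_eq_zsmul]
  rfl

lemma parity_parity (a : A) : parity 𝒜 (parity 𝒜 a) = a := by
  induction a using DirectSum.Decomposition.inductionOn 𝒜 with
  | zero => simp
  | @homogeneous n a =>
    rw [parity_of_mem a.2, map_smul, parity_of_mem a.2, smul_smul, negOnePow_mul_self, one_smul]
  | add a b ha hb => rw [map_add, map_add, ha, hb]

lemma parity_mul_parity : parity 𝒜 * parity 𝒜 = 1 := LinearMap.ext parity_parity

lemma parity_mul_i (x : g) : parity 𝒜 * S.i x = -(S.i x * parity 𝒜) := by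
  refine LinearMap.ext fun a => ?_
  rw [LinearMap.neg_apply, Module.End.mul_apply, Module.End.mul_apply]
  induction a using DirectSum.Decomposition.inductionOn 𝒜 with
  | zero => simp
  | @homogeneous n a =>
    rw [parity_of_mem a.2, parity_of_mem (S.i_mem x n a a.2), map_smul, negOnePow_sub_one,
      neg_smul]
  | add a b ha hb => simp only [map_add, ha, hb, neg_add]

lemma parity_mul_L (x : g) : parity 𝒜 * S.L x = S.L x * parity 𝒜 := by
  refine LinearMap.ext fun a => ?_
  rw [Module.End.mul_apply, Module.End.mul_apply]
  induction a using DirectSum.Decomposition.inductionOn 𝒜 with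
  | zero => simp
  | @homogeneous n a =>
    rw [parity_of_mem a.2, parity_of_mem (S.L_mem x n a a.2), map_smul]
  | add a b ha hb => simp only [map_add, ha, hb]

lemma i_mul_eq (x : g) (a b : A) :
    S.i x (a * b) = S.i x a * b + parity 𝒜 a * S.i x b := by
  induction a using DirectSum.Decomposition.inductionOn 𝒜 with
  | zero => simp
  | @homogeneous n a =>
    rw [S.i_mul x n a a.2, parity_of_mem a.2, units_smul_eq, smul_mul_assoc]
  | add a b ha hb =>
    simp only [add_mul, map_add, ha, hb]
    abel

lemma i_mul_i_self (x : g) : S.i x * S.i x = 0 := by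
  have := S.i_i x x
  rw [← two_smul ℂ] at this
  exact (smul_eq_zero.1 this).resolve_left two_ne_zero

lemma i_mul_i_comm (x y : g) : S.i x * S.i y = -(S.i y * S.i x) :=
  eq_neg_of_add_eq_zero_left (S.i_i x y)

/-- Two signs cancel, one from the anticommutation of the interior derivatives and one from passing
the parity. -/
lemma i_mul_parity_mul_i (x y : g) :
    S.i x * parity 𝒜 * S.i y = S.i y * (S.i x * parity 𝒜) := by
  rw [mul_assoc, parity_mul_i, end_mul_neg, ← mul_assoc, i_mul_i_comm S x y, end_neg_mul, neg_neg,
    mul_assoc]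

end GradedParity

/-! ### Dual bases and the invariance of the Casimir tensor -/

section Casimir

variable {g : Type*} [LieRing g] [LieAlgebra ℂ g] {ι : Type*} [Fintype ι] [DecidableEq ι] {p : ℕ}
  (D : TwistData g ι p)

/-- The dual basis `e^a = B^{ab} e_b`. -/
def dualVec (a : ι) : g := ∑ b, Bup D a b • D.e b

lemma B_dualVec_e (a c : ι) : D.B (dualVec D a) (D.e c) = if a = c then 1 else 0 := by
  have hdet : (Matrix.of fun a b => D.B (D.e a) (D.e b)).det ≠ 0 := by
    have h := (LinearMap.BilinForm.nondegenerate_iff_det_ne_zero D.e).1 D.nondegenerate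
    convert h using 2
    ext a b
    rw [LinearMap.BilinForm.toMatrix_apply]
    rfl
  have h := Matrix.nonsing_inv_mul (Matrix.of fun a b => D.B (D.e a) (D.e b))
    (isUnit_iff_ne_zero.2 hdet)
  have h2 := congrFun (congrFun h a) c
  rw [Matrix.mul_apply, Matrix.one_apply] at h2
  rw [← h2, dualVec, map_sum, LinearMap.sum_apply]
  refine Finset.sum_congr rfl fun b _ => ?_
  rw [map_smul, LinearMap.smul_apply]
  rfl

lemma B_dualVec_dualVec (a b : ι) : D.B (dualVec D a) (dualVec D b) = Bup D b a := by
  conv_lhs => rw [dualVec.eq_1 D b, map_sum]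
  simp [B_dualVec_e]

lemma sum_B_dualVec_smul_e (y : g) : ∑ b, D.B (dualVec D b) y • D.e b = y := by
  conv_rhs => rw [← D.e.sum_repr y]
  refine Finset.sum_congr rfl fun b _ => ?_
  congr 1
  conv_lhs => rw [← D.e.sum_repr y, map_sum]
  simp [B_dualVec_e]

lemma sum_B_e_smul_dualVec (y : g) : ∑ b, D.B y (D.e b) • dualVec D b = y := by
  have h : ∀ z, D.B (∑ b, D.B y (D.e b) • dualVec D b - y) z = 0 := by
    have : D.B (∑ b, D.B y (D.e b) • dualVec D b - y) = 0 := by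
      refine D.e.ext fun c => ?_
      rw [map_sub, map_sum, LinearMap.sub_apply, LinearMap.sum_apply]
      simp [B_dualVec_e]
    intro z
    rw [this, LinearMap.zero_apply]
  exact sub_eq_zero.1 (D.nondegenerate.1 _ h)

/-- Invariance of the Casimir tensor. -/
lemma casimir_invariant {M : Type*} [AddCommGroup M] [Module ℂ M] (β : g →ₗ[ℂ] g →ₗ[ℂ] M)
    (x : g) :
    ∑ a, β ⁅x, dualVec D a⁆ (D.e a) + ∑ a, β (dualVec D a) ⁅x, D.e a⁆ = 0 := by
  have h1 : ∑ a, β (dualVec D a) ⁅x, D.e a⁆ =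
      ∑ a, ∑ b, D.B (dualVec D b) ⁅x, D.e a⁆ • β (dualVec D a) (D.e b) := by
    refine Finset.sum_congr rfl fun a _ => ?_
    conv_lhs => rw [← sum_B_dualVec_smul_e D ⁅x, D.e a⁆, map_sum]
    simp only [map_smul]
  have h2 : ∑ b, β ⁅x, dualVec D b⁆ (D.e b) =
      ∑ b, ∑ a, (-D.B (dualVec D b) ⁅x, D.e a⁆) • β (dualVec D a) (D.e b) := by
    refine Finset.sum_congr rfl fun b _ => ?_
    conv_lhs => rw [← sum_B_e_smul_dualVec D ⁅x, dualVec D b⁆, map_sum, LinearMap.sum_apply]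
    refine Finset.sum_congr rfl fun a _ => ?_
    rw [map_smul, LinearMap.smul_apply, D.invariant]
  rw [h1, h2, Finset.sum_comm, ← Finset.sum_add_distrib]
  refine Finset.sum_eq_zero fun a _ => ?_
  rw [← Finset.sum_add_distrib]
  refine Finset.sum_eq_zero fun b _ => ?_
  rw [neg_smul, neg_add_cancel]

lemma xiUp_eq (a : ι) : xiUp D a = Weil.odd D.B (dualVec D a) := by
  rw [← Weil.oddHom_apply, dualVec, map_sum]
  simp only [map_smul, Weil.oddHom_apply]
  rfl

end Casimir

/-! ### Operators on iterated tensor products -/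

section Quad

variable {W A : Type*} [AddCommGroup W] [Module ℂ W] [AddCommGroup A] [Module ℂ A]

/-- The operator `a ⊗ b ⊗ c ⊗ d` on `(W ⊗ A) ⊗ (W ⊗ A)`. -/
def quad (a : Module.End ℂ W) (b : Module.End ℂ A) (c : Module.End ℂ W) (d : Module.End ℂ A) :
    Module.End ℂ ((W ⊗[ℂ] A) ⊗[ℂ] (W ⊗[ℂ] A)) :=
  TensorProduct.map (TensorProduct.map a b) (TensorProduct.map c d)

variable (a a' : Module.End ℂ W) (b b' : Module.End ℂ A) (c c' : Module.End ℂ W)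
  (d d' : Module.End ℂ A)

lemma quad_mul : quad a b c d * quad a' b' c' d' = quad (a * a') (b * b') (c * c') (d * d') := by
  rw [quad, quad, quad, ← TensorProduct.map_mul, ← TensorProduct.map_mul, ← TensorProduct.map_mul]

lemma quad_one : quad (1 : Module.End ℂ W) (1 : Module.End ℂ A) 1 1 = 1 := by
  rw [quad, TensorProduct.map_one, TensorProduct.map_one]

lemma quad_add₁ : quad (a + a') b c d = quad a b c d + quad a' b c d := by
  rw [quad, TensorProduct.map_add_left, TensorProduct.map_add_left]
  rfl

lemma quad_neg₁ : quad (-a) b c d = -quad a b c d := by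
  ext
  simp [quad, TensorProduct.neg_tmul, TensorProduct.tmul_neg]

lemma quad_neg₂ : quad a (-b) c d = -quad a b c d := by
  ext
  simp [quad, TensorProduct.neg_tmul, TensorProduct.tmul_neg]

lemma quad_neg₃ : quad a b (-c) d = -quad a b c d := by
  ext
  simp [quad, TensorProduct.neg_tmul, TensorProduct.tmul_neg]

lemma quad_neg₄ : quad a b c (-d) = -quad a b c d := by
  ext
  simp [quad, TensorProduct.neg_tmul, TensorProduct.tmul_neg]

lemma quad_neg_neg₁₂ : quad (-a) (-b) c d = quad a b c d := by
  rw [quad_neg₁, quad_neg₂, end_neg_neg]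

lemma quad_neg_neg₃₄ : quad a b (-c) (-d) = quad a b c d := by
  rw [quad_neg₃, quad_neg₄, end_neg_neg]

lemma quad_neg_neg₂₄ : quad a (-b) c (-d) = quad a b c d := by
  rw [quad_neg₂, quad_neg₄, end_neg_neg]

lemma quad_smul₁ (t : ℂ) : quad (t • a) b c d = t • quad a b c d := by
  rw [quad, TensorProduct.map_smul_left, TensorProduct.map_smul_left]
  rfl

lemma quad_add₄ : quad a b c (d + d') = quad a b c d + quad a b c d' := by
  rw [quad, TensorProduct.map_add_right, TensorProduct.map_add_right]
  rfl

lemma quad_smul₄ (t : ℂ) : quad a b c (t • d) = t • quad a b c d := by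
  rw [quad, TensorProduct.map_smul_right, TensorProduct.map_smul_right]
  rfl

lemma quad_zero₄ : quad a b c 0 = 0 := by
  rw [quad, TensorProduct.map_zero_right, TensorProduct.map_zero_right]

lemma quad_apply (w₁ w₂ : W) (ν₁ ν₂ : A) :
    quad a b c d ((w₁ ⊗ₜ ν₁) ⊗ₜ (w₂ ⊗ₜ ν₂)) = (a w₁ ⊗ₜ b ν₁) ⊗ₜ (c w₂ ⊗ₜ d ν₂) := rfl

end Quad

/-! ### Koszul signs as operators. -/

section Koszul

variable {V : Type*} [AddCommGroup V] [Module ℂ V] {P Q T : Module.End ℂ V}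

/-- An operator that changes the parity of the first factor changes (-1)^{|v||w|} by (-1)^{|w|},
which is the action of Q. Written with the involutions, this needs no decomposition into homogeneous
elements. -/
lemma koszul_mul_of_anticommute_left (hQ : Q * Q = 1) (hPQ : Commute P Q)
    (hP : P * T = -(T * P)) (hTQ : Commute Q T) :
    koszul P Q * T = T * Q * koszul P Q := by
  have h1 : P * Q * T = -(T * (P * Q)) := by
    rw [mul_assoc, hTQ.eq, ← mul_assoc, hP, end_neg_mul, mul_assoc]
  have h2 : T * Q * (P * Q) = T * P := by
    rw [hPQ.eq, mul_assoc, ← mul_assoc Q Q, hQ, one_mul]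
  have h3 : T * Q * Q = T := by rw [mul_assoc, hQ, mul_one]
  have h4 : T * Q * P = T * (P * Q) := by rw [mul_assoc, hPQ.eq]
  rw [koszul, smul_mul_assoc, mul_smul_comm, sub_mul, add_mul, add_mul, mul_sub, mul_add, mul_add,
    one_mul, mul_one, hP, hTQ.eq, h1, h2, h3, h4]
  congr 1
  abel

lemma koszul_mul_of_anticommute_right (hP : P * P = 1) (hPQ : Commute P Q)
    (hQ : Q * T = -(T * Q)) (hTP : Commute P T) :
    koszul P Q * T = T * P * koszul P Q := by
  have h : koszul P Q = koszul Q P := by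
    rw [koszul, koszul, hPQ.eq, add_right_comm]
  rw [h]
  exact koszul_mul_of_anticommute_left hP hPQ.symm hQ hTP

lemma koszul_mul_of_commute (hP : Commute P T) (hQ : Commute Q T) :
    Commute (koszul P Q) T :=
  ((((Commute.one_left T).add_left hP).add_left hQ).sub_left (hP.mul_left hQ)).smul_left _

lemma koszul_apply_of_fixed {v : V} (h : Q v = v) : koszul P Q v = v := by
  rw [koszul, LinearMap.smul_apply, LinearMap.sub_apply, LinearMap.add_apply, LinearMap.add_apply,
    Module.End.one_apply, Module.End.mul_apply, h]
  module

end Koszul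

/-! ### The product induced by the untwisted Kalkman map -/

section Untwisted

variable {g : Type*} [LieRing g] [LieAlgebra ℂ g] {ι : Type*} [Fintype ι] [DecidableEq ι] {p : ℕ}
  (D : TwistData g ι p) {A : Type*} [Ring A] [Algebra ℂ A] {𝒜 : ℤ → Submodule ℂ A}
  [GradedAlgebra 𝒜] (S : GDA g 𝒜)

/-- The parity involution of the Weil algebra as a linear map. -/
def parityW : Module.End ℂ (Weil D.B) := (Weil.parity D.B).toLinearMap

/-- Left multiplication by `ξ^a`. -/
def xiMul (a : ι) : Module.End ℂ (Weil D.B) := LinearMap.mulLeft ℂ (xiUp D a)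

/-- The contraction `[ξ^a, ·]`. -/
def contrUp (a : ι) : Module.End ℂ (Weil D.B) := Weil.contr D.B (dualVec D a)

lemma parityW_mul_parityW : parityW D * parityW D = 1 :=
  LinearMap.ext fun w => Weil.parity_parity D.B w

lemma parityW_mul_xiMul (a : ι) : parityW D * xiMul D a = -(xiMul D a * parityW D) := by
  refine LinearMap.ext fun w => ?_
  change Weil.parity D.B (xiUp D a * w) = -(xiUp D a * Weil.parity D.B w)
  rw [map_mul, xiUp_eq, Weil.parity_odd, neg_mul]

lemma parityW_mul_contrUp (a : ι) : parityW D * contrUp D a = -(contrUp D a * parityW D) :=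
  LinearMap.ext fun w => Weil.parity_contr D.B _ w

/-- The Clifford relation for the dual basis. It is the only source of the matrix B^{ab} in the
product formula. -/
lemma contrUp_mul_xiMul (a b : ι) :
    contrUp D a * xiMul D b + xiMul D b * contrUp D a = Bup D b a • 1 := by
  refine LinearMap.ext fun w => ?_
  change Weil.contr D.B (dualVec D a) (xiUp D b * w) +
    xiUp D b * Weil.contr D.B (dualVec D a) w = Bup D b a • w
  rw [Weil.contr_mul, xiUp_eq, Weil.contr_odd, Weil.parity_odd, neg_mul, neg_add_cancel_right,
    B_dualVec_dualVec, ← Algebra.smul_def]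

/-- `ξ^a ⊗ i_a` on `W ⊗ A`. -/
def kalkmanOp : Module.End ℂ (WA D S) :=
  ∑ a, TensorProduct.map (xiMul D a * parityW D) (S.i (D.e a))

lemma isNilpotent_kalkmanOp : IsNilpotent (kalkmanOp D S) := by
  have h := isNilpotent_sum_mul (R := Module.End ℂ (WA D S)) D.e
    (LinearMap.lTensorHom (Weil D.B) ∘ₗ S.i)
    (fun x => by
      change (S.i x).lTensor (Weil D.B) * (S.i x).lTensor (Weil D.B) = 0
      rw [← LinearMap.lTensor_mul, i_mul_i_self, LinearMap.lTensor_zero])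
    (fun a => (xiMul D a * parityW D).rTensor A)
    (fun a x => by
      change _ * (S.i x).lTensor (Weil D.B) = (S.i x).lTensor (Weil D.B) * _
      exact (LinearMap.rTensor_comp_lTensor _ _ _).trans
        (LinearMap.lTensor_comp_rTensor _ _ _).symm)
  refine (congrArg IsNilpotent ?_).mpr h
  refine Finset.sum_congr rfl fun a _ => ?_
  change _ = (xiMul D a * parityW D).rTensor A ∘ₗ (S.i (D.e a)).lTensor (Weil D.B)
  rw [LinearMap.rTensor_comp_lTensor]

/-- `ξ^a ⊗ i_a` on the first factor. -/
def kalkmanLeft : Module.End ℂ (WA D S ⊗[ℂ] WA D S) :=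
  ∑ a, quad (xiMul D a * parityW D) (S.i (D.e a)) 1 1

/-- `ξ^a ⊗ i_a` on the second factor. -/
def kalkmanRight : Module.End ℂ (WA D S ⊗[ℂ] WA D S) :=
  ∑ a, quad 1 1 (xiMul D a * parityW D) (S.i (D.e a))

/-- The failure of `ξ^a ⊗ i_a` to be a derivation. -/
def kalkmanDefect : Module.End ℂ (WA D S ⊗[ℂ] WA D S) :=
  ∑ a, quad (contrUp D a * parityW D) (parity 𝒜) (parityW D) (S.i (D.e a))

/-- `B^{ab} i_a ⊗ i_b` on `(W ⊗ A) ⊗ (W ⊗ A)`. -/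
def intPair : Module.End ℂ (WA D S ⊗[ℂ] WA D S) :=
  ∑ a, ∑ b, Bup D b a • quad 1 (S.i (D.e b) * parity 𝒜) (parityW D) (S.i (D.e a))

lemma kalkmanLeft_eq : kalkmanLeft D S = (kalkmanOp D S).rTensor (WA D S) := by
  refine TensorProduct.ext' fun x y => ?_
  simp only [kalkmanLeft, kalkmanOp, quad, TensorProduct.map_one, LinearMap.sum_apply,
    LinearMap.rTensor_tmul, TensorProduct.map_tmul, Module.End.one_apply, TensorProduct.sum_tmul]

lemma kalkmanRight_eq : kalkmanRight D S = (kalkmanOp D S).lTensor (WA D S) := by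
  refine TensorProduct.ext' fun x y => ?_
  simp only [kalkmanRight, kalkmanOp, quad, TensorProduct.map_one, LinearMap.sum_apply,
    LinearMap.lTensor_tmul, TensorProduct.map_tmul, Module.End.one_apply, TensorProduct.tmul_sum]

/-- The parity of the first `A`. -/
def parityA₁ : Module.End ℂ (WA D S ⊗[ℂ] WA D S) :=
  ((parity 𝒜).lTensor (Weil D.B)).rTensor (WA D S)

/-- The parity of the second `W`. -/
def parityW₂ : Module.End ℂ (WA D S ⊗[ℂ] WA D S) :=
  ((parityW D).rTensor A).lTensor (WA D S)

lemma parityA₁_eq : parityA₁ D S = quad 1 (parity 𝒜) 1 1 := by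
  rw [quad, TensorProduct.map_one]
  rfl

lemma parityW₂_eq : parityW₂ D S = quad 1 1 (parityW D) 1 := by
  rw [quad, TensorProduct.map_one]
  rfl

/-- `(w₁ ⊗ ν₁) ⊗ (w₂ ⊗ ν₂) ↦ w₁ w₂ ⊗ ν₁ ν₂`. -/
def plainMul : WA D S ⊗[ℂ] WA D S →ₗ[ℂ] WA D S :=
  TensorProduct.map (LinearMap.mul' ℂ (Weil D.B)) (LinearMap.mul' ℂ A) ∘ₗ
    (TensorProduct.tensorTensorTensorComm ℂ (Weil D.B) A (Weil D.B) A).toLinearMap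

lemma superMul_eq : superMul D S = plainMul D S ∘ₗ koszul (parityA₁ D S) (parityW₂ D S) := rfl

lemma plainMul_tmul (w₁ w₂ : Weil D.B) (ν₁ ν₂ : A) :
    plainMul D S ((w₁ ⊗ₜ ν₁) ⊗ₜ (w₂ ⊗ₜ ν₂)) = (w₁ * w₂) ⊗ₜ (ν₁ * ν₂) := rfl

lemma ext_quad {Z : Type*} [AddCommGroup Z] [Module ℂ Z]
    {f h : WA D S ⊗[ℂ] WA D S →ₗ[ℂ] Z}
    (H : ∀ (w₁ : Weil D.B) (ν₁ : A) (w₂ : Weil D.B) (ν₂ : A),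
      f ((w₁ ⊗ₜ ν₁) ⊗ₜ (w₂ ⊗ₜ ν₂)) = h ((w₁ ⊗ₜ ν₁) ⊗ₜ (w₂ ⊗ₜ ν₂))) : f = h := by
  ext w₁ ν₁ w₂ ν₂
  exact H w₁ ν₁ w₂ ν₂

/-- The interior derivative i_a distributes over ν₁ν₂. In the term where it hits ν₂, the factor ξ^a
must be moved past w₁, and the resulting supercommutator is the defect. -/
lemma kalkmanOp_comp_plainMul : kalkmanOp D S ∘ₗ plainMul D S = plainMul D S ∘ₗ
    (kalkmanLeft D S * parityW₂ D S + kalkmanRight D S * parityA₁ D S + kalkmanDefect D S) := by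
  refine ext_quad D S fun w₁ ν₁ w₂ ν₂ => ?_
  rw [LinearMap.comp_apply, LinearMap.comp_apply, LinearMap.add_apply, LinearMap.add_apply,
    parityW₂_eq, parityA₁_eq, Module.End.mul_apply, Module.End.mul_apply, quad_apply, quad_apply,
    map_add, map_add, plainMul_tmul]
  simp only [kalkmanLeft, kalkmanRight, kalkmanDefect, kalkmanOp, LinearMap.sum_apply, quad_apply,
    map_sum, plainMul_tmul, TensorProduct.map_tmul]
  rw [← Finset.sum_add_distrib, ← Finset.sum_add_distrib]
  refine Finset.sum_congr rfl fun a _ => ?_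
  simp only [Module.End.mul_apply, Module.End.one_apply]
  rw [i_mul_eq, TensorProduct.tmul_add, add_assoc]
  have h1 : parityW D (w₁ * w₂) = parityW D w₁ * parityW D w₂ := map_mul (Weil.parity D.B) _ _
  have h2 : ∀ w, xiMul D a w = xiUp D a * w := fun _ => rfl
  have h3 : xiUp D a * parityW D w₁ = w₁ * xiUp D a + contrUp D a (parityW D w₁) := by
    have : contrUp D a (parityW D w₁) = xiUp D a * parityW D w₁ - w₁ * xiUp D a := by
      rw [contrUp, Weil.contr_apply, xiUp_eq]
      congr 2
      exact Weil.parity_parity D.B w₁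
    rw [this]
    abel
  rw [h1, h2, h2, h2, ← mul_assoc]
  congr 1
  rw [h3, add_mul, TensorProduct.add_tmul, mul_assoc]

/-- The Koszul sign in the super product absorbs the parity operators attached to the left and right
terms, while it commutes with the defect, which preserves both parities involved. -/
lemma kalkmanOp_comp_superMul : kalkmanOp D S ∘ₗ superMul D S = superMul D S ∘ₗ
    (kalkmanLeft D S + kalkmanRight D S + kalkmanDefect D S) := by
  have hP : parityA₁ D S * parityA₁ D S = 1 := by
    rw [parityA₁_eq, quad_mul, parity_mul_parity, one_mul, one_mul, quad_one]
  have hQ : parityW₂ D S * parityW₂ D S = 1 := by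
    rw [parityW₂_eq, quad_mul, parityW_mul_parityW, one_mul, one_mul, quad_one]
  have hPQ : Commute (parityA₁ D S) (parityW₂ D S) := by
    rw [parityW₂_eq, parityA₁_eq, Commute, SemiconjBy, quad_mul, quad_mul]
    simp only [one_mul, mul_one]
  have h1 : koszul (parityA₁ D S) (parityW₂ D S) * kalkmanLeft D S =
      kalkmanLeft D S * parityW₂ D S * koszul (parityA₁ D S) (parityW₂ D S) := by
    refine koszul_mul_of_anticommute_left hQ hPQ ?_ ?_
    · rw [kalkmanLeft, Finset.mul_sum, Finset.sum_mul, ← end_sum_neg]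
      refine Finset.sum_congr rfl fun a _ => ?_
      rw [parityA₁_eq, quad_mul, quad_mul, parity_mul_i, quad_neg₂]
      simp only [one_mul, mul_one]
    · refine Commute.sum_right _ _ _ fun a _ => ?_
      rw [parityW₂_eq, Commute, SemiconjBy, quad_mul, quad_mul]
      simp only [one_mul, mul_one]
  have h2 : koszul (parityA₁ D S) (parityW₂ D S) * kalkmanRight D S =
      kalkmanRight D S * parityA₁ D S * koszul (parityA₁ D S) (parityW₂ D S) := by
    refine koszul_mul_of_anticommute_right hP hPQ ?_ ?_
    · rw [kalkmanRight, Finset.mul_sum, Finset.sum_mul, ← end_sum_neg]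
      refine Finset.sum_congr rfl fun a _ => ?_
      rw [parityW₂_eq, quad_mul, quad_mul, ← mul_assoc, parityW_mul_xiMul, end_neg_mul, quad_neg₃]
      simp only [one_mul, mul_one]
    · refine Commute.sum_right _ _ _ fun a _ => ?_
      rw [parityA₁_eq, Commute, SemiconjBy, quad_mul, quad_mul]
      simp only [one_mul, mul_one]
  have h3 : koszul (parityA₁ D S) (parityW₂ D S) * kalkmanDefect D S =
      kalkmanDefect D S * koszul (parityA₁ D S) (parityW₂ D S) := by
    refine koszul_mul_of_commute ?_ ?_
    all_goals refine Commute.sum_right _ _ _ fun a _ => ?_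
    · rw [parityA₁_eq, Commute, SemiconjBy, quad_mul, quad_mul]
      simp only [one_mul, mul_one]
    · rw [parityW₂_eq, Commute, SemiconjBy, quad_mul, quad_mul]
      simp only [one_mul, mul_one]
  rw [superMul_eq, ← LinearMap.comp_assoc, kalkmanOp_comp_plainMul, LinearMap.comp_assoc,
    LinearMap.comp_assoc, ← Module.End.mul_eq_comp, ← Module.End.mul_eq_comp, mul_add, mul_add,
    h1, h2, h3, add_mul, add_mul]

lemma commute_kalkmanLeft_kalkmanRight : Commute (kalkmanLeft D S) (kalkmanRight D S) := by
  refine Commute.sum_left _ _ _ fun a _ => Commute.sum_right _ _ _ fun b _ => ?_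
  rw [Commute, SemiconjBy, quad_mul, quad_mul]
  simp only [one_mul, mul_one]

lemma parityW_xi_commute (a : ι) :
    parityW D * (xiMul D a * parityW D) = -(xiMul D a * parityW D * parityW D) := by
  rw [← mul_assoc, parityW_mul_xiMul, end_neg_mul]

lemma defect_commutator (a b : ι) :
    contrUp D a * parityW D * (xiMul D b * parityW D) =
      -(xiMul D b * parityW D * (contrUp D a * parityW D) + Bup D b a • 1) := by
  have h1 : contrUp D a * parityW D * (xiMul D b * parityW D) = -(contrUp D a * xiMul D b) := by
    rw [mul_assoc, parityW_xi_commute, mul_assoc, parityW_mul_parityW, mul_one, end_mul_neg]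
  have h2 : xiMul D b * parityW D * (contrUp D a * parityW D) = -(xiMul D b * contrUp D a) := by
    rw [mul_assoc, ← mul_assoc (parityW D), parityW_mul_contrUp, end_neg_mul, mul_assoc,
      parityW_mul_parityW, mul_one, end_mul_neg]
  rw [h1, h2, ← contrUp_mul_xiMul]
  abel

/-- The defect commutes with the right term because two sign changes cancel there. With the left
term the Clifford relation leaves B^{ab} and one interior derivative on each factor A. -/
lemma kalkmanDefect_mul : kalkmanDefect D S * (kalkmanLeft D S + kalkmanRight D S) =
    (kalkmanLeft D S + kalkmanRight D S) * kalkmanDefect D S + intPair D S := by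
  have h1 : kalkmanDefect D S * kalkmanRight D S = kalkmanRight D S * kalkmanDefect D S := by
    refine Commute.sum_left _ _ _ fun a _ => Commute.sum_right _ _ _ fun b _ => ?_
    rw [Commute, SemiconjBy, quad_mul, quad_mul, parityW_xi_commute, i_mul_i_comm S (D.e a),
      quad_neg_neg₃₄]
    simp only [one_mul, mul_one]
  have h2 : kalkmanDefect D S * kalkmanLeft D S =
      kalkmanLeft D S * kalkmanDefect D S + intPair D S := by
    have hs : kalkmanLeft D S * kalkmanDefect D S =
        ∑ a, ∑ b, quad (xiMul D b * parityW D) (S.i (D.e b)) 1 1 *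
          quad (contrUp D a * parityW D) (parity 𝒜) (parityW D) (S.i (D.e a)) := by
      rw [kalkmanLeft, kalkmanDefect, Finset.sum_mul_sum, Finset.sum_comm]
    rw [hs, kalkmanDefect, kalkmanLeft, Finset.sum_mul_sum, intPair, ← Finset.sum_add_distrib]
    refine Finset.sum_congr rfl fun a _ => ?_
    rw [← Finset.sum_add_distrib]
    refine Finset.sum_congr rfl fun b _ => ?_
    rw [quad_mul, quad_mul, defect_commutator, parity_mul_i, quad_neg_neg₁₂, quad_add₁,
      quad_smul₁]
    simp only [one_mul, mul_one]
  rw [mul_add, h1, h2, add_mul]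
  abel

end Untwisted

/-! ### The Heisenberg formula with reversed signs and exponentials on a tensor square. -/

section GenericNeg

variable {V Z : Type*} [AddCommGroup V] [Module ℂ V] [AddCommGroup Z] [Module ℂ Z]

lemma end_neg_isNilpotent {f : Module.End ℂ V} (h : IsNilpotent f) : IsNilpotent (-f) := h.neg

lemma nilExp_mul_nilExp_neg_apply {f : Module.End ℂ V} (h : IsNilpotent f) (v : V) :
    nilExp f (nilExp (-f) v) = v := by
  rw [← Module.End.mul_apply, nilExp_mul_nilExp_neg h, Module.End.one_apply]

/-- Reversing the signs of T, X and K preserves the hypotheses with the same N, since a commutator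
is bilinear. -/
lemma nilExp_heisenberg_neg {T : Module.End ℂ Z} {X K N : Module.End ℂ V} (m : V →ₗ[ℂ] Z)
    (hm : T ∘ₗ m = m ∘ₗ (X + K)) (hKX : K * X = X * K + N) (hXN : Commute X N) (hKN : Commute K N)
    (hT : IsNilpotent T) (hX : IsNilpotent X) (hN : IsNilpotent N) {v : V} (hv : K v = 0) :
    nilExp (-T) (m (nilExp (-((1 / 2 : ℂ) • N)) v)) = m (nilExp (-X) v) := by
  refine nilExp_heisenberg (K := -K) m ?_ ?_ hXN.neg_left hKN.neg_left hT.neg hX.neg hN ?_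
  · rw [LinearMap.neg_comp, hm, ← LinearMap.comp_neg]
    congr 1
    exact neg_add _ _
  · rw [end_neg_mul, end_mul_neg, end_neg_neg, end_neg_mul, end_mul_neg, end_neg_neg, hKX]
  · rw [LinearMap.neg_apply, hv, neg_zero]

lemma nilExp_neg_add_tmul {T : Module.End ℂ V} (hT : IsNilpotent T) (x y : V) :
    nilExp (-(T.rTensor V + T.lTensor V)) (x ⊗ₜ[ℂ] y) =
      nilExp (-T) x ⊗ₜ[ℂ] nilExp (-T) y := by
  have hL : IsNilpotent (-T.rTensor V) := by
    obtain ⟨n, hn⟩ := hT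
    exact end_neg_isNilpotent ⟨n, by rw [LinearMap.rTensor_pow, hn, LinearMap.rTensor_zero]⟩
  have hR : IsNilpotent (-T.lTensor V) := by
    obtain ⟨n, hn⟩ := hT
    exact end_neg_isNilpotent ⟨n, by rw [LinearMap.lTensor_pow, hn, LinearMap.lTensor_zero]⟩
  have hc : Commute (-T.rTensor V) (-T.lTensor V) := by
    have h : Commute (T.rTensor V) (T.lTensor V) :=
      (LinearMap.rTensor_comp_lTensor _ _ _).trans (LinearMap.lTensor_comp_rTensor _ _ _).symm
    exact h.neg_left.neg_right
  have h1 : ∀ y', nilExp (-T.rTensor V) (x ⊗ₜ y') = nilExp (-T) x ⊗ₜ y' := by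
    intro y'
    have := nilExp_intertwine hT.neg hL ((TensorProduct.mk ℂ V V).flip y') (by
      refine LinearMap.ext fun z => ?_
      change (-(T z)) ⊗ₜ y' = -(T.rTensor V (z ⊗ₜ y'))
      rw [LinearMap.rTensor_tmul, TensorProduct.neg_tmul])
    exact (LinearMap.congr_fun this x).symm
  have h2 : nilExp (-T.lTensor V) (x ⊗ₜ y) = x ⊗ₜ nilExp (-T) y := by
    have := nilExp_intertwine hT.neg hR (TensorProduct.mk ℂ V V x) (by
      refine LinearMap.ext fun z => ?_
      change x ⊗ₜ (-(T z)) = -(T.lTensor V (x ⊗ₜ z))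
      rw [LinearMap.lTensor_tmul, TensorProduct.tmul_neg])
    exact (LinearMap.congr_fun this y).symm
  rw [end_neg_add, nilExp_add_of_commute hc hL hR, Module.End.mul_apply, h2, h1]

end GenericNeg

/-! ### The undeformed induced product with a horizontal first factor. -/

section Untwisted

variable {g : Type*} [LieRing g] [LieAlgebra ℂ g] {ι : Type*} [Fintype ι] [DecidableEq ι] {p : ℕ}
  (D : TwistData g ι p) {A : Type*} [Ring A] [Algebra ℂ A] {𝒜 : ℤ → Submodule ℂ A}
  [GradedAlgebra 𝒜] (S : GDA g 𝒜)

lemma Bup_symm (a b : ι) : Bup D a b = Bup D b a := by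
  rw [← B_dualVec_dualVec, ← B_dualVec_dualVec, D.symm.eq]

lemma commute_kalkman_intPair :
    Commute (kalkmanLeft D S + kalkmanRight D S) (intPair D S) := by
  refine Commute.add_left ?_ ?_
  all_goals
    refine Commute.sum_left _ _ _ fun c _ => Commute.sum_right _ _ _ fun a _ =>
      Commute.sum_right _ _ _ fun b _ => Commute.smul_right ?_ _
    rw [Commute, SemiconjBy, quad_mul, quad_mul]
  · rw [i_mul_parity_mul_i]
    simp only [one_mul, mul_one]
  · rw [parityW_xi_commute, i_mul_i_comm S (D.e a), quad_neg_neg₃₄]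
    simp only [one_mul, mul_one]

lemma commute_kalkmanDefect_intPair : Commute (kalkmanDefect D S) (intPair D S) := by
  refine Commute.sum_left _ _ _ fun c _ => Commute.sum_right _ _ _ fun a _ =>
    Commute.sum_right _ _ _ fun b _ => Commute.smul_right ?_ _
  rw [Commute, SemiconjBy, quad_mul, quad_mul, ← mul_assoc, parity_mul_i,
    i_mul_i_comm S (D.e c), end_neg_mul, quad_neg_neg₂₄]
  simp only [one_mul, mul_one]

lemma isNilpotent_intPair : IsNilpotent (intPair D S) := by
  let φ : g →ₗ[ℂ] Module.End ℂ (WA D S ⊗[ℂ] WA D S) :=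
    { toFun := fun x => quad 1 1 (parityW D) (S.i x)
      map_add' := fun x y => by rw [map_add, quad_add₄]
      map_smul' := fun t x => by rw [map_smul, quad_smul₄]; rfl }
  have h := isNilpotent_sum_mul D.e φ
    (fun x => by
      change quad 1 1 (parityW D) (S.i x) * quad 1 1 (parityW D) (S.i x) = 0
      rw [quad_mul, i_mul_i_self, quad_zero₄])
    (fun a => ∑ b, Bup D b a • quad 1 (S.i (D.e b) * parity 𝒜) 1 1)
    (fun a x => by
      refine Commute.sum_left _ _ _ fun b _ => Commute.smul_left ?_ _
      change _ * quad 1 1 (parityW D) (S.i x) = quad 1 1 (parityW D) (S.i x) * _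
      rw [quad_mul, quad_mul]
      simp only [one_mul, mul_one])
  refine (congrArg IsNilpotent ?_).mpr h
  refine Finset.sum_congr rfl fun a _ => ?_
  rw [Finset.sum_mul]
  refine Finset.sum_congr rfl fun b _ => ?_
  change _ = _ * quad 1 1 (parityW D) (S.i (D.e a))
  rw [smul_mul_assoc, quad_mul]
  simp only [one_mul, mul_one]

lemma isNilpotent_kalkmanLeft : IsNilpotent (kalkmanLeft D S) := by
  obtain ⟨n, hn⟩ := isNilpotent_kalkmanOp D S
  refine ⟨n, ?_⟩
  rw [kalkmanLeft_eq, LinearMap.rTensor_pow, hn, LinearMap.rTensor_zero]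

lemma isNilpotent_kalkmanRight : IsNilpotent (kalkmanRight D S) := by
  obtain ⟨n, hn⟩ := isNilpotent_kalkmanOp D S
  refine ⟨n, ?_⟩
  rw [kalkmanRight_eq, LinearMap.lTensor_pow, hn, LinearMap.lTensor_zero]

/-- The product induced by the untwisted Kalkman map, on a horizontal first factor. -/
theorem kalkman_superMul (x y : WA D S) (hx : ∀ z, (Weil.contr D.B z).rTensor A x = 0) :
    nilExp (kalkmanOp D S) (superMul D S
      (nilExp (-kalkmanOp D S) x ⊗ₜ nilExp (-kalkmanOp D S) y)) =
    superMul D S (nilExp (-((1 / 2 : ℂ) • intPair D S)) (x ⊗ₜ y)) := by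
  -- The defect contracts the first Weil factor. Up to a sign the parity can be pulled out to the
  -- left, so horizontality of x suffices.
  have hKv : kalkmanDefect D S (x ⊗ₜ y) = 0 := by
    rw [kalkmanDefect, LinearMap.sum_apply]
    refine Finset.sum_eq_zero fun a _ => ?_
    have h : TensorProduct.map (contrUp D a * parityW D) (parity 𝒜) x = 0 := by
      have hcp : contrUp D a * parityW D = (-parityW D) * contrUp D a := by
        rw [end_neg_mul, parityW_mul_contrUp, end_neg_neg]
      have : TensorProduct.map (contrUp D a * parityW D) (parity 𝒜) x =
          TensorProduct.map (-parityW D) (parity 𝒜) ((contrUp D a).rTensor A x) := by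
        rw [hcp, LinearMap.rTensor, ← LinearMap.comp_apply, ← TensorProduct.map_comp]
        rfl
      rw [this, contrUp, hx, map_zero]
    change TensorProduct.map (contrUp D a * parityW D) (parity 𝒜) x ⊗ₜ _ = 0
    rw [h, TensorProduct.zero_tmul]
  have key := nilExp_heisenberg_neg (superMul D S) (kalkmanOp_comp_superMul D S)
    (kalkmanDefect_mul D S) (commute_kalkman_intPair D S) (commute_kalkmanDefect_intPair D S)
    (isNilpotent_kalkmanOp D S)
    ((commute_kalkmanLeft_kalkmanRight D S).isNilpotent_add (isNilpotent_kalkmanLeft D S)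
      (isNilpotent_kalkmanRight D S))
    (isNilpotent_intPair D S) hKv
  rw [kalkmanLeft_eq, kalkmanRight_eq, nilExp_neg_add_tmul (isNilpotent_kalkmanOp D S)] at key
  rw [← key, nilExp_mul_nilExp_neg_apply (isNilpotent_kalkmanOp D S)]

end Untwisted

/-! ### Exponentials on vectors fixed by an involution. -/

section Fixed

variable {V Y : Type*} [AddCommGroup V] [Module ℂ V] [AddCommGroup Y] [Module ℂ Y]

lemma nilExp_neg_smul_lTensor {f : Module.End ℂ V} (hf : IsNilpotent f) (t : ℂ) :
    nilExp (-(t • f.lTensor Y)) = (nilExp (-(t • f))).lTensor Y := by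
  refine Eq.trans ?_ (map_nilExp (Module.End.lTensorAlgHom ℂ V Y) (hf.smul t).neg).symm
  congr 1
  refine TensorProduct.ext' fun y v => ?_
  change -(t • (y ⊗ₜ[ℂ] f v)) = y ⊗ₜ[ℂ] (-(t • f v))
  rw [TensorProduct.tmul_neg, TensorProduct.tmul_smul]

/-- Intertwiners up to an involution intertwine exponentials on the fixed vectors. -/
lemma nilExp_intertwine_fixed {q N : Module.End ℂ V} {M : Module.End ℂ Y} (f : V →ₗ[ℂ] Y)
    (hcomm : Commute q N) (hN : IsNilpotent N) (hM : IsNilpotent M)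
    (hf : f ∘ₗ (N * q) = M ∘ₗ f) (t : ℂ) {z : V} (hz : q z = z) :
    q (nilExp (-(t • N)) z) = nilExp (-(t • N)) z ∧
      f (nilExp (-(t • N)) z) = nilExp (-(t • M)) (f z) := by
  have hc' : Commute q (-(t • N)) := (hcomm.smul_right t).neg_right
  have hf' : ∀ v, q v = v → f ((-(t • N)) v) = (-(t • M)) (f v) := by
    intro v hv
    have := LinearMap.congr_fun hf v
    rw [LinearMap.comp_apply, Module.End.mul_apply, hv, LinearMap.comp_apply] at this
    rw [LinearMap.neg_apply, LinearMap.smul_apply, map_neg, map_smul, this, LinearMap.neg_apply,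
      LinearMap.smul_apply]
  obtain ⟨a, ha⟩ := (hN.smul t).neg
  obtain ⟨b, hb⟩ := (hM.smul t).neg
  set N' := -(t • N)
  set M' := -(t • M)
  have hp : ∀ n, q ((N' ^ n) z) = (N' ^ n) z ∧ f ((N' ^ n) z) = (M' ^ n) (f z) := by
    intro n
    induction n with
    | zero => exact ⟨hz, rfl⟩
    | succ n ih =>
      rw [pow_succ', pow_succ', Module.End.mul_apply, Module.End.mul_apply, ← ih.2, ← hf' _ ih.1]
      refine ⟨?_, rfl⟩
      have := LinearMap.congr_fun hc'.eq ((N' ^ n) z)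
      rwa [Module.End.mul_apply, Module.End.mul_apply, ih.1] at this
  have ha' : N' ^ (a + b) = 0 := by rw [pow_add]; exact (congrArg (· * N' ^ b) ha).trans (zero_mul _)
  have hb' : M' ^ (a + b) = 0 := by rw [pow_add]; exact (congrArg (M' ^ a * ·) hb).trans (mul_zero _)
  rw [nilExp_eq_sum ha', nilExp_eq_sum hb', LinearMap.sum_apply, LinearMap.sum_apply, map_sum,
    map_sum]
  constructor
  · exact Finset.sum_congr rfl fun n _ => by rw [LinearMap.smul_apply, map_smul, (hp n).1]
  · exact Finset.sum_congr rfl fun n _ => by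
      rw [LinearMap.smul_apply, map_smul, (hp n).2, LinearMap.smul_apply]

end Fixed

/-! ### The graded flip and the undeformed explicit product. -/

section Flip

variable {g : Type*} [LieRing g] [LieAlgebra ℂ g] {ι : Type*} [Fintype ι] [DecidableEq ι] {p : ℕ}
  (D : TwistData g ι p) {A : Type*} [Ring A] [Algebra ℂ A] {𝒜 : ℤ → Submodule ℂ A}
  [GradedAlgebra 𝒜] (S : GDA g 𝒜)

/-- The graded flip `ν₁ ⊗ ν₂ ↦ (-1)^{|ν₁||ν₂|} ν₂ ⊗ ν₁`. -/
def gradedFlip (𝒜 : ℤ → Submodule ℂ A) [GradedAlgebra 𝒜] : Module.End ℂ (A ⊗[ℂ] A) :=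
  (TensorProduct.comm ℂ A A).toLinearMap ∘ₗ
    koszul ((parity 𝒜).rTensor A) ((parity 𝒜).lTensor A)

lemma negOnePow_cast_cases (n : ℤ) :
    (((n.negOnePow : ℤ) : ℂ) = 1 ∧ Even n) ∨ (((n.negOnePow : ℤ) : ℂ) = -1 ∧ Odd n) := by
  rcases Int.even_or_odd n with h | h
  · exact Or.inl ⟨by simp [Int.negOnePow_even n h], h⟩
  · exact Or.inr ⟨by simp [Int.negOnePow_odd n h], h⟩

/-- For signs s and t the expression ½(1 + s + t - st) is -1 exactly when s = t = -1; this justifies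
the formula defining `koszul`. -/
lemma negOnePow_mul_cast (m n : ℤ) :
    (1 / 2 : ℂ) * (1 + ((m.negOnePow : ℤ) : ℂ) + ((n.negOnePow : ℤ) : ℂ) -
      ((m.negOnePow : ℤ) : ℂ) * ((n.negOnePow : ℤ) : ℂ)) = (((m * n).negOnePow : ℤ) : ℂ) := by
  rcases negOnePow_cast_cases m with ⟨hm, hm'⟩ | ⟨hm, hm'⟩ <;>
    rcases negOnePow_cast_cases n with ⟨hn, hn'⟩ | ⟨hn, hn'⟩
  · rw [hm, hn, Int.negOnePow_even _ (hm'.mul_right n)]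
    norm_num
  · rw [hm, hn, Int.negOnePow_even _ (hm'.mul_right n)]
    norm_num
  · rw [hm, hn, Int.negOnePow_even _ (hn'.mul_left m)]
    norm_num
  · rw [hm, hn, Int.negOnePow_odd _ (hm'.mul hn')]
    norm_num

lemma koszul_tmul_of_mem {m n : ℤ} {ν₁ ν₂ : A} (h₁ : ν₁ ∈ 𝒜 m) (h₂ : ν₂ ∈ 𝒜 n) :
    koszul ((parity 𝒜).rTensor A) ((parity 𝒜).lTensor A) (ν₁ ⊗ₜ[ℂ] ν₂) =
      (((m * n).negOnePow : ℤ) : ℂ) • (ν₁ ⊗ₜ[ℂ] ν₂) := by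
  rw [koszul, LinearMap.smul_apply, LinearMap.sub_apply, LinearMap.add_apply, LinearMap.add_apply,
    Module.End.one_apply, Module.End.mul_apply, LinearMap.lTensor_tmul, LinearMap.rTensor_tmul,
    LinearMap.rTensor_tmul, parity_of_mem h₁, parity_of_mem h₂, ← negOnePow_mul_cast]
  simp only [TensorProduct.tmul_smul, ← TensorProduct.smul_tmul']
  module

lemma gradedFlip_tmul_of_mem {m n : ℤ} {ν₁ ν₂ : A} (h₁ : ν₁ ∈ 𝒜 m) (h₂ : ν₂ ∈ 𝒜 n) :
    gradedFlip 𝒜 (ν₁ ⊗ₜ[ℂ] ν₂) = (((m * n).negOnePow : ℤ) : ℂ) • (ν₂ ⊗ₜ[ℂ] ν₁) := by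
  rw [gradedFlip, LinearMap.comp_apply, koszul_tmul_of_mem h₁ h₂, map_smul]
  rfl

lemma ext_homogeneous {Z : Type*} [AddCommGroup Z] [Module ℂ Z] (𝒜 : ℤ → Submodule ℂ A)
    [GradedAlgebra 𝒜] {f h : A ⊗[ℂ] A →ₗ[ℂ] Z}
    (H : ∀ m n, ∀ ν₁ ∈ 𝒜 m, ∀ ν₂ ∈ 𝒜 n, f (ν₁ ⊗ₜ ν₂) = h (ν₁ ⊗ₜ ν₂)) : f = h := by
  refine TensorProduct.ext' fun a b => ?_
  induction a using DirectSum.Decomposition.inductionOn 𝒜 with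
  | zero => simp
  | @homogeneous m a =>
    induction b using DirectSum.Decomposition.inductionOn 𝒜 with
    | zero => simp
    | @homogeneous n b => exact H m n a a.2 b b.2
    | add b b' hb hb' => rw [TensorProduct.tmul_add, map_add, map_add, hb, hb']
  | add a a' ha ha' => rw [TensorProduct.add_tmul, map_add, map_add, ha, ha']

lemma mul'_comp_gradedFlip (hA : GradedCommutative 𝒜) :
    LinearMap.mul' ℂ A ∘ₗ gradedFlip 𝒜 = LinearMap.mul' ℂ A := by
  refine ext_homogeneous 𝒜 fun m n ν₁ h₁ ν₂ h₂ => ?_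
  rw [LinearMap.comp_apply, gradedFlip_tmul_of_mem h₁ h₂, map_smul, LinearMap.mul'_apply,
    LinearMap.mul'_apply, hA m n ν₁ h₁ ν₂ h₂, units_smul_eq]

/-- `B^{ab} i_a ⊗ i_b` on `A ⊗ A`, with Koszul signs. -/
def intTensor : Module.End ℂ (A ⊗[ℂ] A) :=
  ∑ a, ∑ b, Bup D a b • TensorProduct.map (S.i (D.e a) * parity 𝒜) (S.i (D.e b))

lemma isNilpotent_intTensor : IsNilpotent (intTensor D S) := by
  have h := isNilpotent_sum_mul (R := Module.End ℂ (A ⊗[ℂ] A)) D.e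
    (LinearMap.lTensorHom A ∘ₗ S.i)
    (fun x => by
      change (S.i x).lTensor A * (S.i x).lTensor A = 0
      rw [← LinearMap.lTensor_mul, i_mul_i_self, LinearMap.lTensor_zero])
    (fun b => ∑ a, Bup D a b • (S.i (D.e a) * parity 𝒜).rTensor A)
    (fun b x => by
      refine Commute.sum_left _ _ _ fun a _ => Commute.smul_left ?_ _
      exact (LinearMap.rTensor_comp_lTensor _ _ _).trans
        (LinearMap.lTensor_comp_rTensor _ _ _).symm)
  refine (congrArg IsNilpotent ?_).mpr h
  rw [intTensor, Finset.sum_comm]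
  refine Finset.sum_congr rfl fun b _ => ?_
  rw [Finset.sum_mul]
  refine Finset.sum_congr rfl fun a _ => ?_
  rw [smul_mul_assoc]
  congr 1
  exact (LinearMap.rTensor_comp_lTensor _ _ _).symm

lemma intTensor_tmul_of_mem {m : ℤ} {ν₁ : A} (h₁ : ν₁ ∈ 𝒜 m) (ν₂ : A) :
    intTensor D S (ν₁ ⊗ₜ ν₂) = ((m.negOnePow : ℤ) : ℂ) •
      ∑ a, ∑ b, Bup D a b • (S.i (D.e a) ν₁ ⊗ₜ[ℂ] S.i (D.e b) ν₂) := by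
  simp only [intTensor, LinearMap.sum_apply, LinearMap.smul_apply, TensorProduct.map_tmul,
    Module.End.mul_apply, parity_of_mem h₁, map_smul, ← TensorProduct.smul_tmul', Finset.smul_sum]
  exact Finset.sum_congr rfl fun a _ => Finset.sum_congr rfl fun b _ => smul_comm _ _ _

/-- Both degrees drop by one, so the flip contributes (-1)^{(m-1)(n-1)} instead of (-1)^{mn}, and
the Koszul sign of the interior derivatives changes from (-1)^m to (-1)^n. The net sign is -1; the
exchange of the indices is harmless because B^{ab} is symmetric. -/
lemma gradedFlip_comp_intTensor :
    gradedFlip 𝒜 ∘ₗ (-intTensor D S) = intTensor D S ∘ₗ gradedFlip 𝒜 := by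
  refine ext_homogeneous 𝒜 fun m n ν₁ h₁ ν₂ h₂ => ?_
  rw [LinearMap.comp_apply, LinearMap.comp_apply, gradedFlip_tmul_of_mem h₁ h₂, map_smul,
    LinearMap.neg_apply, map_neg, intTensor_tmul_of_mem D S h₁, intTensor_tmul_of_mem D S h₂,
    map_smul, map_sum, Finset.sum_comm, smul_smul]
  simp only [map_sum, map_smul]
  have hflip : ∀ a b, gradedFlip 𝒜 (S.i (D.e a) ν₁ ⊗ₜ[ℂ] S.i (D.e b) ν₂) =
      ((((m - 1) * (n - 1)).negOnePow : ℤ) : ℂ) • (S.i (D.e b) ν₂ ⊗ₜ[ℂ] S.i (D.e a) ν₁) :=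
    fun a b => gradedFlip_tmul_of_mem (S.i_mem _ m ν₁ h₁) (S.i_mem _ n ν₂ h₂)
  have hsign : -(((m.negOnePow : ℤ) : ℂ) * ((((m - 1) * (n - 1)).negOnePow : ℤ) : ℂ)) =
      (((m * n).negOnePow : ℤ) : ℂ) * ((n.negOnePow : ℤ) : ℂ) := by
    have e : (m - 1) * (n - 1) = m * n - m - n + 1 := by ring
    rw [e, Int.negOnePow_add, Int.negOnePow_sub, Int.negOnePow_sub, Int.negOnePow_one]
    push_cast
    linear_combination ((((m * n).negOnePow : ℤ) : ℂ) * ((n.negOnePow : ℤ) : ℂ)) *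
      negOnePow_mul_self m
  rw [← hsign, neg_smul, mul_smul]
  congr 2
  rw [Finset.smul_sum]
  refine Finset.sum_congr rfl fun a _ => ?_
  rw [Finset.smul_sum]
  refine Finset.sum_congr rfl fun b _ => ?_
  rw [hflip, Bup_symm, smul_comm]

lemma nilExp_intTensor_comp_gradedFlip :
    nilExp ((1 / 2 : ℂ) • intTensor D S) ∘ₗ gradedFlip 𝒜 =
      gradedFlip 𝒜 ∘ₗ nilExp (-((1 / 2 : ℂ) • intTensor D S)) := by
  have h := (isNilpotent_intTensor D S).smul (1 / 2 : ℂ)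
  refine (nilExp_intertwine (end_neg_isNilpotent h) h _ ?_).symm
  refine LinearMap.ext fun z => ?_
  have := congrArg ((1 / 2 : ℂ) • ·) (LinearMap.congr_fun (gradedFlip_comp_intTensor D S) z)
  simpa only [LinearMap.comp_apply, LinearMap.neg_apply, LinearMap.smul_apply, map_neg, map_smul,
    smul_neg] using this

/-- The explicit product before the twist. -/
def explicitOp : WA D S ⊗[ℂ] WA D S →ₗ[ℂ] WA D S :=
  (LinearMap.mul' ℂ A ∘ₗ nilExp ((1 / 2 : ℂ) • intTensor D S)).lTensor (Weil D.B) ∘ₗ swapMul D S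

/-- `(w₁ ⊗ ν₁) ⊗ (w₂ ⊗ ν₂) ↦ w₁ w₂ ⊗ (ν₁ ⊗ ν₂)`. -/
def mulFirst : WA D S ⊗[ℂ] WA D S →ₗ[ℂ] Weil D.B ⊗[ℂ] (A ⊗[ℂ] A) :=
  (LinearMap.mul' ℂ (Weil D.B)).rTensor (A ⊗[ℂ] A) ∘ₗ
    (TensorProduct.tensorTensorTensorComm ℂ (Weil D.B) A (Weil D.B) A).toLinearMap

lemma mulFirst_tmul (w₁ w₂ : Weil D.B) (ν₁ ν₂ : A) :
    mulFirst D S ((w₁ ⊗ₜ ν₁) ⊗ₜ (w₂ ⊗ₜ ν₂)) = (w₁ * w₂) ⊗ₜ (ν₁ ⊗ₜ ν₂) := rfl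

lemma swapMul_eq : swapMul D S = (gradedFlip 𝒜).lTensor (Weil D.B) ∘ₗ mulFirst D S := by
  rw [mulFirst, ← LinearMap.comp_assoc, LinearMap.lTensor_comp_rTensor]
  rfl

lemma plainMul_eq :
    plainMul D S = (LinearMap.mul' ℂ A).lTensor (Weil D.B) ∘ₗ mulFirst D S := by
  rw [mulFirst, ← LinearMap.comp_assoc, LinearMap.lTensor_comp_rTensor]
  rfl

/-- Moving the exponential past the flip reverses its sign, and graded commutativity then absorbs
the flip into the multiplication. -/
lemma explicitOp_eq (hA : GradedCommutative 𝒜) : explicitOp D S =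
    (LinearMap.mul' ℂ A ∘ₗ nilExp (-((1 / 2 : ℂ) • intTensor D S))).lTensor (Weil D.B) ∘ₗ
      mulFirst D S := by
  rw [explicitOp, swapMul_eq, ← LinearMap.comp_assoc, ← LinearMap.lTensor_comp,
    LinearMap.comp_assoc, nilExp_intTensor_comp_gradedFlip, ← LinearMap.comp_assoc,
    mul'_comp_gradedFlip hA]

lemma commute_parityW₂_intPair : Commute (parityW₂ D S) (intPair D S) := by
  refine Commute.sum_right _ _ _ fun a _ =>
    Commute.sum_right _ _ _ fun b _ => Commute.smul_right ?_ _
  rw [parityW₂_eq, Commute, SemiconjBy, quad_mul, quad_mul]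
  simp only [one_mul, mul_one]

/-- The pairing carries the parity of the second Weil factor. It descends to A ⊗ A only after this
parity is cancelled, which is why the comparison is made on elements even in that factor. -/
lemma mulFirst_comp_intPair : mulFirst D S ∘ₗ (intPair D S * parityW₂ D S) =
    (intTensor D S).lTensor (Weil D.B) ∘ₗ mulFirst D S := by
  refine ext_quad D S fun w₁ ν₁ w₂ ν₂ => ?_
  have h2 : parityW D (parityW D w₂) = w₂ := Weil.parity_parity D.B w₂
  rw [LinearMap.comp_apply, LinearMap.comp_apply, Module.End.mul_apply, parityW₂_eq, quad_apply,
    mulFirst_tmul, LinearMap.lTensor_tmul]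
  simp only [intPair, intTensor, LinearMap.sum_apply, LinearMap.smul_apply, quad_apply, map_sum,
    map_smul, mulFirst_tmul, TensorProduct.map_tmul, TensorProduct.tmul_sum,
    TensorProduct.tmul_smul, Module.End.one_apply, h2]
  rw [Finset.sum_comm]

/-- On elements that are even in the second Weil algebra, the induced product is the explicit
one. -/
theorem superMul_nilExp_intPair (hA : GradedCommutative 𝒜) (z : WA D S ⊗[ℂ] WA D S)
    (hz : parityW₂ D S z = z) :
    superMul D S (nilExp (-((1 / 2 : ℂ) • intPair D S)) z) = explicitOp D S z := by
  have hM : IsNilpotent ((intTensor D S).lTensor (Weil D.B)) := by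
    obtain ⟨n, hn⟩ := isNilpotent_intTensor D S
    exact ⟨n, by rw [LinearMap.lTensor_pow, hn, LinearMap.lTensor_zero]⟩
  obtain ⟨h1, h2⟩ := nilExp_intertwine_fixed (mulFirst D S) (commute_parityW₂_intPair D S)
    (isNilpotent_intPair D S) hM (mulFirst_comp_intPair D S) (1 / 2) hz
  rw [superMul_eq, LinearMap.comp_apply, koszul_apply_of_fixed h1, plainMul_eq,
    explicitOp_eq D S hA, LinearMap.comp_apply, LinearMap.comp_apply, h2,
    nilExp_neg_smul_lTensor (isNilpotent_intTensor D S),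
    LinearMap.lTensor_comp, LinearMap.comp_apply]

end Flip

/-! ### Equivariance of the products -/

section Equivariance

variable {g : Type*} [LieRing g] [LieAlgebra ℂ g] {ι : Type*} [Fintype ι] [DecidableEq ι] {p : ℕ}
  (D : TwistData g ι p) {A : Type*} [Ring A] [Algebra ℂ A] {𝒜 : ℤ → Submodule ℂ A}
  [GradedAlgebra 𝒜] (S : GDA g 𝒜)

/-- The untwisted total Lie derivative on `W ⊗ A`. -/
def lieOp (x : g) : Module.End ℂ (WA D S) :=
  (Weil.ad D.B x).rTensor A + (S.L x).lTensor (Weil D.B)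

lemma lieOp_tmul (x : g) (w : Weil D.B) (ν : A) :
    lieOp D S x (w ⊗ₜ ν) = Weil.ad D.B x w ⊗ₜ ν + w ⊗ₜ S.L x ν := rfl

lemma L_i_apply (x y : g) (ν : A) : S.L x (S.i y ν) = S.i y (S.L x ν) + S.i ⁅x, y⁆ ν := by
  have := LinearMap.congr_fun (S.L_i x y) ν
  rw [← this, LinearMap.sub_apply, Module.End.mul_apply, Module.End.mul_apply]
  abel

/-- The Kalkman generator is a contraction of the Casimir tensor, which is invariant. Hence the
Kalkman map and its inverse preserve invariant elements. -/
lemma commute_lieOp_kalkmanOp (x : g) : Commute (lieOp D S x) (kalkmanOp D S) := by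
  refine TensorProduct.ext' fun w ν => ?_
  rw [Module.End.mul_apply, Module.End.mul_apply, lieOp_tmul, map_add]
  simp only [kalkmanOp, LinearMap.sum_apply, TensorProduct.map_tmul, map_sum, lieOp_tmul]
  have hβ := casimir_invariant D (LinearMap.compl₁₂ (TensorProduct.mk ℂ (Weil D.B) A)
    (LinearMap.mulRight ℂ (parityW D w) ∘ₗ Weil.oddHom D.B) (S.i.flip ν)) x
  rw [← Finset.sum_add_distrib] at hβ
  rw [← Finset.sum_add_distrib, ← sub_eq_zero, ← Finset.sum_sub_distrib]
  refine Eq.trans (Finset.sum_congr rfl fun a _ => ?_) hβ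
  have h1 : ∀ v, (xiMul D a * parityW D) v = xiUp D a * parityW D v := fun _ => rfl
  have h2 : parityW D (Weil.ad D.B x w) = Weil.ad D.B x (parityW D w) := Weil.parity_ad D.B x w
  simp only [LinearMap.compl₁₂_apply, LinearMap.comp_apply, LinearMap.mulRight_apply,
    LinearMap.flip_apply, TensorProduct.mk_apply, Weil.oddHom_apply]
  rw [h1, h1, h2, Weil.ad_mul, xiUp_eq, Weil.ad_odd, L_i_apply, TensorProduct.add_tmul,
    TensorProduct.tmul_add]
  abel

/-- The diagonal Lie derivative on `A ⊗ A`. -/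
def lieA₂ (x : g) : Module.End ℂ (A ⊗[ℂ] A) := (S.L x).rTensor A + (S.L x).lTensor A

lemma lieA₂_tmul (x : g) (ν₁ ν₂ : A) :
    lieA₂ S x (ν₁ ⊗ₜ ν₂) = S.L x ν₁ ⊗ₜ ν₂ + ν₁ ⊗ₜ S.L x ν₂ := rfl

/-- Again a contraction of the invariant Casimir tensor, once it is rewritten in terms of the dual
basis. -/
lemma commute_lieA₂_intTensor (x : g) : Commute (lieA₂ S x) (intTensor D S) := by
  have hsum : intTensor D S =
      ∑ b, TensorProduct.map (S.i (dualVec D b) * parity 𝒜) (S.i (D.e b)) := by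
    rw [intTensor, Finset.sum_comm]
    refine Finset.sum_congr rfl fun b _ => TensorProduct.ext' fun ν₁ ν₂ => ?_
    simp only [dualVec, map_sum, map_smul, LinearMap.sum_apply, LinearMap.smul_apply,
      TensorProduct.map_tmul, Module.End.mul_apply, TensorProduct.sum_tmul,
      ← TensorProduct.smul_tmul', Bup_symm D b]
  rw [hsum]
  refine TensorProduct.ext' fun ν₁ ν₂ => ?_
  rw [Module.End.mul_apply, Module.End.mul_apply, lieA₂_tmul, map_add]
  simp only [LinearMap.sum_apply, TensorProduct.map_tmul, map_sum, lieA₂_tmul]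
  have hβ := casimir_invariant D (LinearMap.compl₁₂ (TensorProduct.mk ℂ A A)
    (S.i.flip (parity 𝒜 ν₁)) (S.i.flip ν₂)) x
  rw [← Finset.sum_add_distrib] at hβ
  rw [← Finset.sum_add_distrib, ← sub_eq_zero, ← Finset.sum_sub_distrib]
  refine Eq.trans (Finset.sum_congr rfl fun a _ => ?_) hβ
  have h2 : parity 𝒜 (S.L x ν₁) = S.L x (parity 𝒜 ν₁) := LinearMap.congr_fun (parity_mul_L S x) ν₁
  simp only [LinearMap.compl₁₂_apply, LinearMap.flip_apply, TensorProduct.mk_apply,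
    Module.End.mul_apply]
  rw [h2, L_i_apply, L_i_apply, TensorProduct.add_tmul, TensorProduct.tmul_add]
  abel

lemma commute_lieA₂_gradedFlip (x : g) : Commute (lieA₂ S x) (gradedFlip 𝒜) := by
  refine ext_homogeneous 𝒜 fun m n ν₁ h₁ ν₂ h₂ => ?_
  rw [Module.End.mul_apply, Module.End.mul_apply, lieA₂_tmul, map_add,
    gradedFlip_tmul_of_mem h₁ h₂, gradedFlip_tmul_of_mem (S.L_mem x m ν₁ h₁) h₂,
    gradedFlip_tmul_of_mem h₁ (S.L_mem x n ν₂ h₂), map_smul, lieA₂_tmul, smul_add, add_comm]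

/-- The `A`-part of the explicit product. -/
def explicitA : A ⊗[ℂ] A →ₗ[ℂ] A :=
  LinearMap.mul' ℂ A ∘ₗ nilExp ((1 / 2 : ℂ) • intTensor D S) ∘ₗ gradedFlip 𝒜

lemma L_comp_explicitA (x : g) : S.L x ∘ₗ explicitA D S = explicitA D S ∘ₗ lieA₂ S x := by
  have h1 : S.L x ∘ₗ LinearMap.mul' ℂ A = LinearMap.mul' ℂ A ∘ₗ lieA₂ S x :=
    TensorProduct.ext' fun ν₁ ν₂ => by
      rw [LinearMap.comp_apply, LinearMap.comp_apply, lieA₂_tmul, map_add, LinearMap.mul'_apply,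
        LinearMap.mul'_apply, LinearMap.mul'_apply, S.L_mul]
  have h2 : lieA₂ S x ∘ₗ nilExp ((1 / 2 : ℂ) • intTensor D S) =
      nilExp ((1 / 2 : ℂ) • intTensor D S) ∘ₗ lieA₂ S x :=
    commute_nilExp ((commute_lieA₂_intTensor D S x).smul_right _)
  have h3 : lieA₂ S x ∘ₗ gradedFlip 𝒜 = gradedFlip 𝒜 ∘ₗ lieA₂ S x := commute_lieA₂_gradedFlip S x
  rw [explicitA, ← LinearMap.comp_assoc, h1, LinearMap.comp_assoc, ← LinearMap.comp_assoc _ _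
    (lieA₂ S x), h2, LinearMap.comp_assoc, h3]
  rfl

lemma explicitOp_eq_explicitA :
    explicitOp D S = (explicitA D S).lTensor (Weil D.B) ∘ₗ mulFirst D S := by
  rw [explicitOp, swapMul_eq, ← LinearMap.comp_assoc, ← LinearMap.lTensor_comp]
  rfl

/-- Compatibility of a product on `W ⊗ A` with the actions of `g` on the factors. -/
structure IsEquivariantMul (f : WA D S ⊗[ℂ] WA D S →ₗ[ℂ] WA D S) : Prop where
  ad : ∀ x, (Weil.ad D.B x).rTensor A ∘ₗ f =
    f ∘ₗ (quad (Weil.ad D.B x) 1 1 1 + quad 1 1 (Weil.ad D.B x) 1)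
  lie : ∀ x, (S.L x).lTensor (Weil D.B) ∘ₗ f =
    f ∘ₗ (quad 1 (S.L x) 1 1 + quad 1 1 1 (S.L x))
  left : ∀ x, (LinearMap.mulLeft ℂ (Weil.even D.B x)).rTensor A ∘ₗ f =
    f ∘ₗ quad (LinearMap.mulLeft ℂ (Weil.even D.B x)) 1 1 1
  middle : ∀ x, f ∘ₗ (quad 1 1 (LinearMap.mulLeft ℂ (Weil.even D.B x)) 1 +
    quad (Weil.ad D.B x) 1 1 1) = f ∘ₗ quad (LinearMap.mulLeft ℂ (Weil.even D.B x)) 1 1 1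

lemma rTensor_comp_mulFirst_ad (x : g) :
    (Weil.ad D.B x).rTensor (A ⊗[ℂ] A) ∘ₗ mulFirst D S =
      mulFirst D S ∘ₗ (quad (Weil.ad D.B x) 1 1 1 + quad 1 1 (Weil.ad D.B x) 1) := by
  refine ext_quad D S fun w₁ ν₁ w₂ ν₂ => ?_
  simp only [LinearMap.comp_apply, LinearMap.add_apply, quad_apply, map_add, mulFirst_tmul,
    LinearMap.rTensor_tmul, Module.End.one_apply, Weil.ad_mul, TensorProduct.add_tmul]

lemma rTensor_comp_mulFirst_contr (x : g) :
    (Weil.contr D.B x).rTensor (A ⊗[ℂ] A) ∘ₗ mulFirst D S =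
      mulFirst D S ∘ₗ (quad (Weil.contr D.B x) 1 1 1 + quad (parityW D) 1 (Weil.contr D.B x) 1) := by
  refine ext_quad D S fun w₁ ν₁ w₂ ν₂ => ?_
  simp only [LinearMap.comp_apply, LinearMap.add_apply, quad_apply, map_add, mulFirst_tmul,
    LinearMap.rTensor_tmul, Module.End.one_apply, Weil.contr_mul, TensorProduct.add_tmul]
  rfl

lemma rTensor_comp_explicitOp (f : Module.End ℂ (Weil D.B)) :
    f.rTensor A ∘ₗ explicitOp D S =
      (explicitA D S).lTensor (Weil D.B) ∘ₗ f.rTensor (A ⊗[ℂ] A) ∘ₗ mulFirst D S := by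
  rw [explicitOp_eq_explicitA, ← LinearMap.comp_assoc, ← LinearMap.comp_assoc,
    LinearMap.rTensor_comp_lTensor, LinearMap.lTensor_comp_rTensor]

lemma contr_comp_explicitOp (x : g) : (Weil.contr D.B x).rTensor A ∘ₗ explicitOp D S =
    explicitOp D S ∘ₗ
      (quad (Weil.contr D.B x) 1 1 1 + quad (parityW D) 1 (Weil.contr D.B x) 1) := by
  rw [rTensor_comp_explicitOp, rTensor_comp_mulFirst_contr, explicitOp_eq_explicitA]
  rfl

/-- This is w₁(e w₂) + [e, w₁] w₂ = e w₁ w₂. It allows left multiplications on the second Weil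
factor to be traded for operators on the first. -/
lemma middle_comp_mulFirst (x : g) :
    mulFirst D S ∘ₗ (quad 1 1 (LinearMap.mulLeft ℂ (Weil.even D.B x)) 1 +
      quad (Weil.ad D.B x) 1 1 1) =
    mulFirst D S ∘ₗ quad (LinearMap.mulLeft ℂ (Weil.even D.B x)) 1 1 1 := by
  refine ext_quad D S fun w₁ ν₁ w₂ ν₂ => ?_
  simp only [LinearMap.comp_apply, LinearMap.add_apply, quad_apply, map_add, mulFirst_tmul,
    Module.End.one_apply, LinearMap.mulLeft_apply, ← TensorProduct.add_tmul, Weil.ad_apply]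
  congr 1
  noncomm_ring

lemma isEquivariantMul_explicitOp : IsEquivariantMul D S (explicitOp D S) where
  ad x := by
    rw [rTensor_comp_explicitOp, rTensor_comp_mulFirst_ad, explicitOp_eq_explicitA]
    rfl
  lie x := by
    have h : (lieA₂ S x).lTensor (Weil D.B) ∘ₗ mulFirst D S =
        mulFirst D S ∘ₗ (quad 1 (S.L x) 1 1 + quad 1 1 1 (S.L x)) := by
      refine ext_quad D S fun w₁ ν₁ w₂ ν₂ => ?_
      simp only [LinearMap.comp_apply, LinearMap.add_apply, quad_apply, map_add, mulFirst_tmul,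
        LinearMap.lTensor_tmul, Module.End.one_apply, lieA₂_tmul, TensorProduct.tmul_add]
    rw [explicitOp_eq_explicitA, ← LinearMap.comp_assoc, ← LinearMap.lTensor_comp,
      L_comp_explicitA, LinearMap.lTensor_comp, LinearMap.comp_assoc, h]
    rfl
  left x := by
    have h : (LinearMap.mulLeft ℂ (Weil.even D.B x)).rTensor (A ⊗[ℂ] A) ∘ₗ mulFirst D S =
        mulFirst D S ∘ₗ quad (LinearMap.mulLeft ℂ (Weil.even D.B x)) 1 1 1 := by
      refine ext_quad D S fun w₁ ν₁ w₂ ν₂ => ?_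
      simp only [LinearMap.comp_apply, quad_apply, mulFirst_tmul, LinearMap.rTensor_tmul,
        Module.End.one_apply, LinearMap.mulLeft_apply, mul_assoc]
    rw [rTensor_comp_explicitOp, h, explicitOp_eq_explicitA]
    rfl
  middle x := by
    rw [explicitOp_eq_explicitA, LinearMap.comp_assoc, middle_comp_mulFirst]
    rfl

lemma parityW_commute_ad (x : g) : Commute (parityW D) (Weil.ad D.B x) :=
  LinearMap.ext fun w => Weil.parity_ad D.B x w

lemma parityW_commute_mulLeft (x : g) :
    Commute (parityW D) (LinearMap.mulLeft ℂ (Weil.even D.B x)) :=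
  LinearMap.ext fun w => by
    change Weil.parity D.B (Weil.even D.B x * w) = Weil.even D.B x * Weil.parity D.B w
    rw [map_mul, Weil.parity_even]

lemma commute_koszul_quad (a : Module.End ℂ (Weil D.B)) {b : Module.End ℂ A}
    {c : Module.End ℂ (Weil D.B)} (d : Module.End ℂ A) (hb : Commute (parity 𝒜) b)
    (hc : Commute (parityW D) c) :
    Commute (koszul (parityA₁ D S) (parityW₂ D S)) (quad a b c d) := by
  refine koszul_mul_of_commute ?_ ?_
  · rw [parityA₁_eq, Commute, SemiconjBy, quad_mul, quad_mul, hb.eq]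
    simp only [one_mul, mul_one]
  · rw [parityW₂_eq, Commute, SemiconjBy, quad_mul, quad_mul, hc.eq]
    simp only [one_mul, mul_one]

/-- All the operators involved are even, so they commute with the Koszul sign and it is enough to
treat the product without sign. -/
lemma isEquivariantMul_superMul : IsEquivariantMul D S (superMul D S) := by
  have hcomp : ∀ {f : Module.End ℂ (WA D S)} {q : Module.End ℂ (WA D S ⊗[ℂ] WA D S)},
      Commute (koszul (parityA₁ D S) (parityW₂ D S)) q → f ∘ₗ plainMul D S = plainMul D S ∘ₗ q →
      f ∘ₗ superMul D S = superMul D S ∘ₗ q := by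
    intro f q hq hf
    have hq' : koszul (parityA₁ D S) (parityW₂ D S) ∘ₗ q =
      q ∘ₗ koszul (parityA₁ D S) (parityW₂ D S) := hq
    rw [superMul_eq, ← LinearMap.comp_assoc, hf, LinearMap.comp_assoc, LinearMap.comp_assoc, hq']
  have hL : ∀ x, Commute (parity 𝒜) (S.L x) := fun x => parity_mul_L S x
  have h1 : Commute (parity 𝒜) 1 := Commute.one_right _
  have h1' : Commute (parityW D) 1 := Commute.one_right _
  refine ⟨fun x => ?_, fun x => ?_, fun x => ?_, fun x => ?_⟩
  · refine hcomp ((commute_koszul_quad D S _ _ h1 h1').add_right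
      (commute_koszul_quad D S _ _ h1 (parityW_commute_ad D x))) ?_
    refine ext_quad D S fun w₁ ν₁ w₂ ν₂ => ?_
    simp only [LinearMap.comp_apply, LinearMap.add_apply, quad_apply, map_add, plainMul_tmul,
      LinearMap.rTensor_tmul, Module.End.one_apply, Weil.ad_mul, TensorProduct.add_tmul]
  · refine hcomp ((commute_koszul_quad D S _ _ (hL x) h1').add_right
      (commute_koszul_quad D S _ _ h1 h1')) ?_
    refine ext_quad D S fun w₁ ν₁ w₂ ν₂ => ?_
    simp only [LinearMap.comp_apply, LinearMap.add_apply, quad_apply, map_add, plainMul_tmul,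
      LinearMap.lTensor_tmul, Module.End.one_apply, S.L_mul, TensorProduct.tmul_add]
  · refine hcomp (commute_koszul_quad D S _ _ h1 h1') ?_
    refine ext_quad D S fun w₁ ν₁ w₂ ν₂ => ?_
    simp only [LinearMap.comp_apply, quad_apply, plainMul_tmul, LinearMap.rTensor_tmul,
      Module.End.one_apply, LinearMap.mulLeft_apply, mul_assoc]
  · have e1 : koszul (parityA₁ D S) (parityW₂ D S) ∘ₗ
        (quad 1 1 (LinearMap.mulLeft ℂ (Weil.even D.B x)) 1 + quad (Weil.ad D.B x) 1 1 1) =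
        (quad 1 1 (LinearMap.mulLeft ℂ (Weil.even D.B x)) 1 + quad (Weil.ad D.B x) 1 1 1) ∘ₗ
          koszul (parityA₁ D S) (parityW₂ D S) :=
      (commute_koszul_quad D S _ _ h1 (parityW_commute_mulLeft D x)).add_right
        (commute_koszul_quad D S _ _ h1 h1')
    have e2 : koszul (parityA₁ D S) (parityW₂ D S) ∘ₗ
        quad (LinearMap.mulLeft ℂ (Weil.even D.B x)) 1 1 1 =
        quad (LinearMap.mulLeft ℂ (Weil.even D.B x)) 1 1 1 ∘ₗ
          koszul (parityA₁ D S) (parityW₂ D S) := commute_koszul_quad D S _ _ h1 h1'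
    have e3 : plainMul D S ∘ₗ
        (quad 1 1 (LinearMap.mulLeft ℂ (Weil.even D.B x)) 1 + quad (Weil.ad D.B x) 1 1 1) =
        plainMul D S ∘ₗ quad (LinearMap.mulLeft ℂ (Weil.even D.B x)) 1 1 1 := by
      rw [plainMul_eq, LinearMap.comp_assoc, middle_comp_mulFirst, LinearMap.comp_assoc]
    rw [superMul_eq, LinearMap.comp_assoc, LinearMap.comp_assoc, e1, e2, ← LinearMap.comp_assoc,
      ← LinearMap.comp_assoc, e3]

/-- The untwisted Cartan complex. -/
def IsBasic (x : WA D S) : Prop :=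
  (∀ z, lieOp D S z x = 0) ∧ ∀ z, (Weil.contr D.B z).rTensor A x = 0

lemma IsBasic.parityW {x : WA D S} (hx : IsBasic D S x) : (parityW D).rTensor A x = x :=
  parity_rTensor_eq_self_of_horizontal D.e D.symm D.nondegenerate D.invariant x hx.2

/-- The product induced by the untwisted Kalkman map on the untwisted Cartan complex. -/
theorem kalkman_superMul_of_isBasic (hA : GradedCommutative 𝒜) {x y : WA D S}
    (hx : IsBasic D S x) (hy : IsBasic D S y) :
    nilExp (kalkmanOp D S) (superMul D S
      (nilExp (-kalkmanOp D S) x ⊗ₜ nilExp (-kalkmanOp D S) y)) = explicitOp D S (x ⊗ₜ y) := by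
  rw [kalkman_superMul D S x y hx.2, superMul_nilExp_intPair D S hA]
  rw [parityW₂, LinearMap.lTensor_tmul, hy.parityW]

lemma lieOp_explicitOp (x y : WA D S) (z : g) :
    lieOp D S z (explicitOp D S (x ⊗ₜ y)) =
      explicitOp D S (lieOp D S z x ⊗ₜ y + x ⊗ₜ lieOp D S z y) := by
  have h := isEquivariantMul_explicitOp D S
  have h1 := LinearMap.congr_fun (h.ad z) (x ⊗ₜ y)
  have h2 := LinearMap.congr_fun (h.lie z) (x ⊗ₜ y)
  rw [LinearMap.comp_apply, LinearMap.comp_apply] at h1 h2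
  rw [lieOp, LinearMap.add_apply, h1, h2, ← map_add]
  congr 1
  simp only [quad, TensorProduct.map_one, LinearMap.add_apply, TensorProduct.map_tmul,
    Module.End.one_apply, TensorProduct.add_tmul, TensorProduct.tmul_add, LinearMap.rTensor,
    LinearMap.lTensor]
  simp only [← Module.End.one_eq_id]
  abel

/-- The untwisted Cartan complex is closed under the explicit product. -/
theorem IsBasic.explicitOp {x y : WA D S} (hx : IsBasic D S x) (hy : IsBasic D S y) :
    IsBasic D S (explicitOp D S (x ⊗ₜ y)) := by
  refine ⟨fun z => ?_, fun z => ?_⟩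
  · rw [lieOp_explicitOp, hx.1, hy.1, TensorProduct.zero_tmul, TensorProduct.tmul_zero, add_zero,
      map_zero]
  · have h := LinearMap.congr_fun (contr_comp_explicitOp D S z) (x ⊗ₜ y)
    rw [LinearMap.comp_apply, LinearMap.comp_apply, LinearMap.add_apply] at h
    rw [h]
    have h1 : quad (Weil.contr D.B z) 1 1 1 (x ⊗ₜ y) = (0 : WA D S ⊗[ℂ] WA D S) := by
      change (Weil.contr D.B z).rTensor A x ⊗ₜ _ = 0
      rw [hx.2, TensorProduct.zero_tmul]
    have h2 : quad (TwistedCartan.parityW D) 1 (Weil.contr D.B z) 1 (x ⊗ₜ y) =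
        (0 : WA D S ⊗[ℂ] WA D S) := by
      change _ ⊗ₜ (Weil.contr D.B z).rTensor A y = 0
      rw [hy.2, TensorProduct.tmul_zero]
    rw [h1, h2, add_zero, map_zero]

end Equivariance

/-! ### Exponentials of bilinear expressions in commuting operators -/

section HomExp

variable {p : ℕ} {U V Z : Type*} [AddCommGroup U] [Module ℂ U] [AddCommGroup V] [Module ℂ V]
  [AddCommGroup Z] [Module ℂ Z]

open scoped IsMulCommutative in
/-- Commuting families of operators come from a commutative algebra. -/
lemma exists_algHom_of_commute {E : Type u} [Ring E] [Algebra ℂ E] {κ : Type*}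
    (X : κ → Fin p → E) (h : ∀ i j k l, Commute (X i k) (X j l)) :
    ∃ (R : Type u) (_ : CommRing R) (_ : Algebra ℂ R) (φ : R →ₐ[ℂ] E)
      (x : κ → Fin p → R), ∀ i, X i = fun k => φ (x i k) := by
  let T : Set E := Set.range fun t : κ × Fin p => X t.1 t.2
  have hT : IsMulCommutative (Algebra.adjoin ℂ T) := Algebra.isMulCommutative_adjoin ℂ <| by
    rintro _ ⟨s, rfl⟩ _ ⟨t, rfl⟩
    exact h s.1 t.1 s.2 t.2
  exact ⟨Algebra.adjoin ℂ T, inferInstance, inferInstance,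
    Subalgebra.val _, fun i k => ⟨X i k, Algebra.subset_adjoin ⟨(i, k), rfl⟩⟩, fun _ => rfl⟩

variable {R : Type*} [CommRing R] [Algebra ℂ R] (φ : R →ₐ[ℂ] Module.End ℂ V)

/-- `exp {(i/2) θ^{kl} q_{kl}}` for commuting operators `q_{kl}`. -/
def homExp (q : Fin p → Fin p → R) : Module.End ℂ (Formal p V) :=
  thetaExp (Complex.I / 2) fun k l => φ (q k l)

lemma homExp_mul (q q' : Fin p → Fin p → R) :
    homExp φ q * homExp φ q' = homExp φ (q + q') := by
  rw [homExp, homExp, thetaExp_mul, homExp]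
  · congr 1
    funext k l
    exact (map_add φ (q k l) (q' k l)).symm
  · intro k l k' l'
    exact (Commute.all (q k l) (q' k' l')).map φ

lemma homExp_congr {q q' : Fin p → Fin p → R} (h : ∀ k l, q k l - q l k = q' k l - q' l k) :
    homExp φ q = homExp φ q' :=
  thetaExp_congr _ fun k l => by rw [← map_sub, ← map_sub, h]

lemma thetaExp_neg_eq_homExp (q : Fin p → Fin p → R) :
    thetaExp (-(Complex.I / 2)) (fun k l => φ (q k l)) = homExp φ (-q) := by
  rw [thetaExp_neg, homExp]
  congr 1
  funext k l
  exact (map_neg φ (q k l)).symm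

lemma homExp_zero : homExp φ (0 : Fin p → Fin p → R) = 1 := by
  have h : (fun k l => φ ((0 : Fin p → Fin p → R) k l)) = 0 := by
    funext k l
    exact map_zero φ
  rw [homExp, h, thetaExp_zero]

lemma homExp_mul_neg (q : Fin p → Fin p → R) : homExp φ q * homExp φ (-q) = 1 := by
  rw [homExp_mul, add_neg_cancel, homExp_zero]

lemma homExp_neg_mul (q : Fin p → Fin p → R) : homExp φ (-q) * homExp φ q = 1 := by
  rw [homExp_mul, neg_add_cancel, homExp_zero]

lemma twist_eq_homExp (x y : Fin p → R) :
    twist (fun k => φ (x k)) (fun l => φ (y l)) = homExp φ (-fun k l => x k * y l) := by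
  rw [← thetaExp_neg_eq_homExp, twist]
  simp only [map_mul]

lemma twistInv_eq_homExp (x y : Fin p → R) :
    twistInv (fun k => φ (x k)) (fun l => φ (y l)) = homExp φ fun k l => x k * y l := by
  rw [homExp, twistInv]
  simp only [map_mul]

lemma fmap_homExp {R' : Type*} [CommRing R'] [Algebra ℂ R'] {ψ : R' →ₐ[ℂ] Module.End ℂ Z}
    {q : Fin p → Fin p → R} {q' : Fin p → Fin p → R'} (f : V →ₗ[ℂ] Z)
    (h : ∀ k l, f ∘ₗ φ (q k l) = ψ (q' k l) ∘ₗ f) (x : Formal p V) :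
    fmap f (homExp φ q x) = homExp ψ q' (fmap f x) :=
  fmap_thetaExp _ f h x

lemma comp_map_mul {R' : Type*} [CommRing R'] [Algebra ℂ R'] {ψ : R' →ₐ[ℂ] Module.End ℂ Z}
    {f : V →ₗ[ℂ] Z} {x y : R} {x' y' : R'} (hx : f ∘ₗ φ x = ψ x' ∘ₗ f)
    (hy : f ∘ₗ φ y = ψ y' ∘ₗ f) : f ∘ₗ φ (x * y) = ψ (x' * y') ∘ₗ f := by
  rw [map_mul, map_mul, Module.End.mul_eq_comp, Module.End.mul_eq_comp, ← LinearMap.comp_assoc,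
    hx, LinearMap.comp_assoc, hy, LinearMap.comp_assoc]

lemma comp_map_add {R' : Type*} [CommRing R'] [Algebra ℂ R'] {ψ : R' →ₐ[ℂ] Module.End ℂ Z}
    {f : V →ₗ[ℂ] Z} {x y : R} {x' y' : R'} (hx : f ∘ₗ φ x = ψ x' ∘ₗ f)
    (hy : f ∘ₗ φ y = ψ y' ∘ₗ f) : f ∘ₗ φ (x + y) = ψ (x' + y') ∘ₗ f := by
  rw [map_add, map_add, LinearMap.comp_add, LinearMap.add_comp, hx, hy]

lemma comp_map_neg {R' : Type*} [CommRing R'] [Algebra ℂ R'] {ψ : R' →ₐ[ℂ] Module.End ℂ Z}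
    {f : V →ₗ[ℂ] Z} {x : R} {x' : R'} (hx : f ∘ₗ φ x = ψ x' ∘ₗ f) :
    f ∘ₗ φ (-x) = ψ (-x') ∘ₗ f := by
  rw [map_neg, map_neg, LinearMap.comp_neg, LinearMap.neg_comp, hx]

/-- An exponent annihilated by f from the left contributes nothing, so such a factor may be inserted
freely. -/
lemma fmap_homExp_of_comp_eq_zero {q : Fin p → Fin p → R} (f : V →ₗ[ℂ] Z)
    (h : ∀ k l, f ∘ₗ φ (q k l) = 0) (x : Formal p V) : fmap f (homExp φ q x) = fmap f x := by
  rw [homExp, fmap_thetaExp (Q' := 0) _ f (fun k l => by rw [h k l]; rfl), thetaExp_zero,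
    Module.End.one_apply]

/-- Transport of the twists of two factors through an equivariant product `f`. -/
lemma fmap_twist_pair {R' : Type*} [CommRing R'] [Algebra ℂ R'] (ψ : R' →ₐ[ℂ] Module.End ℂ Z)
    (f : V →ₗ[ℂ] Z) {w a h : Fin p → R'} {w₁ a₁ h₁ w₂ a₂ h₂ : Fin p → R}
    (hw : ∀ k, f ∘ₗ φ (w₁ k + w₂ k) = ψ (w k) ∘ₗ f)
    (ha : ∀ k, f ∘ₗ φ (a₁ k + a₂ k) = ψ (a k) ∘ₗ f)
    (hh : ∀ k, f ∘ₗ φ (h₁ k) = ψ (h k) ∘ₗ f)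
    (hm : ∀ k, f ∘ₗ φ (h₂ k + w₁ k - h₁ k) = 0) (z : Formal p V) :
    fmap f ((homExp φ (-fun k l => w₁ k * a₁ l) * homExp φ (fun k l => h₁ l * w₁ k) *
      homExp φ (-fun k l => w₂ k * a₂ l) * homExp φ (fun k l => h₂ l * w₂ k)) z) =
    (homExp ψ (-fun k l => w k * a l) * homExp ψ (fun k l => h l * w k)) (fmap f
      (homExp φ (fun k l => w₁ k * a₂ l + w₂ k * a₁ l + w₁ k * w₂ l) z)) := by
  rw [homExp_mul, homExp_mul, homExp_mul, homExp_mul,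
    ← fmap_homExp (φ := φ)
      (q := fun k l => -((w₁ k + w₂ k) * (a₁ l + a₂ l)) + h₁ l * (w₁ k + w₂ k))
      (q' := (-fun k l => w k * a l) + fun k l => h l * w k) f
      (fun k l => comp_map_add φ (comp_map_neg φ (comp_map_mul φ (hw k) (ha l)))
        (comp_map_mul φ (hh l) (hw k)))]
  -- A factor invisible to f is inserted. By `hm` it replaces h₁ by h₂ + w₁ in the cross term with
  -- w₂, as happens when a left multiplication on the second Weil factor is moved to the first.
  conv_rhs => rw [← fmap_homExp_of_comp_eq_zero φ (q := fun k l => (h₂ l + w₁ l - h₁ l) * w₂ k) f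
      (fun k l => by
        rw [map_mul, Module.End.mul_eq_comp, ← LinearMap.comp_assoc, hm, LinearMap.zero_comp]),
    ← Module.End.mul_apply, ← Module.End.mul_apply, homExp_mul, homExp_mul]
  congr 2
  -- The two exponents differ by w₁_k w₂_l + w₁_l w₂_k, which is symmetric in k and l.
  refine homExp_congr φ fun k l => ?_
  simp only [Pi.add_apply, Pi.neg_apply]
  ring

lemma fmap₂_flip (β : U →ₗ[ℂ] V →ₗ[ℂ] Z) (x : Formal p U) (y : Formal p V) :
    fmap₂ β x y = fmap₂ β.flip y x := by
  funext m
  rw [fmap₂_apply, fmap₂_apply, ← sum_antidiagonal_swap]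
  rfl

lemma fmap₂_thetaExp_left (c : ℂ) (β : U →ₗ[ℂ] V →ₗ[ℂ] Z) {Q : Fin p → Fin p → Module.End ℂ U}
    {Q' : Fin p → Fin p → Module.End ℂ Z} (h : ∀ k l u v, β (Q k l u) v = Q' k l (β u v))
    (x : Formal p U) (y : Formal p V) :
    fmap₂ β (thetaExp c Q x) y = thetaExp c Q' (fmap₂ β x y) := by
  refine thetaExp_intertwine c ((fmap₂ β).flip y)
    (fun d x hx => by simpa using hx.fmap₂ β (hasOrderGE_zero y)) (fun x => ?_) x
  simp only [LinearMap.flip_apply, thetaSum_apply, map_sum, LinearMap.sum_apply]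
  refine Finset.sum_congr rfl fun k _ => Finset.sum_congr rfl fun l _ => ?_
  have h1 : fmap (Q' k l) (fmap₂ β x y) = fmap₂ β (fmap (Q k l) x) y := by
    funext m
    rw [fmap_apply, fmap₂_apply, fmap₂_apply, map_sum]
    exact Finset.sum_congr rfl fun ij _ => (h k l _ _).symm
  rw [h1]
  funext m
  simp only [fmap₂_apply, map_sum, LinearMap.sum_apply, LinearMap.lsmul_apply, map_smul,
    LinearMap.smul_apply, Finset.smul_sum]
  rw [Finset.sum_sigma', Finset.sum_sigma']
  refine Finset.sum_nbij' (fun t => ⟨(t.2.1, t.2.2 + t.1.2), (t.2.2, t.1.2)⟩)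
    (fun t => ⟨(t.1.1 + t.2.1, t.2.2), (t.1.1, t.2.1)⟩) ?_ ?_ ?_ ?_ ?_
  all_goals
    rintro ⟨⟨i, j⟩, ⟨i', j'⟩⟩ h
    simp only [Finset.mem_sigma, Finset.HasAntidiagonal.mem_antidiagonal] at h ⊢
  · exact ⟨by rw [← h.1, ← h.2, add_assoc], trivial⟩
  · exact ⟨by rw [← h.1, ← h.2, add_assoc], trivial⟩
  · obtain ⟨-, rfl⟩ := h
    rfl
  · obtain ⟨-, rfl⟩ := h
    rfl

lemma fmap₂_thetaExp_right (c : ℂ) (β : U →ₗ[ℂ] V →ₗ[ℂ] Z) {Q : Fin p → Fin p → Module.End ℂ V}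
    {Q' : Fin p → Fin p → Module.End ℂ Z} (h : ∀ k l u v, β u (Q k l v) = Q' k l (β u v))
    (x : Formal p U) (y : Formal p V) :
    fmap₂ β x (thetaExp c Q y) = thetaExp c Q' (fmap₂ β x y) := by
  rw [fmap₂_flip, fmap₂_flip β x y]
  exact fmap₂_thetaExp_left c β.flip (fun k l v u => h k l u v) y x

end HomExp

/-! ### Commutative algebras of operators on tensor products. -/

section TensorLetters

variable {p : ℕ} {W : Type u} {A : Type v} [AddCommGroup W] [Module ℂ W] [AddCommGroup A]
  [Module ℂ A] {x y : Fin p → Module.End ℂ W} {z : Fin p → Module.End ℂ A}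

lemma commute_map {a a' : Module.End ℂ W} {b b' : Module.End ℂ A} (ha : Commute a a')
    (hb : Commute b b') : Commute (TensorProduct.map a b) (TensorProduct.map a' b') := by
  rw [Commute, SemiconjBy, ← TensorProduct.map_mul, ← TensorProduct.map_mul, ha.eq, hb.eq]

/-- Commuting operators on the factors of a tensor product form a commutative algebra. -/
lemma exists_algHom_map (hxx : ∀ k l, Commute (x k) (x l)) (hxy : ∀ k l, Commute (x k) (y l))
    (hyy : ∀ k l, Commute (y k) (y l)) (hzz : ∀ k l, Commute (z k) (z l)) :
    ∃ (R : Type (max u v)) (_ : CommRing R) (_ : Algebra ℂ R)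
      (φ : R →ₐ[ℂ] Module.End ℂ (W ⊗[ℂ] A)) (w a h : Fin p → R),
      (∀ k, TensorProduct.map (x k) 1 = φ (w k)) ∧ (∀ k, TensorProduct.map 1 (z k) = φ (a k)) ∧
      ∀ k, TensorProduct.map (y k) 1 = φ (h k) := by
  have hyx : ∀ k l, Commute (y k) (x l) := fun k l => (hxy l k).symm
  obtain ⟨R, i₁, i₂, φ, t, ht⟩ := exists_algHom_of_commute
    (E := Module.End ℂ (W ⊗[ℂ] A)) (p := p)
    ![fun k => TensorProduct.map (x k) 1, fun k => TensorProduct.map 1 (z k),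
      fun k => TensorProduct.map (y k) 1] (by
    intro i j k l
    fin_cases i <;> fin_cases j <;> refine commute_map ?_ ?_ <;>
      first
        | exact hxx _ _
        | exact hxy _ _
        | exact hyx _ _
        | exact hyy _ _
        | exact hzz _ _
        | exact Commute.one_left _)
  exact ⟨R, i₁, i₂, φ, t 0, t 1, t 2, fun k => congrFun (ht 0) k, fun k => congrFun (ht 1) k,
    fun k => congrFun (ht 2) k⟩

lemma commute_quad {a a' : Module.End ℂ W} {b b' : Module.End ℂ A} {c c' : Module.End ℂ W}
    {d d' : Module.End ℂ A} (ha : Commute a a') (hb : Commute b b') (hc : Commute c c')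
    (hd : Commute d d') : Commute (quad a b c d) (quad a' b' c' d') := by
  rw [Commute, SemiconjBy, quad_mul, quad_mul, ha.eq, hb.eq, hc.eq, hd.eq]

/-- Commuting operators on the factors of `(W ⊗ A) ⊗ (W ⊗ A)` form a commutative algebra. -/
lemma exists_algHom_quad (hxx : ∀ k l, Commute (x k) (x l)) (hxy : ∀ k l, Commute (x k) (y l))
    (hyy : ∀ k l, Commute (y k) (y l)) (hzz : ∀ k l, Commute (z k) (z l)) :
    ∃ (R : Type (max u v)) (_ : CommRing R) (_ : Algebra ℂ R)
      (φ : R →ₐ[ℂ] Module.End ℂ ((W ⊗[ℂ] A) ⊗[ℂ] (W ⊗[ℂ] A))) (w₁ a₁ h₁ w₂ a₂ h₂ : Fin p → R),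
      ((∀ k, quad (x k) 1 1 1 = φ (w₁ k)) ∧ (∀ k, quad 1 (z k) 1 1 = φ (a₁ k)) ∧
        ∀ k, quad (y k) 1 1 1 = φ (h₁ k)) ∧
      (∀ k, quad 1 1 (x k) 1 = φ (w₂ k)) ∧ (∀ k, quad 1 1 1 (z k) = φ (a₂ k)) ∧
        ∀ k, quad 1 1 (y k) 1 = φ (h₂ k) := by
  have hyx : ∀ k l, Commute (y k) (x l) := fun k l => (hxy l k).symm
  obtain ⟨R, i₁, i₂, φ, t, ht⟩ := exists_algHom_of_commute
    (E := Module.End ℂ ((W ⊗[ℂ] A) ⊗[ℂ] (W ⊗[ℂ] A))) (p := p)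
    ![fun k => quad (x k) 1 1 1, fun k => quad 1 (z k) 1 1, fun k => quad (y k) 1 1 1,
      fun k => quad 1 1 (x k) 1, fun k => quad 1 1 1 (z k), fun k => quad 1 1 (y k) 1] (by
    intro i j k l
    fin_cases i <;> fin_cases j <;> refine commute_quad ?_ ?_ ?_ ?_ <;>
      first
        | exact hxx _ _
        | exact hxy _ _
        | exact hyx _ _
        | exact hyy _ _
        | exact hzz _ _
        | exact Commute.one_left _)
  exact ⟨R, i₁, i₂, φ, t 0, t 1, t 2, t 3, t 4, t 5,
    ⟨fun k => congrFun (ht 0) k, fun k => congrFun (ht 1) k, fun k => congrFun (ht 2) k⟩,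
    fun k => congrFun (ht 3) k, fun k => congrFun (ht 4) k, fun k => congrFun (ht 5) k⟩

end TensorLetters

/-! ### The twisted Cartan complex in terms of the untwisted one -/

section TwistedComplex

variable {g : Type u} [LieRing g] [LieAlgebra ℂ g] {ι : Type*} [Fintype ι] [DecidableEq ι] {p : ℕ}
  (D : TwistData g ι p) {A : Type v} [Ring A] [Algebra ℂ A] {𝒜 : ℤ → Submodule ℂ A}
  [GradedAlgebra 𝒜] (S : GDA g 𝒜)

lemma even_zero : Weil.even D.B 0 = 0 := map_zero (Weil.evenHom D.B)

lemma even_H_comm (k l : Fin p) :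
    Weil.even D.B (D.H k) * Weil.even D.B (D.H l) =
      Weil.even D.B (D.H l) * Weil.even D.B (D.H k) := by
  rw [Weil.even_mul_even, D.comm, even_zero, add_zero]

lemma commute_mulLeft_H (k l : Fin p) :
    Commute (LinearMap.mulLeft ℂ (Weil.even D.B (D.H k)))
      (LinearMap.mulLeft ℂ (Weil.even D.B (D.H l))) := by
  rw [Commute, SemiconjBy, Module.End.mul_eq_comp, Module.End.mul_eq_comp, ← LinearMap.mulLeft_mul,
    ← LinearMap.mulLeft_mul, even_H_comm]

lemma commute_adH_mulLeft_H (k l : Fin p) :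
    Commute (adH D k) (LinearMap.mulLeft ℂ (Weil.even D.B (D.H l))) := by
  refine LinearMap.ext fun w => ?_
  change Weil.ad D.B (D.H k) (Weil.even D.B (D.H l) * w) =
    Weil.even D.B (D.H l) * Weil.ad D.B (D.H k) w
  rw [Weil.ad_mul, Weil.ad_even, D.comm, even_zero, zero_mul, zero_add]

lemma commute_adH_adH (k l : Fin p) : Commute (adH D k) (adH D l) := by
  refine LinearMap.ext fun w => ?_
  change Weil.ad D.B (D.H k) (Weil.even D.B (D.H l) * w - w * Weil.even D.B (D.H l)) =
    Weil.even D.B (D.H l) * Weil.ad D.B (D.H k) w - Weil.ad D.B (D.H k) w * Weil.even D.B (D.H l)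
  rw [map_sub, Weil.ad_mul, Weil.ad_mul, Weil.ad_even, D.comm, even_zero, zero_mul, zero_add,
    mul_zero, add_zero]

lemma commute_L_H (k l : Fin p) : Commute (S.L (D.H k)) (S.L (D.H l)) :=
  sub_eq_zero.1 (by rw [S.L_L, D.comm, map_zero])

/-- The operators of the Cartan elements on `W ⊗ A` form a commutative algebra. -/
lemma exists_cartanOperators : ∃ (R : Type (max u v)) (_ : CommRing R) (_ : Algebra ℂ R)
    (φ : R →ₐ[ℂ] Module.End ℂ (WA D S)) (w a h : Fin p → R),
    (∀ k, (adH D k).rTensor A = φ (w k)) ∧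
    (∀ k, (S.L (D.H k)).lTensor (Weil D.B) = φ (a k)) ∧
    ∀ k, (LinearMap.mulLeft ℂ (Weil.even D.B (D.H k))).rTensor A = φ (h k) :=
  exists_algHom_map (commute_adH_adH D) (commute_adH_mulLeft_H D) (commute_mulLeft_H D)
    (commute_L_H D S)

section Letters

variable {D S} {R : Type*} [CommRing R] [Algebra ℂ R] {φ : R →ₐ[ℂ] Module.End ℂ (WA D S)}
  {w a h : Fin p → R}

lemma chi_eq
    (hw : ∀ k, (adH D k).rTensor A = φ (w k))
    (ha : ∀ k, (S.L (D.H k)).lTensor (Weil D.B) = φ (a k)) :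
    chi D S = homExp φ (-fun k l => w k * a l) := by
  rw [chi, ← twist_eq_homExp]
  simp only [hw, ha]

lemma chiInv_eq
    (hw : ∀ k, (adH D k).rTensor A = φ (w k))
    (ha : ∀ k, (S.L (D.H k)).lTensor (Weil D.B) = φ (a k)) :
    chiInv D S = homExp φ (fun k l => w k * a l) := by
  rw [chiInv, ← twistInv_eq_homExp]
  simp only [hw, ha]

lemma quantum_eq
    (hw : ∀ k, (adH D k).rTensor A = φ (w k))
    (hh : ∀ k, (LinearMap.mulLeft ℂ (Weil.even D.B (D.H k))).rTensor A = φ (h k)) :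
    quantum D S = homExp φ (fun k l => h l * w k) := by
  rw [quantum, homExp]
  simp only [LinearMap.rTensor_mul, hw, hh, map_mul]

lemma quantumInv_eq
    (hw : ∀ k, (adH D k).rTensor A = φ (w k))
    (hh : ∀ k, (LinearMap.mulLeft ℂ (Weil.even D.B (D.H k))).rTensor A = φ (h k)) :
    quantumInv D S = homExp φ (-fun k l => h l * w k) := by
  rw [quantumInv, ← thetaExp_neg_eq_homExp]
  simp only [LinearMap.rTensor_mul, hw, hh, map_mul]

end Letters

/-- The transport `χ Q` from the untwisted to the twisted complex. -/
def transport : Module.End ℂ (Formal p (WA D S)) := chi D S * quantum D S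

/-- The inverse of `transport`. -/
def transportInv : Module.End ℂ (Formal p (WA D S)) := quantumInv D S * chiInv D S

lemma chiInv_mul_chi : chiInv D S * chi D S = 1 := by
  obtain ⟨R, _, _, φ, w, a, h, hw, ha, hh⟩ := exists_cartanOperators D S
  rw [chi_eq hw ha, chiInv_eq hw ha, homExp_mul_neg]

lemma chi_mul_chiInv : chi D S * chiInv D S = 1 := by
  obtain ⟨R, _, _, φ, w, a, h, hw, ha, hh⟩ := exists_cartanOperators D S
  rw [chi_eq hw ha, chiInv_eq hw ha, homExp_neg_mul]

lemma quantumInv_mul_quantum : quantumInv D S * quantum D S = 1 := by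
  obtain ⟨R, _, _, φ, w, a, h, hw, ha, hh⟩ := exists_cartanOperators D S
  rw [quantum_eq hw hh, quantumInv_eq hw hh, homExp_neg_mul]

lemma quantum_mul_quantumInv : quantum D S * quantumInv D S = 1 := by
  obtain ⟨R, _, _, φ, w, a, h, hw, ha, hh⟩ := exists_cartanOperators D S
  rw [quantum_eq hw hh, quantumInv_eq hw hh, homExp_mul_neg]

lemma transportInv_transport (x : Formal p (WA D S)) :
    transportInv D S (transport D S x) = x := by
  have h : transportInv D S * transport D S = 1 := by
    rw [transportInv, transport, mul_assoc, ← mul_assoc (chiInv D S), chiInv_mul_chi, one_mul,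
      quantumInv_mul_quantum]
  exact LinearMap.congr_fun h x

lemma transport_transportInv (x : Formal p (WA D S)) :
    transport D S (transportInv D S x) = x := by
  have h : transport D S * transportInv D S = 1 := by
    rw [transportInv, transport, mul_assoc, ← mul_assoc (quantum D S), quantum_mul_quantumInv,
      one_mul, chi_mul_chiInv]
  exact LinearMap.congr_fun h x

lemma transport_injective : Function.Injective (transport D S) :=
  Function.LeftInverse.injective (transportInv_transport D S)

lemma lmul_const (z : Weil D.B) :
    lmul D S (const p z) = fmap ((LinearMap.mulLeft ℂ z).rTensor A) := by
  rw [lmul, fmap₂_const_left]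
  rfl

lemma rmul_const (z : Weil D.B) :
    rmul D S (const p z) = fmap ((LinearMap.mulRight ℂ z).rTensor A) := by
  rw [rmul, fmap₂_const_left]
  rfl

lemma lmul_one : lmul D S (const p 1) = 1 := by
  rw [lmul_const, LinearMap.mulLeft_one, LinearMap.rTensor_id]
  rfl

lemma rmul_one : rmul D S (const p 1) = 1 := by
  rw [rmul_const, LinearMap.mulRight_one, LinearMap.rTensor_id]
  rfl

lemma lmul_lam (b : ι) : lmul D S (lam D b) = thetaExp (Complex.I / 2)
    fun k l => D.r b k • (LinearMap.mulLeft ℂ (Weil.even D.B (D.H l))).rTensor A := by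
  refine LinearMap.ext fun x => ?_
  have hone := LinearMap.congr_fun (lmul_one D S) x
  rw [lmul, lam, fmap₂_thetaExp_left (Q' := fun k l =>
    D.r b k • (LinearMap.mulLeft ℂ (Weil.even D.B (D.H l))).rTensor A)]
  · exact congrArg _ hone
  · intro k l u t
    induction t using TensorProduct.induction_on with
    | zero => simp
    | add t t' ht ht' => rw [map_add, map_add, map_add, ht, ht']
    | tmul w ν =>
      change (D.r b k • (Weil.even D.B (D.H l) * u) * w) ⊗ₜ[ℂ] ν =
        D.r b k • ((Weil.even D.B (D.H l) * (u * w)) ⊗ₜ[ℂ] ν)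
      rw [TensorProduct.smul_tmul', smul_mul_assoc, mul_assoc]

/-- `λ_a` may also be defined by right multiplications. -/
lemma lam_eq_mulRight (b : ι) : lam D b = thetaExp (Complex.I / 2)
    (fun k l => D.r b k • LinearMap.mulRight ℂ (Weil.even D.B (D.H l))) (const p 1) := by
  have hlr : ∀ k l, Commute (LinearMap.mulLeft ℂ (Weil.even D.B (D.H k)))
      (LinearMap.mulRight ℂ (Weil.even D.B (D.H l))) := fun k l =>
    LinearMap.ext fun w => (mul_assoc _ w _).symm
  have hlr' : ∀ k l, Commute (LinearMap.mulRight ℂ (Weil.even D.B (D.H k))) (adH D l) :=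
    fun k l => (hlr l k).symm.sub_right (by
      refine LinearMap.ext fun w => ?_
      change w * Weil.even D.B (D.H l) * Weil.even D.B (D.H k) =
        w * Weil.even D.B (D.H k) * Weil.even D.B (D.H l)
      rw [mul_assoc, mul_assoc, even_H_comm])
  -- Left multiplication by H_l is right multiplication plus the adjoint action, the two commute,
  -- and the adjoint action kills 1.
  have h : thetaExp (Complex.I / 2)
      (fun k l => D.r b k • LinearMap.mulLeft ℂ (Weil.even D.B (D.H l))) =
      thetaExp (Complex.I / 2) (fun k l => D.r b k • LinearMap.mulRight ℂ (Weil.even D.B (D.H l))) *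
      thetaExp (Complex.I / 2) (fun k l => D.r b k • adH D l) := by
    rw [thetaExp_mul]
    · congr 1
      funext k l
      rw [Pi.add_apply, Pi.add_apply, ← smul_add, adH, add_sub_cancel]
    · exact fun k l k' l' => ((hlr' l l').smul_left _).smul_right _
  rw [lam, h, Module.End.mul_apply]
  refine congrArg _ (thetaExp_apply_eq_self _ (thetaSum_eq_zero fun k l => ?_))
  have : (D.r b k • adH D l) 1 = 0 := by
    rw [LinearMap.smul_apply]
    change D.r b k • (Weil.even D.B (D.H l) * 1 - 1 * Weil.even D.B (D.H l)) = 0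
    rw [mul_one, one_mul, sub_self, smul_zero]
  rw [fmap_const, this, map_zero]

lemma rmul_lam (b : ι) : rmul D S (lam D b) = thetaExp (Complex.I / 2)
    fun k l => D.r b k • (LinearMap.mulRight ℂ (Weil.even D.B (D.H l))).rTensor A := by
  refine LinearMap.ext fun x => ?_
  have hone := LinearMap.congr_fun (rmul_one D S) x
  rw [rmul, lam_eq_mulRight, fmap₂_thetaExp_left (Q' := fun k l =>
    D.r b k • (LinearMap.mulRight ℂ (Weil.even D.B (D.H l))).rTensor A)]
  · exact congrArg _ hone
  · intro k l u t
    induction t using TensorProduct.induction_on with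
    | zero => simp
    | add t t' ht ht' => rw [map_add, map_add, map_add, ht, ht']
    | tmul w ν =>
      change (w * D.r b k • (u * Weil.even D.B (D.H l))) ⊗ₜ[ℂ] ν =
        D.r b k • ((w * u * Weil.even D.B (D.H l)) ⊗ₜ[ℂ] ν)
      rw [TensorProduct.smul_tmul', mul_smul_comm, mul_assoc]

end TwistedComplex

/-! ### Membership in the twisted Cartan complex -/

section Membership

variable {g : Type u} [LieRing g] [LieAlgebra ℂ g] {ι : Type*} [Fintype ι] [DecidableEq ι] {p : ℕ}
  (D : TwistData g ι p) {A : Type v} [Ring A] [Algebra ℂ A] {𝒜 : ℤ → Submodule ℂ A}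
  [GradedAlgebra 𝒜] (S : GDA g 𝒜)

section Letters

variable {D S} {R : Type*} [CommRing R] [Algebra ℂ R] {φ : R →ₐ[ℂ] Module.End ℂ (WA D S)}
  {w a h : Fin p → R}

lemma lmul_lam_eq_homExp
    (hh : ∀ k, (LinearMap.mulLeft ℂ (Weil.even D.B (D.H k))).rTensor A = φ (h k)) (b : ι) :
    lmul D S (lam D b) = homExp φ fun k l => D.r b k • h l := by
  rw [lmul_lam, homExp]
  simp only [hh, map_smul]

lemma rmul_lam_eq_homExp (hw : ∀ k, (adH D k).rTensor A = φ (w k))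
    (hh : ∀ k, (LinearMap.mulLeft ℂ (Weil.even D.B (D.H k))).rTensor A = φ (h k)) (b : ι) :
    rmul D S (lam D b) = homExp φ fun k l => D.r b k • (h l - w l) := by
  have h1 : ∀ k, (LinearMap.mulRight ℂ (Weil.even D.B (D.H k))).rTensor A = φ (h k - w k) := by
    intro k
    rw [map_sub, ← hh, ← hw]
    refine TensorProduct.ext' fun v ν => ?_
    change (v * Weil.even D.B (D.H k)) ⊗ₜ[ℂ] ν = (Weil.even D.B (D.H k) * v) ⊗ₜ[ℂ] ν -
      (Weil.even D.B (D.H k) * v - v * Weil.even D.B (D.H k)) ⊗ₜ[ℂ] ν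
    rw [← TensorProduct.sub_tmul, sub_sub_cancel]
  rw [rmul_lam, homExp]
  simp only [h1, map_smul]

end Letters

lemma map_smul_one_apply {V R : Type*} [AddCommGroup V] [Module ℂ V] [CommRing R] [Algebra ℂ R]
    (φ : R →ₐ[ℂ] Module.End ℂ V) (x : R) (c : ℂ) (v : V) : φ (x + c • 1) v = φ x v + c • v := by
  rw [map_add, map_smul, map_one]
  rfl

/-- `ξ_a X λ_a` and `e_a X λ_a` on the untwisted module. -/
lemma mulLeft_mul_rmul_lam_mul_quantum (b : ι) {z : Weil D.B}
    (hz : ∀ k, Weil.ad D.B (D.H k) z = D.r b k • z) :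
    lmul D S (const p z) * rmul D S (lam D b) * quantum D S =
      quantum D S * fmap ((LinearMap.mulLeft ℂ z).rTensor A) := by
  obtain ⟨R, _, _, φ, w, a, h, hw, ha, hh⟩ := exists_cartanOperators D S
  rw [lmul_const, rmul_lam_eq_homExp hw hh, quantum_eq hw hh, mul_assoc, homExp_mul]
  have e1 : ∀ l, (LinearMap.mulLeft ℂ z).rTensor A ∘ₗ φ (h l + D.r b l • 1) =
      φ (h l) ∘ₗ (LinearMap.mulLeft ℂ z).rTensor A := fun l => by
    refine TensorProduct.ext' fun v ν => ?_
    rw [LinearMap.comp_apply, LinearMap.comp_apply, map_smul_one_apply, ← hh, map_add, map_smul]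
    have := hz l
    rw [Weil.ad_apply, sub_eq_iff_eq_add] at this
    change (z * (Weil.even D.B (D.H l) * v)) ⊗ₜ[ℂ] ν + D.r b l • ((z * v) ⊗ₜ[ℂ] ν) =
      (Weil.even D.B (D.H l) * (z * v)) ⊗ₜ[ℂ] ν
    rw [← mul_assoc _ z, this, add_mul, TensorProduct.add_tmul, smul_mul_assoc,
      TensorProduct.smul_tmul', mul_assoc, add_comm]
  have e2 : ∀ k, (LinearMap.mulLeft ℂ z).rTensor A ∘ₗ φ (w k + D.r b k • 1) =
      φ (w k) ∘ₗ (LinearMap.mulLeft ℂ z).rTensor A := fun k => by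
    refine TensorProduct.ext' fun v ν => ?_
    rw [LinearMap.comp_apply, LinearMap.comp_apply, map_smul_one_apply, ← hw, map_add, map_smul]
    change (z * Weil.ad D.B (D.H k) v) ⊗ₜ[ℂ] ν + D.r b k • ((z * v) ⊗ₜ[ℂ] ν) =
      (Weil.ad D.B (D.H k) (z * v)) ⊗ₜ[ℂ] ν
    rw [Weil.ad_mul, hz, TensorProduct.add_tmul, smul_mul_assoc, TensorProduct.smul_tmul', add_comm]
  refine LinearMap.ext fun x => ?_
  rw [Module.End.mul_apply, Module.End.mul_apply,
    ← fmap_homExp φ _ fun k l => comp_map_mul φ (e1 l) (e2 k)]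
  congr 2
  -- Multiplication by an element of weight r shifts h_l and w_k by r_l and r_k. The cross terms
  -- reproduce the exponent of right multiplication by λ up to antisymmetry, and r_l r_k is
  -- symmetric, so it drops out.
  refine homExp_congr φ fun k l => ?_
  simp only [Pi.add_apply, Algebra.smul_def, mul_one]
  ring

/-- `λ_a X ξ_a` and `λ_a X e_a` on the untwisted module. -/
lemma lmul_lam_mul_mulRight_mul_quantum (b : ι) {z : Weil D.B}
    (hz : ∀ k, Weil.ad D.B (D.H k) z = D.r b k • z) :
    lmul D S (lam D b) * rmul D S (const p z) * quantum D S =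
      quantum D S * fmap ((LinearMap.mulRight ℂ z).rTensor A) := by
  obtain ⟨R, _, _, φ, w, a, h, hw, ha, hh⟩ := exists_cartanOperators D S
  rw [rmul_const, lmul_lam_eq_homExp hh, quantum_eq hw hh]
  have e1 : ∀ l, (LinearMap.mulRight ℂ z).rTensor A ∘ₗ φ (h l) =
      φ (h l) ∘ₗ (LinearMap.mulRight ℂ z).rTensor A := fun l => by
    refine TensorProduct.ext' fun v ν => ?_
    rw [LinearMap.comp_apply, LinearMap.comp_apply, ← hh]
    exact congrArg (· ⊗ₜ[ℂ] ν) (mul_assoc _ _ _)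
  have e2 : ∀ k, (LinearMap.mulRight ℂ z).rTensor A ∘ₗ φ (w k + D.r b k • 1) =
      φ (w k) ∘ₗ (LinearMap.mulRight ℂ z).rTensor A := fun k => by
    refine TensorProduct.ext' fun v ν => ?_
    rw [LinearMap.comp_apply, LinearMap.comp_apply, map_smul_one_apply, ← hw, map_add, map_smul]
    change (Weil.ad D.B (D.H k) v * z) ⊗ₜ[ℂ] ν + D.r b k • ((v * z) ⊗ₜ[ℂ] ν) =
      (Weil.ad D.B (D.H k) (v * z)) ⊗ₜ[ℂ] ν
    rw [Weil.ad_mul, hz, TensorProduct.add_tmul, mul_smul_comm, TensorProduct.smul_tmul']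
  have e3 : ∀ k l, (LinearMap.mulRight ℂ z).rTensor A ∘ₗ φ (D.r b k • h l) =
      φ (D.r b k • h l) ∘ₗ (LinearMap.mulRight ℂ z).rTensor A := fun k l => by
    rw [map_smul, LinearMap.comp_smul, e1, LinearMap.smul_comp]
  refine LinearMap.ext fun x => ?_
  rw [Module.End.mul_apply, Module.End.mul_apply, Module.End.mul_apply, ← fmap_homExp φ _ e3,
    ← fmap_homExp φ _ fun k l => comp_map_mul φ (e1 l) (e2 k),
    ← Module.End.mul_apply (homExp φ _) (homExp φ _), homExp_mul]
  congr 2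
  refine homExp_congr φ fun k l => ?_
  simp only [Pi.add_apply, Algebra.smul_def, mul_one]
  ring

lemma fmap_mul_quantum_of_commute {f : Module.End ℂ (WA D S)}
    (hfw : ∀ k, Commute f ((adH D k).rTensor A))
    (hfh : ∀ k, Commute f ((LinearMap.mulLeft ℂ (Weil.even D.B (D.H k))).rTensor A)) :
    fmap f * quantum D S = quantum D S * fmap f :=
  LinearMap.ext fun x => fmap_thetaExp _ f (fun k l => by
    rw [LinearMap.rTensor_mul]
    exact (hfh l).mul_right (hfw k)) x

lemma ad_H_even (b : ι) (k : Fin p) :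
    Weil.ad D.B (D.H k) (Weil.even D.B (D.e b)) = D.r b k • Weil.even D.B (D.e b) := by
  rw [Weil.ad_even, D.weight]
  exact map_smul (Weil.evenHom D.B) _ _

lemma ad_H_odd (b : ι) (k : Fin p) :
    Weil.ad D.B (D.H k) (Weil.odd D.B (D.e b)) = D.r b k • Weil.odd D.B (D.e b) := by
  rw [Weil.ad_odd, D.weight]
  exact map_smul (Weil.oddHom D.B) _ _

/-- Both terms of the twisted adjoint action are conjugated to their undeformed counterparts because
e_a is a weight vector with the weight that enters λ_a. -/
lemma lieW_mul_quantum (b : ι) :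
    lieW D S b * quantum D S = quantum D S * fmap ((Weil.ad D.B (D.e b)).rTensor A) := by
  rw [lieW, sub_mul, mulLeft_mul_rmul_lam_mul_quantum D S b (ad_H_even D b),
    lmul_lam_mul_mulRight_mul_quantum D S b (ad_H_even D b), ← mul_sub, ← fmap_sub,
    ← LinearMap.rTensor_sub]
  rfl

lemma intW_mul_quantum (b : ι) :
    intW D S b * quantum D S = quantum D S * fmap ((Weil.contr D.B (D.e b)).rTensor A) := by
  have hP : fmap ((Weil.parity D.B).toLinearMap.rTensor A) * quantum D S =
      quantum D S * fmap ((Weil.parity D.B).toLinearMap.rTensor A) := by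
    refine fmap_mul_quantum_of_commute D S (fun k => ?_) fun k => ?_
    · rw [Commute, SemiconjBy, ← LinearMap.rTensor_mul, ← LinearMap.rTensor_mul]
      exact congrArg _ (parityW_commute_ad D (D.H k))
    · rw [Commute, SemiconjBy, ← LinearMap.rTensor_mul, ← LinearMap.rTensor_mul]
      exact congrArg _ (parityW_commute_mulLeft D (D.H k))
  rw [intW, sub_mul, mulLeft_mul_rmul_lam_mul_quantum D S b (ad_H_odd D b), mul_assoc _ (fmap _),
    hP, ← mul_assoc, lmul_lam_mul_mulRight_mul_quantum D S b (ad_H_odd D b), mul_assoc, ← mul_sub,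
    ← fmap_mul, ← fmap_sub, ← LinearMap.rTensor_mul, ← LinearMap.rTensor_sub]
  rfl

lemma lieTot_transport (b : ι) (x : Formal p (WA D S)) :
    lieTot D S b (transport D S x) = transport D S (fmap (lieOp D S (D.e b)) x) := by
  have h : lieTot D S b * transport D S = transport D S * fmap (lieOp D S (D.e b)) := by
    have hrl : ∀ f : Module.End ℂ (Weil D.B),
        Commute ((S.L (D.e b)).lTensor (Weil D.B)) (f.rTensor A) := fun f =>
      TensorProduct.ext' fun _ _ => rfl
    rw [lieTot, transport, mul_assoc, ← mul_assoc (chiInv D S), chiInv_mul_chi, one_mul, mul_assoc,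
      add_mul, lieW_mul_quantum, fmap_mul_quantum_of_commute D S (fun k => hrl _) (fun k => hrl _),
      ← mul_add, ← fmap_add, mul_assoc]
    rfl
  exact LinearMap.congr_fun h x

/-- Unlike the total Lie derivative, the contraction on the first factor does not commute with χ: it
shifts the weight by r(a). The shift only changes χ into another invertible exponential, so the
kernels still correspond, although no intertwining relation with `transport` is obtained. -/
lemma intW_transport_eq_zero_iff (b : ι) (x : Formal p (WA D S)) :
    intW D S b (transport D S x) = 0 ↔ fmap ((Weil.contr D.B (D.e b)).rTensor A) x = 0 := by
  obtain ⟨R, _, _, φ, w, a, h, hw, ha, hh⟩ := exists_cartanOperators D S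
  have hcomm : transport D S = quantum D S * chi D S := by
    rw [transport, chi_eq hw ha, quantum_eq hw hh, homExp_mul, homExp_mul, add_comm]
  have e1 : ∀ k, (Weil.contr D.B (D.e b)).rTensor A ∘ₗ φ (w k) =
      φ (w k + (-D.r b k) • 1) ∘ₗ (Weil.contr D.B (D.e b)).rTensor A := fun k => by
    refine TensorProduct.ext' fun v ν => ?_
    rw [LinearMap.comp_apply, LinearMap.comp_apply, map_smul_one_apply, ← hw]
    have h1 := ad_H_odd D b k
    change (Weil.contr D.B (D.e b) (Weil.ad D.B (D.H k) v)) ⊗ₜ[ℂ] ν =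
      (Weil.ad D.B (D.H k) (Weil.contr D.B (D.e b) v)) ⊗ₜ[ℂ] ν +
        (-D.r b k) • (Weil.contr D.B (D.e b) v ⊗ₜ[ℂ] ν)
    rw [TensorProduct.smul_tmul', ← TensorProduct.add_tmul]
    congr 1
    rw [Weil.contr_apply, Weil.contr_apply, map_sub, Weil.ad_mul, Weil.ad_mul, h1, Weil.parity_ad,
      smul_mul_assoc, mul_smul_comm]
    module
  have e2 : ∀ k, (Weil.contr D.B (D.e b)).rTensor A ∘ₗ φ (a k) =
      φ (a k) ∘ₗ (Weil.contr D.B (D.e b)).rTensor A := fun k => by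
    rw [← ha]
    exact TensorProduct.ext' fun _ _ => rfl
  have key : intW D S b (transport D S x) = quantum D S
      (homExp φ (-fun k l => (w k + (-D.r b k) • 1) * a l)
        (fmap ((Weil.contr D.B (D.e b)).rTensor A) x)) := by
    rw [hcomm, Module.End.mul_apply, ← Module.End.mul_apply (intW D S b), intW_mul_quantum,
      Module.End.mul_apply, chi_eq hw ha]
    exact congrArg _ (fmap_homExp φ _
      (fun k l => comp_map_neg φ (comp_map_mul φ (e1 k) (e2 l))) x)
  rw [key]
  refine ⟨fun h0 => ?_, fun h0 => by rw [h0, map_zero, map_zero]⟩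
  have h1 := congrArg (quantumInv D S) h0
  rw [← Module.End.mul_apply, quantumInv_mul_quantum, Module.End.one_apply, map_zero] at h1
  have h2 := congrArg (homExp φ (fun k l => (w k + (-D.r b k) • 1) * a l)) h1
  rwa [← Module.End.mul_apply, homExp_mul_neg, Module.End.one_apply, map_zero] at h2

/-- The twisted Cartan complex corresponds to the untwisted one. -/
theorem transport_mem_cartan_iff (x : Formal p (WA D S)) :
    transport D S x ∈ cartan D S ↔ ∀ m, IsBasic D S (x m) := by
  -- The twisted operators are indexed by basis vectors, whereas `IsBasic` quantifies over all of g;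
  -- linearity bridges the two.
  have hlin : ∀ F : g →ₗ[ℂ] Module.End ℂ (WA D S),
      (∀ b, fmap (F (D.e b)) x = 0) ↔ ∀ m z, F z (x m) = 0 := fun F => by
    refine ⟨fun h m z => ?_, fun h b => funext fun m => h m _⟩
    have : F.flip (x m) = 0 := D.e.ext fun b => congrFun (h b) m
    exact LinearMap.congr_fun this z
  have h1 := hlin ((LinearMap.rTensorHom A) ∘ₗ (((LinearMap.mul ℂ (Weil D.B)) -
    (LinearMap.mul ℂ (Weil D.B)).flip) ∘ₗ Weil.evenHom D.B) + LinearMap.lTensorHom (Weil D.B) ∘ₗ S.L)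
  have h2 := hlin ((LinearMap.rTensorHom A) ∘ₗ ((LinearMap.mul ℂ (Weil D.B)) -
    ((LinearMap.mul ℂ (Weil D.B)).flip.compl₁₂ LinearMap.id (Weil.parity D.B).toLinearMap)) ∘ₗ
      Weil.oddHom D.B)
  have h1' : (∀ b, fmap (lieOp D S (D.e b)) x = 0) ↔ ∀ m z, lieOp D S z (x m) = 0 := h1
  have h2' : (∀ b, fmap ((Weil.contr D.B (D.e b)).rTensor A) x = 0) ↔
      ∀ m z, (Weil.contr D.B z).rTensor A (x m) = 0 := h2
  simp only [cartan, Submodule.mem_inf, Submodule.mem_iInf, LinearMap.mem_ker, lieTot_transport,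
    intW_transport_eq_zero_iff, IsBasic, forall_and]
  rw [← h1', ← h2']
  simp only [map_eq_zero_iff _ (transport_injective D S)]

end Membership

/-! ### Transport of the braided product and of the induced product -/

section Quad

variable {W A : Type*} [AddCommGroup W] [Module ℂ W] [AddCommGroup A] [Module ℂ A]

lemma quad_left_tmul (a : Module.End ℂ W) (b : Module.End ℂ A) (x y : W ⊗[ℂ] A) :
    quad a b 1 1 (x ⊗ₜ[ℂ] y) = TensorProduct.map a b x ⊗ₜ[ℂ] y := by
  rw [quad, TensorProduct.map_one]
  rfl

lemma quad_right_tmul (c : Module.End ℂ W) (d : Module.End ℂ A) (x y : W ⊗[ℂ] A) :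
    quad 1 1 c d (x ⊗ₜ[ℂ] y) = x ⊗ₜ[ℂ] TensorProduct.map c d y := by
  rw [quad, TensorProduct.map_one]
  rfl

end Quad

lemma end_commute_neg {V : Type*} [AddCommGroup V] [Module ℂ V] {f h : Module.End ℂ V}
    (hf : Commute f h) : Commute f (-h) := hf.neg_right

section Transport

variable {g : Type u} [LieRing g] [LieAlgebra ℂ g] {ι : Type*} [Fintype ι] [DecidableEq ι] {p : ℕ}
  (D : TwistData g ι p) {A : Type v} [Ring A] [Algebra ℂ A] {𝒜 : ℤ → Submodule ℂ A}
  [GradedAlgebra 𝒜] (S : GDA g 𝒜)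

/-- A commutative algebra containing the operators of the Cartan elements on the four factors of
`(W ⊗ A) ⊗ (W ⊗ A)`. -/
structure CartanLetters (R : Type*) [CommRing R] [Algebra ℂ R] where
  φ : R →ₐ[ℂ] Module.End ℂ (WA D S ⊗[ℂ] WA D S)
  w₁ : Fin p → R
  a₁ : Fin p → R
  h₁ : Fin p → R
  w₂ : Fin p → R
  a₂ : Fin p → R
  h₂ : Fin p → R
  φ_w₁ : ∀ k, quad (adH D k) 1 1 1 = φ (w₁ k)
  φ_a₁ : ∀ k, quad 1 (S.L (D.H k)) 1 1 = φ (a₁ k)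
  φ_h₁ : ∀ k, quad (LinearMap.mulLeft ℂ (Weil.even D.B (D.H k))) 1 1 1 = φ (h₁ k)
  φ_w₂ : ∀ k, quad 1 1 (adH D k) 1 = φ (w₂ k)
  φ_a₂ : ∀ k, quad 1 1 1 (S.L (D.H k)) = φ (a₂ k)
  φ_h₂ : ∀ k, quad 1 1 (LinearMap.mulLeft ℂ (Weil.even D.B (D.H k))) 1 = φ (h₂ k)

lemma exists_cartanLetters : ∃ (R : Type (max u v)) (_ : CommRing R) (_ : Algebra ℂ R),
    Nonempty (CartanLetters D S R) := by
  obtain ⟨R, i₁, i₂, φ, w₁, a₁, h₁, w₂, a₂, h₂, ⟨e1, e2, e3⟩, e4, e5, e6⟩ :=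
    exists_algHom_quad (commute_adH_adH D) (commute_adH_mulLeft_H D) (commute_mulLeft_H D)
      (commute_L_H D S)
  exact ⟨R, i₁, i₂, ⟨φ, w₁, a₁, h₁, w₂, a₂, h₂, e1, e2, e3, e4, e5, e6⟩⟩

variable {D S} {R : Type*} [CommRing R] [Algebra ℂ R] (C : CartanLetters D S R)

lemma pair_transport (x y : Formal p (WA D S)) :
    pair D S (transport D S x) (transport D S y) =
      (homExp C.φ (-fun k l => C.w₁ k * C.a₁ l) * homExp C.φ (fun k l => C.h₁ l * C.w₁ k) *
        homExp C.φ (-fun k l => C.w₂ k * C.a₂ l) * homExp C.φ (fun k l => C.h₂ l * C.w₂ k))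
        (pair D S x y) := by
  have hleft : ∀ x y, pair D S (transport D S x) y =
      (homExp C.φ (-fun k l => C.w₁ k * C.a₁ l) * homExp C.φ (fun k l => C.h₁ l * C.w₁ k))
        (pair D S x y) := by
    intro x y
    rw [transport, Module.End.mul_apply, chi, twist, pair,
      fmap₂_thetaExp_left (Q' := fun k l => C.φ (C.w₁ k * C.a₁ l)), thetaExp_neg_eq_homExp, quantum,
      fmap₂_thetaExp_left (Q' := fun k l => C.φ (C.h₁ l * C.w₁ k))]
    · rfl
    · intro k l u t
      rw [map_mul, ← C.φ_w₁, ← C.φ_h₁, Module.End.mul_apply, TensorProduct.mk_apply,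
        TensorProduct.mk_apply, quad_left_tmul, quad_left_tmul, LinearMap.rTensor_mul]
      rfl
    · intro k l u t
      rw [map_mul, ← C.φ_w₁, ← C.φ_a₁, Module.End.mul_apply, Module.End.mul_apply, TensorProduct.mk_apply,
        TensorProduct.mk_apply, quad_left_tmul, quad_left_tmul]
      rfl
  have hright : ∀ x y, pair D S x (transport D S y) =
      (homExp C.φ (-fun k l => C.w₂ k * C.a₂ l) * homExp C.φ (fun k l => C.h₂ l * C.w₂ k))
        (pair D S x y) := by
    intro x y
    rw [transport, Module.End.mul_apply, chi, twist, pair,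
      fmap₂_thetaExp_right (Q' := fun k l => C.φ (C.w₂ k * C.a₂ l)), thetaExp_neg_eq_homExp, quantum,
      fmap₂_thetaExp_right (Q' := fun k l => C.φ (C.h₂ l * C.w₂ k))]
    · rfl
    · intro k l u t
      rw [map_mul, ← C.φ_w₂, ← C.φ_h₂, Module.End.mul_apply, TensorProduct.mk_apply,
        TensorProduct.mk_apply, quad_right_tmul, quad_right_tmul, LinearMap.rTensor_mul]
      rfl
    · intro k l u t
      rw [map_mul, ← C.φ_w₂, ← C.φ_a₂, Module.End.mul_apply, Module.End.mul_apply, TensorProduct.mk_apply,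
        TensorProduct.mk_apply, quad_right_tmul, quad_right_tmul]
      rfl
  rw [hleft, hright]
  rfl

/-- An equivariant product of transported elements. -/
lemma fmap_pair_transport {f : WA D S ⊗[ℂ] WA D S →ₗ[ℂ] WA D S} (hf : IsEquivariantMul D S f)
    (q : Fin p → Fin p → R) (x y : Formal p (WA D S)) :
    fmap f (homExp C.φ q (pair D S (transport D S x) (transport D S y))) =
      transport D S (fmap f (homExp C.φ (fun k l => C.w₁ k * C.a₂ l + C.w₂ k * C.a₁ l +
        C.w₁ k * C.w₂ l + q k l) (pair D S x y))) := by
  obtain ⟨R', _, _, ψ, w, a, h, hw, ha, hh⟩ := exists_cartanOperators D S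
  have key := fmap_twist_pair C.φ ψ f (w := w) (a := a) (h := h) (w₁ := C.w₁) (a₁ := C.a₁)
    (h₁ := C.h₁) (w₂ := C.w₂) (a₂ := C.a₂) (h₂ := C.h₂)
    (fun k => by rw [map_add, ← C.φ_w₁, ← C.φ_w₂, ← hw]; exact (hf.ad (D.H k)).symm)
    (fun k => by rw [map_add, ← C.φ_a₁, ← C.φ_a₂, ← ha]; exact (hf.lie (D.H k)).symm)
    (fun k => by rw [← C.φ_h₁, ← hh]; exact (hf.left (D.H k)).symm)
    (fun k => by
      rw [map_sub, map_add, LinearMap.comp_sub, ← C.φ_h₁, ← C.φ_h₂, ← C.φ_w₁, sub_eq_zero]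
      exact hf.middle (D.H k)) (homExp C.φ q (pair D S x y))
  rw [← chi_eq hw ha, ← quantum_eq hw hh, ← Module.End.mul_apply (homExp C.φ _) (homExp C.φ q)] at key
  simp only [homExp_mul] at key
  refine Eq.trans ?_ key
  rw [pair_transport C]
  simp only [homExp_mul]
  rw [← Module.End.mul_apply, ← Module.End.mul_apply, homExp_mul, homExp_mul, add_comm]

/-- The factor w₂ + a₂ is the total action of H_l on the second argument, which vanishes on
invariant elements. -/
lemma homExp_pair_eq_self (x : Formal p (WA D S)) {y : Formal p (WA D S)}
    (hy : ∀ m z, lieOp D S z (y m) = 0) (q : Fin p → R) :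
    homExp C.φ (fun k l => q k * (C.w₂ l + C.a₂ l)) (pair D S x y) = pair D S x y := by
  refine thetaExp_apply_eq_self _ (thetaSum_eq_zero fun k l => ?_)
  funext m
  rw [fmap_apply, pair, fmap₂_apply, map_sum]
  refine Finset.sum_eq_zero fun ij _ => ?_
  have h : C.φ (C.w₂ l + C.a₂ l) (x ij.1 ⊗ₜ[ℂ] y ij.2) = 0 := by
    rw [map_add, ← C.φ_w₂, ← C.φ_a₂, LinearMap.add_apply, quad_right_tmul, quad_right_tmul,
      ← TensorProduct.tmul_add]
    refine (congrArg _ (hy ij.2 (D.H l))).trans (TensorProduct.tmul_zero _ _)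
  rw [map_mul, Module.End.mul_apply, TensorProduct.mk_apply, h, map_zero]

variable (D S)

/-- The R-matrix and the twist in ·_χ contribute 2 a₁_k w₂_l + a₁_k a₂_l up to symmetric terms.
Added to the exponent left over from the transport, this factors as (w₁ + a₁)_k (w₂ + a₂)_l. The
R-matrix is exactly what makes the factorization possible. -/
lemma braidedMul_transport (x : Formal p (WA D S)) {y : Formal p (WA D S)}
    (hy : ∀ m z, lieOp D S z (y m) = 0) :
    braidedMul D S (transport D S x) (transport D S y) =
      transport D S (fmap (superMul D S) (pair D S x y)) := by
  obtain ⟨R, _, _, ⟨C⟩⟩ := exists_cartanLetters D S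
  have h1 : (fun k => ((S.L (D.H k)).lTensor (Weil D.B)).rTensor (WA D S)) =
      fun k => C.φ (C.a₁ k) := by
    funext k
    rw [← C.φ_a₁, quad, TensorProduct.map_one]
    rfl
  have h2 : (fun k => ((adH D k).rTensor A).lTensor (WA D S)) = fun k => C.φ (C.w₂ k) := by
    funext k
    rw [← C.φ_w₂, quad, TensorProduct.map_one]
    rfl
  have h3 : (fun k => ((S.L (D.H k)).lTensor (Weil D.B)).lTensor (WA D S)) =
      fun k => C.φ (C.a₂ k) := by
    funext k
    rw [← C.φ_a₂, quad, TensorProduct.map_one]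
    rfl
  rw [braidedMul, h1, h2, h3, rMatrix, twistInv_eq_homExp, twistInv_eq_homExp, twist_eq_homExp,
    homExp_mul, ← Module.End.mul_apply, homExp_mul,
    fmap_pair_transport C (isEquivariantMul_superMul D S)]
  refine congrArg _ (congrArg _ (Eq.trans ?_
    (homExp_pair_eq_self C x hy fun k => C.w₁ k + C.a₁ k)))
  refine LinearMap.congr_fun (homExp_congr C.φ fun k l => ?_) _
  simp only [Pi.add_apply, Pi.neg_apply]
  ring

lemma fmap_nilExp {V : Type*} [AddCommGroup V] [Module ℂ V] {T : Module.End ℂ V}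
    (hT : IsNilpotent T) : nilExp (fmap T : Module.End ℂ (Formal p V)) = fmap (nilExp T) :=
  (map_nilExp (fmapHom p V) hT).symm

/-- The induced product of transported elements. -/
theorem cartanMul_transport (hA : GradedCommutative 𝒜) {x y : Formal p (WA D S)}
    (hx : ∀ m, IsBasic D S (x m)) (hy : ∀ m, IsBasic D S (y m)) :
    cartanMul D S (transport D S x) (transport D S y) =
      transport D S (fmap (explicitOp D S) (pair D S x y)) := by
  have hK := isNilpotent_kalkmanOp D S
  have h1 : ∀ z, kalkman D S (transport D S z) =
      transport D S (fmap (nilExp (kalkmanOp D S)) z) := fun z => by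
    rw [← fmap_nilExp hK]
    change chi D S (quantum D S (nilExp (kalkmanGen D S) (transportInv D S (transport D S z)))) = _
    rw [transportInv_transport]
    rfl
  have h2 : ∀ z, kalkmanInv D S (transport D S z) =
      transport D S (fmap (nilExp (-kalkmanOp D S)) z) := fun z => by
    rw [← fmap_nilExp (end_neg_isNilpotent hK)]
    change chi D S (quantum D S (nilExp (-kalkmanGen D S) (transportInv D S (transport D S z)))) = _
    rw [transportInv_transport]
    rfl
  -- The braided product is evaluated on the images under the inverse Kalkman map. These need not be
  -- horizontal, but they remain invariant, which is all that the transport requires.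
  have hinv : ∀ m z, lieOp D S z (fmap (nilExp (-kalkmanOp D S)) y m) = 0 := fun m z => by
    have hc : Commute (lieOp D S z) (nilExp (-kalkmanOp D S)) :=
      commute_nilExp (end_commute_neg (commute_lieOp_kalkmanOp D S z))
    rw [fmap_apply, ← Module.End.mul_apply, hc.eq, Module.End.mul_apply, (hy m).1, map_zero]
  rw [cartanMul, h2, h2, braidedMul_transport D S _ hinv, h1]
  congr 1
  funext m
  simp only [fmap_apply, pair, fmap₂_apply, map_sum, TensorProduct.mk_apply]
  exact Finset.sum_congr rfl fun ij _ => kalkman_superMul_of_isBasic D S hA (hx _) (hy _)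

end Transport

/-! ### Transport of the explicit product -/

lemma fextend_comp_const {p : ℕ} {U V Z : Type*} [AddCommGroup U] [Module ℂ U] [AddCommGroup V]
    [Module ℂ V] [AddCommGroup Z] [Module ℂ Z] {G : Formal p V →ₗ[ℂ] Formal p Z} (hG : IsFormal G)
    (s : U →ₗ[ℂ] V) (x : Formal p U) : fextend ((G ∘ₗ const p) ∘ₗ s) x = G (fmap s x) := by
  have h : (G ∘ₗ const p) ∘ₗ s = (G ∘ₗ fmap s) ∘ₗ const p :=
    LinearMap.ext fun u => congrArg G (fmap_const s u).symm
  rw [h, hG.comp (isFormal_fmap s)]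
  rfl

section Explicit

variable {g : Type u} [LieRing g] [LieAlgebra ℂ g] {ι : Type*} [Fintype ι] [DecidableEq ι] {p : ℕ}
  (D : TwistData g ι p) {A : Type v} [Ring A] [Algebra ℂ A] {𝒜 : ℤ → Submodule ℂ A}
  [GradedAlgebra 𝒜] (S : GDA g 𝒜)

lemma i_L_H_apply (b : ι) (k : Fin p) (ν : A) :
    S.i (D.e b) (S.L (D.H k) ν) + D.r b k • S.i (D.e b) ν = S.L (D.H k) (S.i (D.e b) ν) := by
  rw [L_i_apply, D.weight, map_smul]
  rfl

/-- The twisted interior derivatives on `A_χ ⊗ A_χ` are conjugate to the untwisted ones. -/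
lemma twistInv_mul_intLeft_mul_intRight (b c : ι) :
    twistInv (fun k => (S.L (D.H k)).rTensor A) (fun l => (S.L (D.H l)).lTensor A) *
        (intLeft D S b * intRight D S c) =
      fmap (TensorProduct.map (S.i (D.e b) * parity 𝒜) (S.i (D.e c))) *
        twistInv (fun k => (S.L (D.H k)).rTensor A) (fun l => (S.L (D.H l)).lTensor A) := by
  obtain ⟨R, _, _, φ, x, y, -, hx, hy, -⟩ := exists_algHom_map (commute_L_H D S) (commute_L_H D S)
    (commute_L_H D S) (commute_L_H D S)
  have hx' : ∀ k, (S.L (D.H k)).rTensor A = φ (x k) := hx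
  have hy' : ∀ k, (S.L (D.H k)).lTensor A = φ (y k) := hy
  have e0 : twistInv (fun k => (S.L (D.H k)).rTensor A) (fun l => (S.L (D.H l)).lTensor A) =
      homExp φ fun k l => x k * y l := by
    simp only [hx', hy', twistInv_eq_homExp]
  have e1 : intLeft D S b = fmap ((S.i (D.e b)).rTensor A) *
      homExp φ (-fun k l => D.r b k • y l) := by
    simp only [intLeft, hy', ← map_smul, thetaExp_neg_eq_homExp]
  have e2 : intRight D S c = fmap (TensorProduct.map (parity 𝒜) (S.i (D.e c))) *
      homExp φ (fun k l => D.r c k • x l) := by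
    simp only [intRight, hx', ← map_smul, homExp]
  have l1 : ∀ k, (S.i (D.e b)).rTensor A ∘ₗ φ (x k + D.r b k • 1) =
      φ (x k) ∘ₗ (S.i (D.e b)).rTensor A := fun k => by
    refine TensorProduct.ext' fun ν₁ ν₂ => ?_
    rw [LinearMap.comp_apply, LinearMap.comp_apply, map_smul_one_apply, ← hx', map_add, map_smul]
    simp only [LinearMap.rTensor_tmul]
    rw [TensorProduct.smul_tmul', ← TensorProduct.add_tmul, i_L_H_apply]
  have l2 : ∀ k, (S.i (D.e b)).rTensor A ∘ₗ φ (y k) =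
      φ (y k) ∘ₗ (S.i (D.e b)).rTensor A := fun k => by
    rw [← hy']
    exact TensorProduct.ext' fun _ _ => rfl
  have r1 : ∀ k, TensorProduct.map (parity 𝒜) (S.i (D.e c)) ∘ₗ φ (x k) =
      φ (x k) ∘ₗ TensorProduct.map (parity 𝒜) (S.i (D.e c)) := fun k => by
    rw [← hx']
    refine TensorProduct.ext' fun ν₁ ν₂ => ?_
    exact congrArg (· ⊗ₜ[ℂ] _) (LinearMap.congr_fun (parity_mul_L S (D.H k)) ν₁)
  have r2 : ∀ k, TensorProduct.map (parity 𝒜) (S.i (D.e c)) ∘ₗ φ (y k + D.r c k • 1) =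
      φ (y k) ∘ₗ TensorProduct.map (parity 𝒜) (S.i (D.e c)) := fun k => by
    refine TensorProduct.ext' fun ν₁ ν₂ => ?_
    rw [LinearMap.comp_apply, LinearMap.comp_apply, map_smul_one_apply, ← hy', map_add, map_smul]
    simp only [LinearMap.lTensor_tmul, TensorProduct.map_tmul]
    rw [← TensorProduct.tmul_smul, ← TensorProduct.tmul_add, i_L_H_apply]
  have c1 : homExp φ (fun k l => x k * y l) * fmap ((S.i (D.e b)).rTensor A) =
      fmap ((S.i (D.e b)).rTensor A) * homExp φ (fun k l => (x k + D.r b k • 1) * y l) :=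
    LinearMap.ext fun z =>
      (fmap_homExp φ _ (fun k l => comp_map_mul φ (l1 k) (l2 l)) z).symm
  have c2 : homExp φ (fun k l => x k * y l) *
        fmap (TensorProduct.map (parity 𝒜) (S.i (D.e c))) =
      fmap (TensorProduct.map (parity 𝒜) (S.i (D.e c))) *
        homExp φ (fun k l => x k * (y l + D.r c l • 1)) :=
    LinearMap.ext fun z =>
      (fmap_homExp φ _ (fun k l => comp_map_mul φ (r1 k) (r2 l)) z).symm
  -- Moving the twist past i_b shifts x_k by r_k(b), and λ_b⁻¹ cancels this exactly.
  have c3 : homExp φ (fun k l => (x k + D.r b k • 1) * y l) *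
      homExp φ (-fun k l => D.r b k • y l) = homExp φ (fun k l => x k * y l) := by
    rw [homExp_mul]
    refine homExp_congr φ fun k l => ?_
    simp only [Pi.add_apply, Pi.neg_apply, Algebra.smul_def, mul_one]
    ring
  -- Here the shift of y_l by r_l(c) is cancelled by λ_c only up to the symmetric expression x_k
  -- r_l(c) + r_k(c) x_l.
  have c4 : homExp φ (fun k l => x k * (y l + D.r c l • 1)) *
      homExp φ (fun k l => D.r c k • x l) = homExp φ (fun k l => x k * y l) := by
    rw [homExp_mul]
    refine homExp_congr φ fun k l => ?_
    simp only [Pi.add_apply, Algebra.smul_def, mul_one]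
    ring
  have c5 : fmap (TensorProduct.map (S.i (D.e b) * parity 𝒜) (S.i (D.e c))) =
      (fmap ((S.i (D.e b)).rTensor A) * fmap (TensorProduct.map (parity 𝒜) (S.i (D.e c))) :
        Module.End ℂ (Formal p (A ⊗[ℂ] A))) := by
    rw [← fmap_mul]
    exact congrArg fmap (TensorProduct.ext' fun _ _ => rfl)
  have s1 : homExp φ (fun k l => x k * y l) * intLeft D S b =
      fmap ((S.i (D.e b)).rTensor A) * homExp φ (fun k l => x k * y l) := by
    rw [e1, ← mul_assoc, c1, mul_assoc, c3]
  have s2 : homExp φ (fun k l => x k * y l) * intRight D S c =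
      fmap (TensorProduct.map (parity 𝒜) (S.i (D.e c))) * homExp φ (fun k l => x k * y l) := by
    rw [e2, ← mul_assoc, c2, mul_assoc, c4]
  rw [e0, c5, ← mul_assoc, s1, mul_assoc, s2, ← mul_assoc]

/-- Conjugation by the twist in ·_χ turns the twisted interior derivatives into ordinary ones, so
the exponential of the former is conjugate to the exponential of the latter. -/
lemma twistInv_mul_expInt :
    twistInv (fun k => (S.L (D.H k)).rTensor A) (fun l => (S.L (D.H l)).lTensor A) * expInt D S =
      fmap (nilExp ((1 / 2 : ℂ) • intTensor D S)) *
        twistInv (fun k => (S.L (D.H k)).rTensor A) (fun l => (S.L (D.H l)).lTensor A) := by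
  set E := (twistInv (fun k => (S.L (D.H k)).rTensor A) (fun l => (S.L (D.H l)).lTensor A) :
    Module.End ℂ (Formal p (A ⊗[ℂ] A))) with hE
  have hinv : ∃ E', E' * E = 1 := by
    obtain ⟨R, _, _, φ, x, y, -, hx, hy, -⟩ := exists_algHom_map (commute_L_H D S)
      (commute_L_H D S) (commute_L_H D S) (commute_L_H D S)
    have hx' : ∀ k, (S.L (D.H k)).rTensor A = φ (x k) := hx
    have hy' : ∀ k, (S.L (D.H k)).lTensor A = φ (y k) := hy
    refine ⟨homExp φ (-fun k l => x k * y l), ?_⟩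
    rw [hE]
    simp only [hx', hy', twistInv_eq_homExp]
    exact homExp_neg_mul φ _
  obtain ⟨E', hE'⟩ := hinv
  have hT := (isNilpotent_intTensor D S).smul (1 / 2 : ℂ)
  set N := (1 / 2 : ℂ) • ∑ b, ∑ c, Bup D b c • (intLeft D S b * intRight D S c) with hN
  have key : E * N = fmap ((1 / 2 : ℂ) • intTensor D S) * E := by
    have h1 : fmap ((1 / 2 : ℂ) • intTensor D S) = ((1 / 2 : ℂ) • ∑ b, ∑ c, Bup D b c •
        fmap (TensorProduct.map (S.i (D.e b) * parity 𝒜) (S.i (D.e c))) :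
          Module.End ℂ (Formal p (A ⊗[ℂ] A))) := by
      simp only [fmap_eq_fmapHom, intTensor, map_smul, map_sum]
    rw [h1, hN, mul_smul_comm, smul_mul_assoc, Finset.mul_sum, Finset.sum_mul]
    refine congrArg _ (Finset.sum_congr rfl fun b _ => ?_)
    rw [Finset.mul_sum, Finset.sum_mul]
    refine Finset.sum_congr rfl fun c _ => ?_
    rw [mul_smul_comm, smul_mul_assoc, hE, twistInv_mul_intLeft_mul_intRight]
  have hM : IsNilpotent (fmap ((1 / 2 : ℂ) • intTensor D S) :
      Module.End ℂ (Formal p (A ⊗[ℂ] A))) := hT.map (fmapHom p (A ⊗[ℂ] A))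
  -- Nilpotency of the twisted exponent is inherited through the conjugation, for which a left
  -- inverse of the twist is enough.
  have hNn : IsNilpotent N := by
    obtain ⟨n, hn⟩ := hM
    have hs : SemiconjBy E N (fmap ((1 / 2 : ℂ) • intTensor D S)) := key
    have := (hs.pow_right n).eq
    rw [hn, zero_mul] at this
    exact ⟨n, by rw [← one_mul (N ^ n), ← hE', mul_assoc, this, mul_zero]⟩
  have := nilExp_intertwine hNn hM E key
  rw [fmap_nilExp hT] at this
  exact this

lemma mulChi_expInt (t : Formal p (A ⊗[ℂ] A)) :
    mulChi D S (expInt D S t) =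
      fmap (LinearMap.mul' ℂ A ∘ₗ nilExp ((1 / 2 : ℂ) • intTensor D S))
        (thetaExp (Complex.I / 2)
          (fun k l => TensorProduct.map (S.L (D.H k)) (S.L (D.H l))) t) := by
  have h := LinearMap.congr_fun (twistInv_mul_expInt D S) t
  have h' : (fun k l => TensorProduct.map (S.L (D.H k)) (S.L (D.H l))) =
      fun k l => (S.L (D.H k)).rTensor A * (S.L (D.H l)).lTensor A := by
    funext k l
    exact TensorProduct.ext' fun _ _ => rfl
  rw [mulChi, LinearMap.comp_apply, ← Module.End.mul_apply, twistInv_mul_expInt, h']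
  rfl

/-- Exhibits the prescription on constants as the restriction of a θ-linear continuous map, so that
its extension by `fextend` is that map. -/
lemma applyExp_eq : applyExp D S =
    (fmap ((LinearMap.mul' ℂ A ∘ₗ nilExp ((1 / 2 : ℂ) • intTensor D S)).lTensor (Weil D.B)) ∘ₗ
      thetaExp (Complex.I / 2) fun k l =>
        (TensorProduct.map (S.L (D.H k)) (S.L (D.H l))).lTensor (Weil D.B)) ∘ₗ const p := by
  refine TensorProduct.ext' fun w t => ?_
  have h : const p (w ⊗ₜ[ℂ] t) = fmap (TensorProduct.mk ℂ (Weil D.B) (A ⊗[ℂ] A) w) (const p t) :=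
    (fmap_const (TensorProduct.mk ℂ (Weil D.B) (A ⊗[ℂ] A) w) t).symm
  rw [LinearMap.comp_apply, LinearMap.comp_apply, h,
    ← fmap_thetaExp (Q := fun k l => TensorProduct.map (S.L (D.H k)) (S.L (D.H l))) _ _
      fun k l => rfl]
  change fmap (TensorProduct.mk ℂ (Weil D.B) A w) (mulChi D S (expInt D S (const p t))) = _
  rw [mulChi_expInt]
  rfl

lemma gradedFlip_comp_map_L (x y : g) :
    TensorProduct.map (S.L x) (S.L y) ∘ₗ gradedFlip 𝒜 =
      gradedFlip 𝒜 ∘ₗ TensorProduct.map (S.L y) (S.L x) := by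
  refine ext_homogeneous 𝒜 fun m n ν₁ h₁ ν₂ h₂ => ?_
  rw [LinearMap.comp_apply, LinearMap.comp_apply, gradedFlip_tmul_of_mem h₁ h₂, map_smul,
    TensorProduct.map_tmul, TensorProduct.map_tmul,
    gradedFlip_tmul_of_mem (S.L_mem y m ν₁ h₁) (S.L_mem x n ν₂ h₂)]

/-- The factors of A are flipped before ·_χ acts, so the twist appears with a₂ in the first slot and
a₁ in the second, opposite to its sign in the braided product. -/
lemma explicitMul_eq {R : Type*} [CommRing R] [Algebra ℂ R] (C : CartanLetters D S R)
    (x y : Formal p (WA D S)) :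
    explicitMul D S x y =
      fmap (explicitOp D S) (homExp C.φ (fun k l => C.a₂ k * C.a₁ l) (pair D S x y)) := by
  have h1 : ∀ k l, swapMul D S ∘ₗ C.φ (C.a₂ k * C.a₁ l) =
      (TensorProduct.map (S.L (D.H k)) (S.L (D.H l))).lTensor (Weil D.B) ∘ₗ swapMul D S := by
    intro k l
    rw [map_mul, ← C.φ_a₁, ← C.φ_a₂, quad_mul, swapMul_eq, ← LinearMap.comp_assoc,
      ← LinearMap.lTensor_comp, gradedFlip_comp_map_L, LinearMap.lTensor_comp,
      LinearMap.comp_assoc, LinearMap.comp_assoc]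
    exact congrArg _ (ext_quad D S fun _ _ _ _ => rfl)
  rw [explicitMul, applyExp_eq, fextend_comp_const ((isFormal_fmap _).comp (isFormal_thetaExp _ _)),
    LinearMap.comp_apply]
  have h4 := fmap_thetaExp (Complex.I / 2) (swapMul D S) h1 (pair D S x y)
  rw [← h4]
  rfl

/-- The explicit product of transported elements. -/
theorem explicitMul_transport (x : Formal p (WA D S)) {y : Formal p (WA D S)}
    (hy : ∀ m, IsBasic D S (y m)) :
    explicitMul D S (transport D S x) (transport D S y) =
      transport D S (fmap (explicitOp D S) (pair D S x y)) := by
  obtain ⟨R, _, _, ⟨C⟩⟩ := exists_cartanLetters D S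
  rw [explicitMul_eq D S C, fmap_pair_transport C (isEquivariantMul_explicitOp D S)]
  refine congrArg _ (congrArg _ (Eq.trans ?_
    (homExp_pair_eq_self C x (fun m => (hy m).1) fun k => C.w₁ k - C.a₁ k)))
  -- Modulo symmetric terms, w₂_k a₁_l and a₂_k a₁_l become -a₁_k w₂_l and -a₁_k a₂_l, and the
  -- exponent factors as (w₁ - a₁)_k (w₂ + a₂)_l.
  refine LinearMap.congr_fun (homExp_congr C.φ fun k l => ?_) _
  ring

lemma isBasic_sum {κ : Type*} (s : Finset κ) {f : κ → WA D S} (h : ∀ i ∈ s, IsBasic D S (f i)) :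
    IsBasic D S (∑ i ∈ s, f i) := by
  refine ⟨fun z => ?_, fun z => ?_⟩
  · rw [map_sum]
    exact Finset.sum_eq_zero fun i hi => (h i hi).1 z
  · rw [map_sum]
    exact Finset.sum_eq_zero fun i hi => (h i hi).2 z

theorem cartanMul_mem_and_eq (hA : GradedCommutative 𝒜) {x y : Formal p (WA D S)}
    (hx : x ∈ cartan D S) (hy : y ∈ cartan D S) :
    cartanMul D S x y ∈ cartan D S ∧ cartanMul D S x y = explicitMul D S x y := by
  obtain ⟨x, rfl⟩ : ∃ x₀, transport D S x₀ = x := ⟨_, transport_transportInv D S x⟩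
  obtain ⟨y, rfl⟩ : ∃ y₀, transport D S y₀ = y := ⟨_, transport_transportInv D S y⟩
  rw [transport_mem_cartan_iff] at hx hy
  rw [cartanMul_transport D S hA hx hy, explicitMul_transport D S x hy]
  refine ⟨(transport_mem_cartan_iff D S _).2 fun m => ?_, rfl⟩
  rw [fmap_apply, pair, fmap₂_apply, map_sum]
  exact isBasic_sum D S _ fun ij _ => (hx _).explicitOp D S (hy _)

theorem explicitMul_const (u₁ u₂ : Weil D.B) {n₁ n₂ : ℤ} {ν₁ ν₂ : A} (h₁ : ν₁ ∈ 𝒜 n₁)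
    (h₂ : ν₂ ∈ 𝒜 n₂) :
    explicitMul D S (const p (u₁ ⊗ₜ[ℂ] ν₁)) (const p (u₂ ⊗ₜ[ℂ] ν₂)) =
      fmap (TensorProduct.mk ℂ (Weil D.B) A (u₁ * u₂))
        ((n₁ * n₂).negOnePow • mulChi D S (expInt D S (const p (ν₂ ⊗ₜ[ℂ] ν₁)))) := by
  rw [explicitMul, pair, fmap₂_const_const, fextend_const, LinearMap.comp_apply,
    TensorProduct.mk_apply, swapMul_eq, LinearMap.comp_apply, mulFirst_tmul,
    LinearMap.lTensor_tmul, gradedFlip_tmul_of_mem h₁ h₂, TensorProduct.tmul_smul, map_smul,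
    units_smul_eq, map_smul]
  rfl

end Explicit

end TwistedCartan

end

theorem mainTheorem5 {g : Type*} [LieRing g] [LieAlgebra ℂ g] {ι : Type*} [Fintype ι]
    [DecidableEq ι] {p : ℕ} (D : TwistedCartan.TwistData g ι p) {A : Type*} [Ring A] [Algebra ℂ A]
    {𝒜 : ℤ → Submodule ℂ A} [GradedAlgebra 𝒜] (S : TwistedCartan.GDA g 𝒜)
    (hA : TwistedCartan.GradedCommutative 𝒜) :
    (∀ x ∈ TwistedCartan.cartan D S, ∀ y ∈ TwistedCartan.cartan D S,
      TwistedCartan.cartanMul D S x y ∈ TwistedCartan.cartan D S ∧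
      TwistedCartan.cartanMul D S x y = TwistedCartan.explicitMul D S x y) ∧
    ∀ (u₁ u₂ : TwistedCartan.Weil D.B) (n₁ n₂ : ℤ), ∀ ν₁ ∈ 𝒜 n₁, ∀ ν₂ ∈ 𝒜 n₂,
      TwistedCartan.explicitMul D S (TwistedCartan.const p (u₁ ⊗ₜ[ℂ] ν₁))
          (TwistedCartan.const p (u₂ ⊗ₜ[ℂ] ν₂)) =
        TwistedCartan.fmap (TensorProduct.mk ℂ (TwistedCartan.Weil D.B) A (u₁ * u₂))
          ((n₁ * n₂).negOnePow • TwistedCartan.mulChi D S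
            (TwistedCartan.expInt D S (TwistedCartan.const p (ν₂ ⊗ₜ[ℂ] ν₁)))) := by
  exact ⟨fun _ hx _ hy => TwistedCartan.cartanMul_mem_and_eq D S hA hx hy,
    fun u₁ u₂ _ _ _ h₁ _ h₂ => TwistedCartan.explicitMul_const D S u₁ u₂ h₁ h₂⟩
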